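/- **Setting.** Let $V(x,y)=\sum_{i=1}^4\psi^{(i)}(x,y)$ be a Müller–Brown potential, $\psi^{(i)}=\alpha^{(i)}\exp\big(a^{(i)}(x-x_0^{(i)})^2+b^{(i)}(x-x_0^{(i)})(y-y_0^{(i)})+c^{(i)}(y-y_0^{(i)})^2\big)$, with arbitrary real parameters. With $w_1^{(i)}=2a^{(i)}x_0^{(i)}+b^{(i)}y_0^{(i)}$, $w_2^{(i)}=b^{(i)}x_0^{(i)}+2c^{(i)}y_0^{(i)}$, $L_1^{(i)}(X)=2a^{(i)}X^{(1)}+b^{(i)}X^{(2)}-w_1^{(i)}$, $L_2^{(i)}(X)=b^{(i)}X^{(1)}+2c^{(i)}X^{(2)}-w_2^{(i)}$ and $G_s=\sum_i L_s^{(i)}X^{(i+2)}$, the extended polynomial vector field $f:\mathbb R^6\to\mathbb R^6$ is $f^{(1)}=-G_1$, $f^{(2)}=-G_2$, $f^{(j+2)}=-(L_1^{(j)}G_1+L_2^{(j)}G_2)X^{(j+2)}$, $j=1,\dots,4$. **Saddle and unstable manifold.** Let $q_0\in\mathbb R^2$ be a saddle of $V$ (a critical point at which $-D^2V$ has one positive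 and one negative eigenvalue), $X_0=(q_0,\psi(q_0))$, $\lambda>0$ the unstable eigenvalue of $Df(X_0)$, $v$ an associated eigenvector, $\gamma>0$. Let $\hat p(\theta)=\sum_{n<N}p_n\theta^n$ ($N\ge2$) be a validated parameterization of a local unstable manifold with validation radius $\bar r>0$ and weights $\eta_p\in\mathbb R^6_{>0}$; that is, it is the truncation of an absolutely summable series $p(\theta)=\sum_{n\ge0}p_n\theta^n$ with $p_0=X_0$, $p_1=\gamma v$, $\lambda\theta p'(\theta)=f(p(\theta))$ on $[-1,1]$ and $\sum_{i}\sum_{n\ge N}|p_n^{(i)}|\eta_p^{(i)}\le\bar r$. **Data for the orbit.** Let $\nu>1$, $M,K\ge1$, $\tau>0$, $0=t^{(0)}<\dots<t^{(M)}=\tau$, $\eta\in\mathbb R^{6M}_{>0}$, $h_m=t^{(m)}-t^{(m-1)}$. A family $\mathbf X=(\mathbf X^{(m,i)}_k)_{1\le m\le M,\,1\le i\le6,\,k\ge0}$ represents the function equal to $\mathbf X_0^{(m)}+2\sum_{k\ge1}\mathbf X^{(m)}_kT_k\big((2t-t^{(m)}-t^{(m-1)})/h_m\big)$ on $[t^{(m-1)},t^{(m)}]$.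 Put $\xi_0=1$, $\xi_k=2\nu^k$ ($k\ge1$), $\|u\|_\nu=\sum_k|u_k|\xi_k$, $\|\mathbf X^{(m)}\|_m=\sum_i\|\mathbf X^{(m,i)}\|_\nu\eta^{(m,i)}$ and $\|\mathbf X\|_{\mathcal X_{\eta,\nu}}=\max_m\|\mathbf X^{(m)}\|_m$; $\mathcal X_{\eta,\nu}$ is the space of $\mathbf X$ with finite norm. Let $\mathbf f$ be the action of $f$ on Chebyshev coefficients (products replaced by $(u*v)_k=\sum_{l\in\mathbb Z}u_{|l|}v_{|k-l|}$), and define $$\mathbf F_0^{(m)}(\mathbf X)=\mathbf X_0^{(m)}+2\sum_{k\ge1}(-1)^k\mathbf X_k^{(m)}-\Big(\mathbf X_0^{(m-1)}+2\sum_{k\ge1}\mathbf X_k^{(m-1)}\Big),\qquad \mathbf F_k^{(m)}(\mathbf X)=k\mathbf X_k^{(m)}-\tfrac{h_m}{4}\big(\mathbf f_{k-1}(\mathbf X^{(m)})-\mathbf f_{k+1}(\mathbf X^{(m)})\big)\ (k\ge1),$$ where for $m=1$ the bracket is replaced by $p(1)$. Let $\bar{\mathbf X}\in\mathbb R^{6MK}$,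 extended by zero. Let $\mathbf A^\dagger$ act as the Jacobian at $\bar{\mathbf X}$ of the truncation of $\mathbf F$ to the modes $k<K$ on these modes, and as multiplication by $k$ on the modes $k\ge K$. Let $\mathbf A$ act as a given $6MK\times6MK$ matrix $\mathbf A^{[K]}$ on the modes $k<K$, and as multiplication by $1/k$ on the modes $k\ge K$. **Bounds.** For an infinite matrix $\mathbf B$ on $\mathcal X_{\eta,\nu}$ put $\|\mathbf B^{(m,i;n,j)}\|_\nu=\sup_l\frac1{\xi_l}\sum_k|\mathbf B^{(m,i;n,j)}_{k,l}|\xi_k$. Define * $Y^{(m)}=\|(\mathbf A\mathbf F(\bar{\mathbf X}))^{(m)}\|_m$; * $Z_0^{(m)}=\sum_n\max_j\frac1{\eta^{(n,j)}}\sum_i\|\mathbf B^{(m,i;n,j)}\|_\nu\,\eta^{(m,i)}$ with $\mathbf B=I-\mathbf A\mathbf A^\dagger$; * $Z_1^{(m)}=\sum_n\max_j\frac1{\eta^{(n,j)}}\sum_i\max\big(\mathfrak C_{\rm finite}^{(m,i;n,j)},\mathfrak C_{\rm tail}^{(m,i;n,j)}\big)\eta^{(m,i)}$, where, with $\mathbf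 C=\mathbf A(D\mathbf F(\bar{\mathbf X})-\mathbf A^\dagger)$, $\mathfrak C_{\rm finite}^{(m,i;n,j)}=\max_{0\le l\le4K-2}\frac1{\xi_l}\sum_k|\mathbf C^{(m,i;n,j)}_{k,l}|\xi_k$ and $\mathfrak C_{\rm tail}^{(m,i;n,j)}=\frac2{\nu^K}\big(\|\mathbf A^{(m,i;n,j)}_{\cdot,0}\|_\nu+\|\mathbf A^{(m,i;n+1,j)}_{\cdot,0}\|_\nu\big)+\frac{\delta_{m,n}}K\frac{h_m}4\|\mathbf u^{(n;i,j)}_\mp\|_\nu$ (the second norm being $0$ for $n=M$); here $\mathbf u^{(n;i,j)}$ are the Chebyshev coefficients of $\partial_jf^{(i)}(\bar X)$ on the $n$-th subinterval, $(\mathbf u_\mp)_0=0$ and $(\mathbf u_\mp)_k=\mathbf u_{k-1}-\mathbf u_{k+1}$ for $k\ge1$; * for $k=2,3,4$, $Z_k^{(m)}=\sum_n\max_{j_1,\dots,j_k}\sum_{i_1}\frac{\eta^{(m,i_1)}}{\eta^{(n,j_1)}\cdots\eta^{(n,j_k)}}\sum_{i_2}\|\mathbf A^{(m,i_1;n,i_2)}\|_\nu\,\|D^k_{(n,j_1;\dots;n,j_k)}\mathbf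 F^{(n,i_2)}(\bar{\mathbf X})\|_\nu$, the last norm being that of a $k$-linear operator on $\ell^1_\nu$. Let $$P^{(m)}(r)=\tfrac{Z_4^{(m)}}{24}r^4+\tfrac{Z_3^{(m)}}6r^3+\tfrac{Z_2^{(m)}}2r^2-(1-Z_1^{(m)}-Z_0^{(m)})r+Y^{(m)},\qquad Q^{(m)}(r)=\tfrac{Z_4^{(m)}}6r^3+\tfrac{Z_3^{(m)}}2r^2+Z_2^{(m)}r-(1-Z_1^{(m)}-Z_0^{(m)}).$$ **Theorem.** Suppose that there is $\bar\rho>0$ with $P^{(m)}(\bar\rho)<0$ and $Q^{(m)}(\bar\rho)<0$ for all $1\le m\le M$. Then there exists $\mathbf X\in\mathcal X_{\eta,\nu}$ with $\|\mathbf X-\bar{\mathbf X}\|_{\mathcal X_{\eta,\nu}}\le\bar\rho$ such that the piecewise Chebyshev series $X$ with coefficients $\mathbf X$ is a well-defined function on $[0,\tau]$ satisfying $X'=f(X)$ on $[0,\tau]$ and $X(0)=p(1)$; in particular $X(0)$ belongs to the unstable manifold of $X_0$ (the points with a backward orbit converging exponentially to $X_0$). Moreover, let $q_1$ be a local minimum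 of $V$ and $U$ a validated trapping region around $q_1$, i.e. a closed (axis-parallel) square containing $q_1$ on which $V$ is strictly convex and on whose boundary $-\nabla V$ points strictly inward. If $(X^{(1)}(\tau),X^{(2)}(\tau))\in U$, then there is an orbit $y:\mathbb R\to\mathbb R^2$ of $y'=-\nabla V(y)$ with $y(t)\to q_0$ as $t\to-\infty$, $y(t)\to q_1$ as $t\to+\infty$, and $y=(X^{(1)},X^{(2)})$ on $[0,\tau]$. -/

import Mathlib

open Set Filter Topology

noncomputable section

namespace MullerBrown

/-! ## The potential and the extended polynomial system -/

/-- The original phase space `ℝ²`. -/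
abbrev Plane := EuclideanSpace ℝ (Fin 2)

/-- The extended phase space `ℝ⁶`, with coordinates `(x, y, z⁽¹⁾, …, z⁽⁴⁾)`. -/
abbrev Phase := Fin 6 → ℝ

/-- The parameters of a Müller–Brown potential. -/
structure Params where
  α : Fin 4 → ℝ
  a : Fin 4 → ℝ
  b : Fin 4 → ℝ
  c : Fin 4 → ℝ
  x₀ : Fin 4 → ℝ
  y₀ : Fin 4 → ℝ

def Params.w₁ (P : Params) (i : Fin 4) : ℝ := 2 * P.a i * P.x₀ i + P.b i * P.y₀ i

def Params.w₂ (P : Params) (i : Fin 4) : ℝ := P.b i * P.x₀ i + 2 * P.c i * P.y₀ i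

/-- The four exponential terms `ψ⁽ⁱ⁾(x, y)` of the potential. -/
def psi (P : Params) (i : Fin 4) (q : Plane) : ℝ :=
  P.α i * Real.exp (P.a i * (q 0 - P.x₀ i) ^ 2 + P.b i * (q 0 - P.x₀ i) * (q 1 - P.y₀ i)
    + P.c i * (q 1 - P.y₀ i) ^ 2)

/-- The Müller–Brown potential `V`. -/
def V (P : Params) (q : Plane) : ℝ := ∑ i, psi P i q

/-- The vector field `-∇V`. -/
def negGrad (P : Params) (q : Plane) : Plane := -gradient (V P) q

/-- `(x, y) ↦ (x, y, ψ(x, y))`. -/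
def lift (P : Params) (q : Plane) : Phase :=
  Matrix.vecCons (q 0) (Matrix.vecCons (q 1) fun i : Fin 4 => psi P i q)

/-- `X ↦ (X⁽¹⁾, X⁽²⁾)`. -/
def proj (X : Phase) : Plane := !₂[X 0, X 1]

/-- The polynomial expression defining the extended vector field, for variables in a real vector
space `R` with a product `mul` and a unit `one`. It is used for real numbers, which gives `f`, and
for sequences of Chebyshev coefficients with the convolution product, which gives the map that
sends the coefficients of `X` to those of `f(X)`. -/
def fieldOver {R : Type*} [AddCommGroup R] [Module ℝ R] (P : Params) (mul : R → R → R) (one : R)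
    (X : Fin 6 → R) : Fin 6 → R :=
  let L₁ : Fin 4 → R := fun i => (2 * P.a i) • X 0 + P.b i • X 1 - P.w₁ i • one
  let L₂ : Fin 4 → R := fun i => P.b i • X 0 + (2 * P.c i) • X 1 - P.w₂ i • one
  let G₁ : R := ∑ i : Fin 4, mul (L₁ i) (X i.succ.succ)
  let G₂ : R := ∑ i : Fin 4, mul (L₂ i) (X i.succ.succ)
  Matrix.vecCons (-G₁) (Matrix.vecCons (-G₂) fun j : Fin 4 =>
    -mul (mul (L₁ j) G₁ + mul (L₂ j) G₂) (X j.succ.succ))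

/-- The extended vector field `f : ℝ⁶ → ℝ⁶`. -/
def field (P : Params) : Phase → Phase := fieldOver P (fun x y : ℝ => x * y) 1

/-! ## Saddles, unstable manifolds, trapping regions, connecting orbits -/

/-- `q` is a saddle point of `V`: a critical point at which the Jacobian `-D²V(q)` of `-∇V` has one
positive and one negative eigenvalue. -/
def IsSaddle (P : Params) (q : Plane) : Prop :=
  gradient (V P) q = 0 ∧ ∃ lam mu : ℝ, 0 < lam ∧ mu < 0 ∧
    Module.End.HasEigenvalue (fderiv ℝ (negGrad P) q).toLinearMap lam ∧
    Module.End.HasEigenvalue (fderiv ℝ (negGrad P) q).toLinearMap mu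

/-- The function `p(θ) = ∑ pₙ θⁿ` with values in `ℝ⁶`. -/
def powerSum (p : ℕ → Phase) (θ : ℝ) : Phase := fun i => ∑' n, p n i * θ ^ n

/-- The coefficients `p = (pₙ)` define an exact parameterization `p(θ) = ∑ pₙ θⁿ`, `θ ∈ [-1, 1]`, of
a local unstable manifold of `lift P q₀`, with `p(0) = lift P q₀`, `p'(0) = γ v` and
`λ θ p'(θ) = f(p(θ))`; its first `N` coefficients are `phat`, and the remaining ones have weighted
`ℓ¹` norm at most `rbar`. That is, `phat` is a validated parameterization with validation
radius `rbar`. -/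
structure IsValidatedParam (P : Params) (q₀ : Plane) (lam : ℝ) (v : Phase) (γ : ℝ) {N : ℕ}
    (ηp : Fin 6 → ℝ) (phat : Fin N → Phase) (rbar : ℝ) (p : ℕ → Phase) : Prop where
  coeff_zero : p 0 = lift P q₀
  coeff_one : p 1 = γ • v
  coeff_lt : ∀ n : Fin N, p n = phat n
  summable : ∀ i, Summable fun n => |p n i|
  tail_le : ∑ i, (∑' n, |p (n + N) i|) * ηp i ≤ rbar
  invariance : ∀ θ ∈ Icc (-1 : ℝ) 1, ∃ d : Phase,
    HasDerivWithinAt (powerSum p) d (Icc (-1) 1) θ ∧ (lam * θ) • d = field P (powerSum p θ)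

/-- The unstable manifold of an equilibrium `x₀` of a vector field `g`: the points through which
there is a backward orbit that converges to `x₀` exponentially fast. -/
def unstableManifold {E : Type*} [NormedAddCommGroup E] [NormedSpace ℝ E] (g : E → E) (x₀ : E) :
    Set E :=
  {x | ∃ Y : ℝ → E, Y 0 = x ∧ (∀ s ≤ 0, HasDerivWithinAt Y (g (Y s)) (Iic 0) s) ∧
    ∃ C δ : ℝ, 0 < δ ∧ ∀ s ≤ 0, ‖Y s - x₀‖ ≤ C * Real.exp (δ * s)}

/-- `U` is a validated trapping region around `q₁`: a closed square containing `q₁`, on which `V` is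
strictly convex and on whose boundary `-∇V` points strictly inward. -/
def IsTrappingRegion (P : Params) (q₁ : Plane) (U : Set Plane) : Prop :=
  ∃ (c : Plane) (h : ℝ), 0 < h ∧ U = {q | ∀ i, |q i - c i| ≤ h} ∧ q₁ ∈ U ∧
    StrictConvexOn ℝ U (V P) ∧
    ∀ q ∈ U, ∀ i, (q i = c i + h → negGrad P q i < 0) ∧ (q i = c i - h → 0 < negGrad P q i)

/-- `y` is a connecting orbit from `q₀` to `q₁` for `-∇V`. -/
def IsConnectingOrbit (P : Params) (q₀ q₁ : Plane) (y : ℝ → Plane) : Prop :=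
  (∀ s, HasDerivAt y (negGrad P (y s)) s) ∧ Tendsto y atBot (𝓝 q₀) ∧ Tendsto y atTop (𝓝 q₁)

/-! ## Sequences of Chebyshev coefficients -/

/-- The convolution `(u ∗ v)ₖ = ∑_{l ∈ ℤ} u_{|l|} v_{|k-l|}`. -/
def conv (u v : ℕ → ℝ) (k : ℕ) : ℝ := ∑' l : ℤ, u l.natAbs * v ((k : ℤ) - l).natAbs

/-- The action of `f` on Chebyshev coefficients. The sequence `(1, 0, 0, …)` represents the constant
function `1`. -/
def seqField (P : Params) : (Fin 6 → ℕ → ℝ) → Fin 6 → ℕ → ℝ :=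
  fieldOver P conv (Pi.single 0 1)

/-- The weights `ξ₀(ν) = 1`, `ξₖ(ν) = 2 νᵏ`. -/
def xi (ν : ℝ) (k : ℕ) : ℝ := if k = 0 then 1 else 2 * ν ^ k

/-- `u` has a finite `ℓ¹_ν` norm. -/
def MemEll (ν : ℝ) (u : ℕ → ℝ) : Prop := Summable fun k => |u k| * xi ν k

def nuNorm (ν : ℝ) (u : ℕ → ℝ) : ℝ := ∑' k, |u k| * xi ν k

/-- Coefficients `X⁽ᵐ'ⁱ⁾ₖ` of a piecewise Chebyshev series on `M` subintervals. -/
abbrev Coeffs (M : ℕ) := Fin M → Fin 6 → ℕ → ℝ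

/-- `X` belongs to the space `𝒳_{η,ν}` (which does not depend on the positive weights `η`). -/
def MemX {M : ℕ} (ν : ℝ) (X : Coeffs M) : Prop := ∀ m i, MemEll ν (X m i)

/-- The norm of `𝒳_{η⁽ᵐ⁾,ν}`. -/
def domNorm (ν : ℝ) (η : Fin 6 → ℝ) (u : Fin 6 → ℕ → ℝ) : ℝ := ∑ i, nuNorm ν (u i) * η i

/-- The norm of `𝒳_{η,ν}`. -/
def normX {M : ℕ} (ν : ℝ) (η : Fin M → Fin 6 → ℝ) (X : Coeffs M) : ℝ :=
  ⨆ m, domNorm ν (η m) (X m)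

/-- `Xf` is the function on `[t⁽⁰⁾, t⁽ᴹ⁾]` whose restriction to each `[t⁽ᵐ⁻¹⁾, t⁽ᵐ⁾]` is the sum of the
(convergent) rescaled Chebyshev series `X⁽ᵐ⁾₀ + 2 ∑_{k ≥ 1} X⁽ᵐ⁾ₖ T⁽ᵐ⁾ₖ`. -/
def IsPiecewiseCheb {M : ℕ} (t : Fin (M + 1) → ℝ) (X : Coeffs M) (Xf : ℝ → Phase) : Prop :=
  ∀ m : Fin M, ∀ s ∈ Icc (t m.castSucc) (t m.succ), ∀ i,
    HasSum (fun k : ℕ => (if k = 0 then 1 else 2) * X m i k *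
      (Polynomial.Chebyshev.T ℝ k).eval
        ((2 * s - t m.succ - t m.castSucc) / (t m.succ - t m.castSucc))) (Xf s i)

/-! ## The zero-finding problem -/

/-- Value at the left end point of the function with Chebyshev coefficients `u`. -/
def leftVal (u : ℕ → ℝ) : ℝ := u 0 + 2 * ∑' k : ℕ, (-1) ^ (k + 1) * u (k + 1)

/-- Value at the right end point of the function with Chebyshev coefficients `u`. -/
def rightVal (u : ℕ → ℝ) : ℝ := u 0 + 2 * ∑' k : ℕ, u (k + 1)

/-- The value to be matched at the left end of the `m`-th subinterval: the initial value `p₁` on the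
first one, and the right end value of the preceding subinterval on the others. -/
def prevVal {M : ℕ} (p₁ : Phase) (X : Coeffs M) (m : Fin M) (i : Fin 6) : ℝ :=
  if (m : ℕ) = 0 then p₁ i
  else rightVal (X ⟨(m : ℕ) - 1, lt_of_le_of_lt (Nat.sub_le _ _) m.isLt⟩ i)

/-- The map `F`; its zeros are the Chebyshev coefficients of the solutions of
`X' = f(X)`, `X(0) = p₁`. -/
def F {M : ℕ} (P : Params) (t : Fin (M + 1) → ℝ) (p₁ : Phase) (X : Coeffs M) (m : Fin M)
    (i : Fin 6) : ℕ → ℝ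
  | 0 => leftVal (X m i) - prevVal p₁ X m i
  | k + 1 => ((k : ℝ) + 1) * X m i (k + 1)
      - (t m.succ - t m.castSucc) / 4 * (seqField P (X m) i k - seqField P (X m) i (k + 2))

/-- Index set of the rows and columns of an operator on `𝒳_{η,ν}`. -/
abbrev Idx (M : ℕ) := Fin M × Fin 6 × ℕ

/-- Operators on `𝒳_{η,ν}`, as infinite matrices. -/
abbrev Op (M : ℕ) := Matrix (Idx M) (Idx M) ℝ

/-- Product of infinite matrices (used when the rows of the left one are finite). -/
def opMul {M : ℕ} (A B : Op M) : Op M := fun r s => ∑' q, A r q * B q s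

/-- The sequence with the single nonzero component `u`, at position `(n, j)`. -/
def embed {M : ℕ} (n : Fin M) (j : Fin 6) (u : ℕ → ℝ) : Coeffs M := Pi.single n (Pi.single j u)

/-- The injection `ι_K`. -/
def inj {M K : ℕ} (X : Fin M → Fin 6 → Fin K → ℝ) : Coeffs M :=
  fun m i k => if h : k < K then X m i ⟨k, h⟩ else 0

/-- The matrix of partial derivatives of `F` at `X`. -/
def DF {M : ℕ} (P : Params) (t : Fin (M + 1) → ℝ) (p₁ : Phase) (X : Coeffs M) : Op M :=
  fun r s => lineDeriv ℝ (fun Z => F P t p₁ Z r.1 r.2.1 r.2.2) X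
    (embed s.1 s.2.1 (Pi.single s.2.2 1))

/-- The operator `A†`: it acts as the derivative of `π_K ∘ F ∘ ι_K` at `X̄` on the modes of order less
than `K`, and as multiplication by `k` on the modes of order `k ≥ K`. -/
def Adag {M K : ℕ} (P : Params) (t : Fin (M + 1) → ℝ) (p₁ : Phase)
    (Xbar : Fin M → Fin 6 → Fin K → ℝ) : Op M :=
  fun r s => if r.2.2 < K ∧ s.2.2 < K then DF P t p₁ (inj Xbar) r s
    else if r = s then (r.2.2 : ℝ) else 0

/-- The operator `A`: it acts as the matrix `A^[K]` on the modes of order less than `K`, and as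
multiplication by `1/k` on the modes of order `k ≥ K`. -/
def Aop {M K : ℕ} (AK : Matrix (Fin M × Fin 6 × Fin K) (Fin M × Fin 6 × Fin K) ℝ) : Op M :=
  fun r s => if h : r.2.2 < K ∧ s.2.2 < K then
      AK (r.1, r.2.1, ⟨r.2.2, h.1⟩) (s.1, s.2.1, ⟨s.2.2, h.2⟩)
    else if r = s then 1 / (r.2.2 : ℝ) else 0

/-! ## The bounds -/

section Bounds

variable {M K : ℕ} (P : Params) (t : Fin (M + 1) → ℝ) (p₁ : Phase) (ν : ℝ)
  (η : Fin M → Fin 6 → ℝ) (Xbar : Fin M → Fin 6 → Fin K → ℝ)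
  (AK : Matrix (Fin M × Fin 6 × Fin K) (Fin M × Fin 6 × Fin K) ℝ)

/-- The weighted norm of the `l`-th column of the block `(m, i; n, j)` of `A`, divided by the weight
of that column. -/
def colNorm (A : Op M) (m : Fin M) (i : Fin 6) (n : Fin M) (j : Fin 6) (l : ℕ) : ℝ :=
  1 / xi ν l * nuNorm ν fun k => A (m, i, k) (n, j, l)

/-- The `ℓ¹_ν` operator norm of the block `(m, i; n, j)` of `A`. -/
def blockNorm (A : Op M) (m : Fin M) (i : Fin 6) (n : Fin M) (j : Fin 6) : ℝ :=
  ⨆ l : ℕ, colNorm ν A m i n j l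

/-- The weighted operator norm of a `6 × 6` matrix with nonnegative entries. -/
def weightedNorm (ηn ηm : Fin 6 → ℝ) (B : Fin 6 → Fin 6 → ℝ) : ℝ :=
  ⨆ j, 1 / ηn j * ∑ i, B i j * ηm i

/-- `Y⁽ᵐ⁾`, the norm of the `m`-th component of `A F(X̄)`. -/
def Y (m : Fin M) : ℝ :=
  domNorm ν (η m) fun i k => ∑' q : Idx M, Aop AK (m, i, k) q * F P t p₁ (inj Xbar) q.1 q.2.1 q.2.2

/-- `B = I - A A†`. -/
def Bop : Op M := 1 - opMul (Aop AK) (Adag P t p₁ Xbar)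

def Z₀ (m : Fin M) : ℝ :=
  ∑ n, weightedNorm (η n) (η m) fun i j => blockNorm ν (Bop P t p₁ Xbar AK) m i n j

/-- `C = A (DF(X̄) - A†)`. -/
def Cop : Op M := opMul (Aop AK) (DF P t p₁ (inj Xbar) - Adag P t p₁ Xbar)

/-- The part of the norm of a block of `C` coming from the columns of order `l ≤ 4K - 2`. -/
def Cfinite (m : Fin M) (i : Fin 6) (n : Fin M) (j : Fin 6) : ℝ :=
  ⨆ l : Fin (4 * K - 1), colNorm ν (Cop P t p₁ Xbar AK) m i n j l

/-- The Chebyshev coefficients of the function `D_j f⁽ˡ⁾(X̄)` on the `n`-th subinterval: the derivative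
at `ε = 0` of the coefficients of `f⁽ˡ⁾(X̄ + ε e_j)`, where the constant function `e_j` has the
coefficients `(1, 0, 0, …)` in its `j`-th component. -/
def uCoeff (n : Fin M) (l j : Fin 6) (k : ℕ) : ℝ :=
  lineDeriv ℝ (fun Z => seqField P Z l k) (inj Xbar n) (Pi.single j (Pi.single 0 1))

/-- The sequence `u_∓`. -/
def mp (u : ℕ → ℝ) : ℕ → ℝ
  | 0 => 0
  | k + 1 => u k - u (k + 2)

def Ctail (m : Fin M) (i : Fin 6) (n : Fin M) (j : Fin 6) : ℝ :=
  2 / ν ^ K * (nuNorm ν (fun k => Aop AK (m, i, k) (n, j, 0)) +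
      if h : (n : ℕ) + 1 < M then nuNorm ν (fun k => Aop AK (m, i, k) (⟨n + 1, h⟩, j, 0)) else 0)
    + if m = n then
        1 / (K : ℝ) * ((t m.succ - t m.castSucc) / 4) * nuNorm ν (mp (uCoeff P Xbar n i j))
      else 0

def Z₁ (m : Fin M) : ℝ :=
  ∑ n, weightedNorm (η n) (η m) fun i j =>
    max (Cfinite P t p₁ ν Xbar AK m i n j) (Ctail P t ν Xbar AK m i n j)

/-- Iterated directional derivatives. -/
def iterLineDeriv {W : Type*} [AddCommGroup W] [Module ℝ W] (G : W → ℝ) : List W → W → ℝ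
  | [] => G
  | h :: hs => fun x => lineDeriv ℝ (iterLineDeriv G hs) x h

/-- The operator norm of a `k`-linear map on `ℓ¹_ν`. -/
def multiNorm (k : ℕ) (B : (Fin k → ℕ → ℝ) → ℕ → ℝ) : ℝ :=
  sSup {r | ∃ u : Fin k → ℕ → ℝ, (∀ l, MemEll ν (u l) ∧ nuNorm ν (u l) = 1) ∧ r = nuNorm ν (B u)}

/-- The partial derivative `D^k_{(n,j₁;…;n,j_k)} F⁽ⁿ'ⁱ⁾(X̄)`, a `k`-linear map on `ℓ¹_ν`. -/
def DkF (k : ℕ) (n : Fin M) (js : Fin k → Fin 6) (i : Fin 6) (u : Fin k → ℕ → ℝ) : ℕ → ℝ :=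
  fun r => iterLineDeriv (fun Z => F P t p₁ Z n i r) (List.ofFn fun l => embed n (js l) (u l))
    (inj Xbar)

/-- `Z_k⁽ᵐ⁾` for `k = 2, 3, 4`. -/
def Z (k : ℕ) (m : Fin M) : ℝ :=
  ∑ n, ⨆ js : Fin k → Fin 6, ∑ i₁, η m i₁ / (∏ l, η n (js l)) *
    ∑ i₂, blockNorm ν (Aop AK) m i₁ n i₂ * multiNorm ν k (DkF P t p₁ Xbar k n js i₂)

/-- The radii polynomial `P⁽ᵐ⁾`. -/
def radiiP (m : Fin M) (r : ℝ) : ℝ :=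
  Z P t p₁ ν η Xbar AK 4 m / 24 * r ^ 4 + Z P t p₁ ν η Xbar AK 3 m / 6 * r ^ 3
    + Z P t p₁ ν η Xbar AK 2 m / 2 * r ^ 2
    - (1 - Z₁ P t p₁ ν η Xbar AK m - Z₀ P t p₁ ν η Xbar AK m) * r + Y P t p₁ ν η Xbar AK m

/-- The radii polynomial `Q⁽ᵐ⁾`. -/
def radiiQ (m : Fin M) (r : ℝ) : ℝ :=
  Z P t p₁ ν η Xbar AK 4 m / 6 * r ^ 3 + Z P t p₁ ν η Xbar AK 3 m / 2 * r ^ 2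
    + Z P t p₁ ν η Xbar AK 2 m * r
    - (1 - Z₁ P t p₁ ν η Xbar AK m - Z₀ P t p₁ ν η Xbar AK m)

end Bounds

end MullerBrown

end

open MullerBrown

/-!
The coefficients of the orbit are found by a Newton-like contraction, and the resulting solution of
the polynomial system is then projected to the plane and continued in both directions of time.

*Zeros of `F`.* The space `ℓ¹_ν` with the convolution is a commutative Banach algebra (`EllOne`), and
evaluation of Chebyshev series at a point of `[-1, 1]` is multiplicative on it (`chebSum_mul`),
because `2 T_m T_n = T_{m+n} + T_{m-n}`. The map `F` is polynomial of degree four on this algebra, so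
that Taylor's formula at the approximate solution is exact and stops at order four (`F_add`).
Hence `H - A F(X̄ + H)` is the sum of `(1 - A A†) H`, `-A (DF(X̄) - A†) H`, `-A F(X̄)`, and
multilinear terms of degrees two, three and four in `H`. The numbers `Z₀`, `Z₁`, `Y`, `Z_k` bound these
pieces; for `Z₁` this rests on the fact that the columns of `A (DF(X̄) - A†)` of order `l ≥ 4K - 1`
only see the boundary conditions and the tail of `A`, which gives the bound `Ctail`
(`colNorm_Cop_tail`). Negativity of the polynomials `P⁽ᵐ⁾` makes the ball of radius `ρ` invariant, and
negativity of the `Q⁽ᵐ⁾` makes the map a contraction there (`newtonOp_mem_ball`,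
`newtonOp_lipschitz`). Since `Q⁽ᵐ⁾(ρ) < 0` also forces `Z₀⁽ᵐ⁾ < 1`, the matrix of `A` is invertible
(`isUnit_of_Z₀_lt_one`), so that fixed points are zeros of `F` (`exists_zero`).

*The differential equation.* From `T_{k+1}' = (k+1) U_k` and `U_{k+2} - U_k = 2 T_{k+2}`, the
components of order `k ≥ 1` of `F = 0` say that the series is a primitive of `f(X)` on each subinterval
(`hasDerivWithinAt_chebSum`), and the components of order zero match the pieces.

*The gradient system.* Each `z⁽ʲ⁾ exp(-E_j(x, y))`, where `E_j` is the exponent of `ψ⁽ʲ⁾`, is conserved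
by the extended field. Along the orbit `s ↦ p(e^{λ s})`, which tends to the saddle as `s → -∞`, its
value is therefore `α⁽ʲ⁾` (`conserved_backOrbit`), and so it is on the whole orbit. This means that
`z = ψ(x, y)`, and the first two components solve `y' = -∇V(y)` (`hasDerivWithinAt_proj`).

*The trapping region.* The boundary condition keeps the forward orbit in the square
(`exists_trapped_solution`). There the squared distance to `q₁` is a strict Lyapunov function, by the
gradient inequality for the convex function `V` (`tendsto_of_trapped`).
-/

noncomputable section
set_option linter.unusedSectionVars false
namespace MullerBrown


/-! ### The convolution algebra of Chebyshev coefficients -/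

lemma summable_int_conv {a b : ℤ → ℝ} (ha : Summable fun k => |a k|) (hb : Summable fun k => |b k|) :
    Summable fun p : ℤ × ℤ => a p.2 * b (p.1 - p.2) := by
  have h := (summable_mul_of_summable_norm (f := a) (g := b) ha hb)
  let e : ℤ × ℤ ≃ ℤ × ℤ :=
    { toFun := fun p => (p.2, p.1 - p.2)
      invFun := fun p => (p.1 + p.2, p.1)
      left_inv := fun p => by ext <;> simp
      right_inv := fun p => by ext <;> simp }
  exact (e.summable_iff.mpr h)

lemma hasSum_int_conv {a b : ℤ → ℝ} (ha : Summable fun k => |a k|) (hb : Summable fun k => |b k|) :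
    HasSum (fun k => ∑' l, a l * b (k - l)) ((∑' k, a k) * ∑' k, b k) := by
  have hs := summable_int_conv ha hb
  have h1 : (∑' k, a k) * ∑' k, b k = ∑' p : ℤ × ℤ, a p.2 * b (p.1 - p.2) := by
    rw [tsum_mul_tsum_of_summable_norm (f := a) (g := b) ha hb]
    let e : ℤ × ℤ ≃ ℤ × ℤ :=
      { toFun := fun p => (p.2, p.1 - p.2)
        invFun := fun p => (p.1 + p.2, p.1)
        left_inv := fun p => by ext <;> simp
        right_inv := fun p => by ext <;> simp }
    exact (e.tsum_eq (fun z : ℤ × ℤ => a z.1 * b z.2)).symm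
  rw [h1, hs.tsum_prod]
  exact hs.prod.hasSum

lemma summable_int_conv_fiber {a b : ℤ → ℝ} (ha : Summable fun k => |a k|)
    (hb : Summable fun k => |b k|) (k : ℤ) : Summable fun l => a l * b (k - l) :=
  (summable_int_conv ha hb).prod_factor k

lemma int_conv_comm (a b : ℤ → ℝ) (k : ℤ) : ∑' l, a l * b (k - l) = ∑' l, b l * a (k - l) := by
  rw [← (Equiv.subLeft k).tsum_eq]
  simp [mul_comm]

lemma int_conv_assoc {a b c : ℤ → ℝ} (ha : Summable fun k => |a k|) (hb : Summable fun k => |b k|)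
    (hc : Summable fun k => |c k|) (k : ℤ) :
    ∑' l, (∑' j, a j * b (l - j)) * c (k - l) = ∑' j, a j * ∑' m, b m * c (k - j - m) := by
  have hcb : ∀ m, |c m| ≤ ∑' k, |c k| := fun m => hc.le_tsum m fun _ _ => abs_nonneg _
  have hs : Summable fun p : ℤ × ℤ => a p.2 * b (p.1 - p.2) * c (k - p.1) := by
    refine Summable.of_norm_bounded (((summable_int_conv ha hb).abs).mul_right (∑' k, |c k|)) ?_
    intro p
    rw [Real.norm_eq_abs, abs_mul]
    exact mul_le_mul_of_nonneg_left (hcb _) (abs_nonneg _)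
  calc ∑' l, (∑' j, a j * b (l - j)) * c (k - l)
      = ∑' l, ∑' j, a j * b (l - j) * c (k - l) := by simp_rw [tsum_mul_right]
    _ = ∑' j, ∑' l, a j * b (l - j) * c (k - l) := by
        refine Summable.tsum_comm (f := fun j l => a j * b (l - j) * c (k - l)) ?_
        exact hs.prod_symm
    _ = _ := by
        refine tsum_congr fun j => ?_
        rw [← tsum_mul_left, ← (Equiv.addRight j).tsum_eq]
        refine tsum_congr fun l => ?_
        simp only [Equiv.coe_addRight, add_sub_cancel_right]
        rw [mul_assoc]; congr 3; ring

lemma hasSum_natAbs {g : ℕ → ℝ} (hg : Summable g) :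
    HasSum (fun k : ℤ => g k.natAbs) (∑' k, (if k = 0 then 1 else 2) * g k) := by
  have h1 : HasSum (fun n : ℕ => (fun k : ℤ => g k.natAbs) (n : ℤ)) (∑' k, g k) := by
    simpa using hg.hasSum
  have h2 : HasSum (fun n : ℕ => (fun k : ℤ => g k.natAbs) (-(n : ℤ))) (∑' k, g k) := by
    simpa using hg.hasSum
  have h3 : HasSum (fun k : ℤ => g k.natAbs) (∑' k, g k + ∑' k, g k - g 0) :=
    HasSum.of_nat_of_neg h1 h2
  have h4 : ∑' k, (if k = 0 then (1 : ℝ) else 2) * g k = ∑' k, g k + ∑' k, g k - g 0 := by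
    have h5 : HasSum (fun k : ℕ => 2 * g k - (if k = 0 then g 0 else 0)) (2 * ∑' k, g k - g 0) :=
      (hg.hasSum.mul_left 2).sub (hasSum_ite_eq 0 (g 0))
    rw [← two_mul, ← h5.tsum_eq]
    refine tsum_congr fun k => ?_
    by_cases h : k = 0
    · rw [if_pos h, if_pos h, h]; ring
    · rw [if_neg h, if_neg h]; ring
  rw [h4]; exact h3

lemma xi_eq (ν : ℝ) (k : ℕ) : xi ν k = (if k = 0 then 1 else 2) * ν ^ k := by
  unfold xi; by_cases h : k = 0 <;> simp [h]

lemma xi_pos {ν : ℝ} (hν : 1 < ν) (k : ℕ) : 0 < xi ν k := by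
  rw [xi_eq]; have : 0 < ν := by linarith
  split_ifs <;> positivity

lemma one_le_xi {ν : ℝ} (hν : 1 < ν) (k : ℕ) : 1 ≤ xi ν k := by
  rw [xi_eq]; have : 1 ≤ ν ^ k := one_le_pow₀ hν.le
  split_ifs <;> linarith

lemma pow_le_xi {ν : ℝ} (hν : 1 < ν) (k : ℕ) : ν ^ k ≤ xi ν k := by
  rw [xi_eq]; have : 1 ≤ ν ^ k := one_le_pow₀ hν.le
  split_ifs <;> linarith

lemma xi_le {ν : ℝ} (hν : 1 < ν) (k : ℕ) : xi ν k ≤ 2 * ν ^ k := by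
  rw [xi_eq]; have : 1 ≤ ν ^ k := one_le_pow₀ hν.le
  split_ifs <;> linarith

lemma memEll_iff_pow {ν : ℝ} (hν : 1 < ν) {u : ℕ → ℝ} :
    MemEll ν u ↔ Summable fun k => |u k| * ν ^ k := by
  have h0 : 0 < ν := by linarith
  constructor
  · intro h
    refine Summable.of_nonneg_of_le (fun k => by positivity) (fun k => ?_) h
    exact mul_le_mul_of_nonneg_left (pow_le_xi hν k) (abs_nonneg _)
  · intro h
    refine Summable.of_nonneg_of_le (fun k => mul_nonneg (abs_nonneg _) (xi_pos hν k).le)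
      (fun k => ?_) (h.mul_left 2)
    have := mul_le_mul_of_nonneg_left (xi_le hν k) (abs_nonneg (u k))
    linarith

lemma memEll_iff_int {ν : ℝ} (hν : 1 < ν) {u : ℕ → ℝ} :
    MemEll ν u ↔ Summable fun k : ℤ => |u k.natAbs| * ν ^ k.natAbs := by
  rw [memEll_iff_pow hν]
  constructor
  · intro h; exact (hasSum_natAbs h).summable
  · intro h
    simpa [Function.comp_def] using h.comp_injective Nat.cast_injective

lemma nuNorm_eq_int {ν : ℝ} (hν : 1 < ν) {u : ℕ → ℝ} (hu : MemEll ν u) :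
    nuNorm ν u = ∑' k : ℤ, |u k.natAbs| * ν ^ k.natAbs := by
  rw [(hasSum_natAbs ((memEll_iff_pow hν).1 hu)).tsum_eq]
  unfold nuNorm
  refine tsum_congr fun k => ?_
  rw [xi_eq]; ring

lemma MemEll.summable_abs {ν : ℝ} (hν : 1 < ν) {u : ℕ → ℝ} (hu : MemEll ν u) :
    Summable fun k => |u k| := by
  refine Summable.of_nonneg_of_le (fun k => abs_nonneg _) (fun k => ?_) hu
  exact le_mul_of_one_le_right (abs_nonneg _) (one_le_xi hν k)

lemma MemEll.summable_int {ν : ℝ} (hν : 1 < ν) {u : ℕ → ℝ} (hu : MemEll ν u) :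
    Summable fun k : ℤ => |u k.natAbs| :=
  (hasSum_natAbs (hu.summable_abs hν)).summable

/-- The two-sided even extension of a convolution is the convolution over `ℤ` of the even
extensions. -/
lemma conv_natAbs (u v : ℕ → ℝ) (k : ℤ) :
    conv u v k.natAbs = ∑' l : ℤ, u l.natAbs * v (k - l).natAbs := by
  unfold conv
  rcases Int.natAbs_eq k with h | h
  · conv_rhs => rw [h]
  · conv_rhs => rw [h]
    rw [← (Equiv.neg ℤ).tsum_eq]
    refine tsum_congr fun l => ?_
    simp only [Equiv.neg_apply, Int.natAbs_neg]
    congr 2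
    rw [← Int.natAbs_neg]; congr 1; ring

lemma nu_pow_natAbs_add {ν : ℝ} (hν : 1 < ν) (k l : ℤ) :
    ν ^ k.natAbs ≤ ν ^ l.natAbs * ν ^ (k - l).natAbs := by
  rw [← pow_add]
  exact pow_le_pow_right₀ hν.le (by omega)

lemma memEll_conv_aux {ν : ℝ} (hν : 1 < ν) {u v : ℕ → ℝ} (hu : MemEll ν u) (hv : MemEll ν v) :
    MemEll ν (conv u v) ∧ nuNorm ν (conv u v) ≤ nuNorm ν u * nuNorm ν v := by
  have h0 : 0 < ν := by linarith
  have hu' := (memEll_iff_int hν).1 hu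
  have hv' := (memEll_iff_int hν).1 hv
  have hu2 := hu'.abs
  have hv2 := hv'.abs
  have hS := hasSum_int_conv hu2 hv2
  have hle : ∀ k : ℤ, |conv u v k.natAbs| * ν ^ k.natAbs ≤
      ∑' l : ℤ, |u l.natAbs| * ν ^ l.natAbs * (|v (k - l).natAbs| * ν ^ (k - l).natAbs) := by
    intro k
    have hf := summable_int_conv_fiber hu2 hv2 k
    rw [conv_natAbs]
    have hfs : Summable fun l : ℤ => u l.natAbs * v (k - l).natAbs :=
      summable_int_conv_fiber (a := fun l => u l.natAbs) (b := fun l => v l.natAbs)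
        (hu.summable_int hν) (hv.summable_int hν) k
    calc |∑' l : ℤ, u l.natAbs * v (k - l).natAbs| * ν ^ k.natAbs
        ≤ (∑' l : ℤ, |u l.natAbs * v (k - l).natAbs|) * ν ^ k.natAbs := by
          gcongr
          simpa using norm_tsum_le_tsum_norm (f := fun l : ℤ => u l.natAbs * v (k - l).natAbs)
            hfs.norm
      _ = ∑' l : ℤ, |u l.natAbs * v (k - l).natAbs| * ν ^ k.natAbs := tsum_mul_right.symm
      _ ≤ _ := by
          refine Summable.tsum_le_tsum (fun l => ?_) (hfs.abs.mul_right _) hf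
          rw [abs_mul]
          calc |u l.natAbs| * |v (k - l).natAbs| * ν ^ k.natAbs
              ≤ |u l.natAbs| * |v (k - l).natAbs| * (ν ^ l.natAbs * ν ^ (k - l).natAbs) := by
                gcongr; exact nu_pow_natAbs_add hν k l
            _ = _ := by ring
  have hm : MemEll ν (conv u v) := by
    rw [memEll_iff_int hν]
    exact Summable.of_nonneg_of_le (fun k => by positivity) hle hS.summable
  refine ⟨hm, ?_⟩
  rw [nuNorm_eq_int hν hm, nuNorm_eq_int hν hu, nuNorm_eq_int hν hv, ← hS.tsum_eq]
  exact Summable.tsum_le_tsum hle ((memEll_iff_int hν).1 hm) hS.summable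

/-- `ℓ¹_ν` as a subspace of the space of all sequences. -/
def ellSubmodule (ν : ℝ) : Submodule ℝ (ℕ → ℝ) where
  carrier := {u | MemEll ν u}
  zero_mem' := by simp [MemEll, summable_zero]
  add_mem' := by
    intro u v hu hv
    refine Summable.of_norm_bounded (Summable.add (Summable.norm hu) (Summable.norm hv)) fun k => ?_
    simp only [Pi.add_apply, norm_mul, Real.norm_eq_abs, abs_abs, ← add_mul]
    exact mul_le_mul_of_nonneg_right (abs_add_le _ _) (abs_nonneg _)
  smul_mem' := by
    intro c u hu
    have := Summable.mul_left |c| hu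
    refine this.congr fun k => ?_
    simp [abs_mul, mul_assoc]

/-- The space `ℓ¹_ν` of sequences of Chebyshev coefficients. It is a type of its own, not a
subtype, so that its topology is the one of the norm `nuNorm` and not that of the product. -/
structure EllOne (ν : ℝ) where
  /-- The sequence of coefficients. -/
  coeff : ℕ → ℝ
  memEll : MemEll ν coeff

lemma memEll_of_finite {ν : ℝ} {u : ℕ → ℝ} (N : ℕ) (h : ∀ k, N ≤ k → u k = 0) : MemEll ν u := by
  refine summable_of_ne_finset_zero (s := Finset.range N) fun k hk => ?_
  rw [h k (by simpa using hk)]; simp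

namespace EllOne

variable {ν : ℝ}

/-- The bijection of `ℓ¹_ν` with a subspace of the space of all sequences, along which the linear
structure is transported. -/
def equivSubmodule (ν : ℝ) : EllOne ν ≃ ellSubmodule ν where
  toFun u := ⟨u.coeff, u.memEll⟩
  invFun u := ⟨u.1, u.2⟩
  left_inv _ := rfl
  right_inv _ := rfl

instance : AddCommGroup (EllOne ν) := (equivSubmodule ν).addCommGroup

instance : Module ℝ (EllOne ν) := (equivSubmodule ν).module ℝ

instance : CoeFun (EllOne ν) (fun _ => ℕ → ℝ) := ⟨coeff⟩

@[simp] lemma coe_zero : ((0 : EllOne ν) : ℕ → ℝ) = 0 := rfl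

@[simp] lemma coe_add (u v : EllOne ν) : ((u + v : EllOne ν) : ℕ → ℝ) = ⇑u + ⇑v := rfl

@[simp] lemma coe_sub (u v : EllOne ν) : ((u - v : EllOne ν) : ℕ → ℝ) = ⇑u - ⇑v := rfl

@[simp] lemma coe_neg (u : EllOne ν) : ((-u : EllOne ν) : ℕ → ℝ) = -⇑u := rfl

@[simp] lemma coe_smul (c : ℝ) (u : EllOne ν) : ((c • u : EllOne ν) : ℕ → ℝ) = c • ⇑u := rfl

lemma ext {u v : EllOne ν} (h : ∀ k, u k = v k) : u = v := by
  cases u; cases v; congr 1; exact funext h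

/-- The inclusion of `ℓ¹_ν` in the space of all sequences. -/
def coeffs (ν : ℝ) : EllOne ν →ₗ[ℝ] (ℕ → ℝ) where
  toFun := coeff
  map_add' _ _ := rfl
  map_smul' _ _ := rfl

@[simp] lemma coeffs_apply (u : EllOne ν) : coeffs ν u = u := rfl

end EllOne

section Algebra

variable {ν : ℝ} [hν : Fact (1 < ν)]

lemma EllOne.summable_int (u : EllOne ν) : Summable fun k : ℤ => |u k.natAbs| :=
  MemEll.summable_int hν.out u.memEll

instance : Mul (EllOne ν) :=
  ⟨fun u v => ⟨conv u v, (memEll_conv_aux hν.out u.memEll v.memEll).1⟩⟩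

instance : One (EllOne ν) :=
  ⟨⟨Pi.single 0 1, memEll_of_finite 1 fun k hk => by simp [show k ≠ 0 by omega]⟩⟩

lemma EllOne.coe_mul (u v : EllOne ν) : ((u * v : EllOne ν) : ℕ → ℝ) = conv u v := rfl

lemma EllOne.coe_one : ((1 : EllOne ν) : ℕ → ℝ) = Pi.single 0 1 := rfl

lemma EllOne.mul_natAbs (u v : EllOne ν) (k : ℤ) :
    (u * v : EllOne ν) k.natAbs = ∑' l : ℤ, u l.natAbs * v (k - l).natAbs :=
  conv_natAbs _ _ _

lemma EllOne.ext_natAbs {u v : EllOne ν} (h : ∀ k : ℤ, u k.natAbs = v k.natAbs) : u = v :=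
  EllOne.ext fun k => by simpa using h k

lemma EllOne.summable_fiber (u v : EllOne ν) (k : ℤ) :
    Summable fun l : ℤ => u l.natAbs * v (k - l).natAbs :=
  summable_int_conv_fiber (b := fun l => v l.natAbs) u.summable_int v.summable_int k

/-- `ℓ¹_ν` is a commutative algebra under the convolution product. -/
instance : CommRing (EllOne ν) :=
  { (inferInstance : AddCommGroup (EllOne ν)), (inferInstance : Mul (EllOne ν)),
    (inferInstance : One (EllOne ν)) with
    left_distrib := fun u v w => EllOne.ext_natAbs fun k => by
      have h : ((u * v + u * w : EllOne ν) : ℕ → ℝ) k.natAbs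
        = (u * v : EllOne ν) k.natAbs + (u * w : EllOne ν) k.natAbs := rfl
      rw [h]
      simp only [EllOne.mul_natAbs]
      rw [← Summable.tsum_add (EllOne.summable_fiber u v k) (EllOne.summable_fiber u w k)]
      exact tsum_congr fun l => mul_add _ _ _
    right_distrib := fun u v w => EllOne.ext_natAbs fun k => by
      have h : ((u * w + v * w : EllOne ν) : ℕ → ℝ) k.natAbs
        = (u * w : EllOne ν) k.natAbs + (v * w : EllOne ν) k.natAbs := rfl
      rw [h]
      simp only [EllOne.mul_natAbs]
      rw [← Summable.tsum_add (EllOne.summable_fiber u w k) (EllOne.summable_fiber v w k)]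
      exact tsum_congr fun l => add_mul _ _ _
    zero_mul := fun u => EllOne.ext_natAbs fun k => by
      rw [EllOne.mul_natAbs]; simp
    mul_zero := fun u => EllOne.ext_natAbs fun k => by
      rw [EllOne.mul_natAbs]; simp
    mul_assoc := fun u v w => EllOne.ext_natAbs fun k => by
      simp only [EllOne.mul_natAbs]
      exact int_conv_assoc u.summable_int v.summable_int w.summable_int k
    mul_comm := fun u v => EllOne.ext_natAbs fun k => by
      simp only [EllOne.mul_natAbs]
      exact int_conv_comm (fun l => u l.natAbs) (fun l => v l.natAbs) k
    one_mul := fun u => EllOne.ext_natAbs fun k => by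
      rw [EllOne.mul_natAbs, tsum_eq_single 0]
      · simp [EllOne.coe_one]
      · intro l hl
        simp [EllOne.coe_one, hl]
    mul_one := fun u => EllOne.ext_natAbs fun k => by
      rw [EllOne.mul_natAbs, tsum_eq_single k]
      · simp [EllOne.coe_one]
      · intro l hl
        have : k - l ≠ 0 := sub_ne_zero.2 (Ne.symm hl)
        simp [EllOne.coe_one, this] }

instance : Algebra ℝ (EllOne ν) :=
  Algebra.ofModule
    (fun r u v => EllOne.ext_natAbs fun k => by
      have h : ((r • (u * v) : EllOne ν) : ℕ → ℝ) k.natAbs = r * (u * v : EllOne ν) k.natAbs := rfl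
      rw [h]
      simp only [EllOne.mul_natAbs]
      rw [← tsum_mul_left]
      exact tsum_congr fun l => mul_assoc _ _ _)
    (fun r u v => EllOne.ext_natAbs fun k => by
      have h : ((r • (u * v) : EllOne ν) : ℕ → ℝ) k.natAbs = r * (u * v : EllOne ν) k.natAbs := rfl
      rw [h]
      simp only [EllOne.mul_natAbs]
      rw [← tsum_mul_left]
      exact tsum_congr fun l => mul_left_comm _ _ _)

lemma nuNorm_nonneg (u : ℕ → ℝ) : 0 ≤ nuNorm ν u :=
  tsum_nonneg fun k => mul_nonneg (abs_nonneg _) (xi_pos hν.out k).le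

lemma nuNorm_add_le {u v : ℕ → ℝ} (hu : MemEll ν u) (hv : MemEll ν v) :
    nuNorm ν (u + v) ≤ nuNorm ν u + nuNorm ν v := by
  unfold nuNorm
  rw [← Summable.tsum_add hu hv]
  refine Summable.tsum_le_tsum (fun k => ?_) ((ellSubmodule ν).add_mem hu hv) (Summable.add hu hv)
  rw [← add_mul]
  exact mul_le_mul_of_nonneg_right (abs_add_le _ _) (xi_pos hν.out k).le

lemma nuNorm_smul (c : ℝ) (u : ℕ → ℝ) : nuNorm ν (c • u) = |c| * nuNorm ν u := by
  unfold nuNorm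
  rw [← tsum_mul_left]
  exact tsum_congr fun k => by simp [abs_mul, mul_assoc]

lemma abs_mul_xi_le_nuNorm {u : ℕ → ℝ} (hu : MemEll ν u) (k : ℕ) : |u k| * xi ν k ≤ nuNorm ν u :=
  Summable.le_tsum hu k fun _ _ => mul_nonneg (abs_nonneg _) (xi_pos hν.out _).le

lemma abs_le_nuNorm {u : ℕ → ℝ} (hu : MemEll ν u) (k : ℕ) : |u k| ≤ nuNorm ν u :=
  (le_mul_of_one_le_right (abs_nonneg _) (one_le_xi hν.out k)).trans (abs_mul_xi_le_nuNorm hu k)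

/-- `nuNorm` as a norm on the additive group `ℓ¹_ν`. -/
def ellOneNorm (ν : ℝ) [hν : Fact (1 < ν)] : AddGroupNorm (EllOne ν) where
  toFun u := nuNorm ν u
  map_zero' := by simp [nuNorm]
  add_le' u v := nuNorm_add_le u.memEll v.memEll
  neg' u := by simp [nuNorm]
  eq_zero_of_map_eq_zero' u h := by
    refine EllOne.ext fun k => ?_
    have h1 := abs_le_nuNorm u.memEll k
    have h2 : nuNorm ν u = 0 := h
    rw [h2] at h1
    exact abs_nonpos_iff.1 h1

instance : NormedCommRing (EllOne ν) :=
  { (inferInstance : CommRing (EllOne ν)), (ellOneNorm ν).toNormedAddCommGroup with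
    norm_mul_le := fun u v => (memEll_conv_aux hν.out u.memEll v.memEll).2 }

lemma EllOne.norm_def (u : EllOne ν) : ‖u‖ = nuNorm ν u := rfl

instance : NormedAlgebra ℝ (EllOne ν) :=
  { (inferInstance : Algebra ℝ (EllOne ν)) with
    norm_smul_le := fun r u => (nuNorm_smul r u).le }

/-- Rescaling by the weights identifies `ℓ¹_ν` with `ℓ¹`. -/
def ellOneEquiv (ν : ℝ) [hν : Fact (1 < ν)] : EllOne ν ≃ᵢ lp (fun _ : ℕ => ℝ) 1 :=
  IsometryEquiv.mk' (fun u => ⟨fun k => u k * xi ν k, by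
      refine memℓp_gen ?_
      refine Summable.congr u.memEll fun k => ?_
      simp [abs_of_pos (xi_pos hν.out k)]⟩)
    (fun w => ⟨fun k => w k / xi ν k, by
      have h := (lp.memℓp w).summable (by norm_num)
      refine h.congr fun k => ?_
      simp [abs_div, abs_of_pos (xi_pos hν.out k), (xi_pos hν.out k).ne']⟩)
    (fun w => by
      ext k
      exact div_mul_cancel₀ _ (xi_pos hν.out k).ne')
    (Isometry.of_dist_eq fun u v => by
      rw [dist_eq_norm, dist_eq_norm, lp.norm_eq_tsum_rpow (by norm_num), EllOne.norm_def]
      simp only [ENNReal.toReal_one, Real.rpow_one, div_one, nuNorm]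
      refine tsum_congr fun k => ?_
      rw [EllOne.coe_sub, Pi.sub_apply, lp.coeFn_sub, Pi.sub_apply, ← sub_mul, Real.norm_eq_abs, abs_mul,
        abs_of_pos (xi_pos hν.out k)])

instance : CompleteSpace (EllOne ν) :=
  (ellOneEquiv ν).completeSpace

/-! ### Chebyshev series as functions -/

open Polynomial.Chebyshev in
/-- The sum `u₀ + 2 ∑_{k ≥ 1} uₖ Tₖ(s)` of the Chebyshev series with coefficients `u`. -/
def chebSum (s : ℝ) (u : ℕ → ℝ) : ℝ :=
  ∑' k : ℕ, (if k = 0 then 1 else 2) * u k * (T ℝ k).eval s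

open Polynomial.Chebyshev in
lemma summable_mul_eval_T (u : EllOne ν) {s : ℝ} (hs : |s| ≤ 1) :
    Summable fun k : ℕ => u k * (T ℝ k).eval s := by
  refine Summable.of_norm_bounded (u.memEll.summable_abs hν.out) fun k => ?_
  rw [norm_mul, Real.norm_eq_abs, Real.norm_eq_abs]
  exact mul_le_of_le_one_right (abs_nonneg _) (abs_eval_T_real_le_one _ hs)

open Polynomial.Chebyshev in
lemma hasSum_chebSum (u : EllOne ν) {s : ℝ} (hs : |s| ≤ 1) :
    HasSum (fun k : ℕ => (if k = 0 then 1 else 2) * u k * (T ℝ k).eval s) (chebSum s u) := by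
  refine Summable.hasSum ?_
  refine Summable.of_norm_bounded ((summable_mul_eval_T u hs).norm.mul_left 2) fun k => ?_
  rw [mul_assoc, norm_mul]
  refine mul_le_mul_of_nonneg_right ?_ (norm_nonneg _)
  split_ifs <;> simp

open Polynomial.Chebyshev in
lemma hasSum_int_chebSum (u : EllOne ν) {s : ℝ} (hs : |s| ≤ 1) :
    HasSum (fun k : ℤ => u k.natAbs * (T ℝ k).eval s) (chebSum s u) := by
  have h := hasSum_natAbs (summable_mul_eval_T u hs)
  simpa only [T_natAbs, chebSum, mul_assoc] using h

open Polynomial.Chebyshev in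
/-- The value at `s ∈ [-1, 1]` of a product of two Chebyshev series is the product of the values,
because of `2 Tₘ Tₙ = Tₘ₊ₙ + Tₘ₋ₙ`. -/
lemma chebSum_mul (u v : EllOne ν) {s : ℝ} (hs : |s| ≤ 1) :
    chebSum s (u * v : EllOne ν) = chebSum s u * chebSum s v := by
  have hu := hasSum_int_chebSum u hs
  have hv := hasSum_int_chebSum v hs
  have hT : ∀ k : ℤ, |(T ℝ k).eval s| ≤ 1 := fun k => abs_eval_T_real_le_one k hs
  have hprod : HasSum (fun z : ℤ × ℤ => u z.1.natAbs * (T ℝ z.1).eval s *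
      (v z.2.natAbs * (T ℝ z.2).eval s)) (chebSum s u * chebSum s v) := by
    have := summable_mul_of_summable_norm hu.summable.norm hv.summable.norm
    rw [← hu.tsum_eq, ← hv.tsum_eq, tsum_mul_tsum_of_summable_norm hu.summable.norm
      hv.summable.norm]
    exact this.hasSum
  have habs := summable_mul_of_summable_norm (f := fun k : ℤ => u k.natAbs)
    (g := fun k : ℤ => v k.natAbs) u.summable_int v.summable_int
  have hplus : Summable fun z : ℤ × ℤ => u z.1.natAbs * v z.2.natAbs *
      (T ℝ (z.1 + z.2)).eval s := by
    refine Summable.of_norm_bounded habs.norm fun z => ?_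
    rw [norm_mul]
    exact mul_le_of_le_one_right (norm_nonneg _) (hT _)
  -- the terms with `T (m - n)` become those with `T (m + n)` under `n ↦ -n`
  let e : ℤ × ℤ ≃ ℤ × ℤ := (Equiv.refl ℤ).prodCongr (Equiv.neg ℤ)
  have hminus : HasSum (fun z : ℤ × ℤ => u z.1.natAbs * v z.2.natAbs *
      (T ℝ (z.1 - z.2)).eval s) (∑' z : ℤ × ℤ, u z.1.natAbs * v z.2.natAbs *
      (T ℝ (z.1 + z.2)).eval s) := by
    have := e.hasSum_iff.2 hplus.hasSum
    refine this.congr_fun ?_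
    intro z
    simp [e, sub_eq_add_neg]
  have h2 : HasSum (fun z : ℤ × ℤ => u z.1.natAbs * (T ℝ z.1).eval s *
      (v z.2.natAbs * (T ℝ z.2).eval s)) (∑' z : ℤ × ℤ, u z.1.natAbs * v z.2.natAbs *
      (T ℝ (z.1 + z.2)).eval s) := by
    have := (hplus.hasSum.add hminus).div_const 2
    rw [add_self_div_two] at this
    refine this.congr_fun fun z => ?_
    have h3 := congrArg (Polynomial.eval s) (T_mul_T ℝ z.1 z.2)
    simp only [Polynomial.eval_mul, Polynomial.eval_add, Polynomial.eval_ofNat] at h3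
    rw [← mul_add, ← h3]; ring
  have huv := hasSum_int_chebSum (u * v) hs
  have hconv : Summable fun p : ℤ × ℤ => u p.2.natAbs * v (p.1 - p.2).natAbs *
      (T ℝ p.1).eval s := by
    refine Summable.of_norm_bounded (summable_int_conv (a := fun k => u k.natAbs)
      (b := fun k => v k.natAbs) u.summable_int v.summable_int).norm fun p => ?_
    rw [norm_mul]
    exact mul_le_of_le_one_right (norm_nonneg _) (hT _)
  let e' : ℤ × ℤ ≃ ℤ × ℤ :=
    { toFun := fun p => (p.2, p.1 - p.2)
      invFun := fun p => (p.1 + p.2, p.1)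
      left_inv := fun p => by ext <;> simp
      right_inv := fun p => by ext <;> simp }
  rw [hprod.unique h2, ← huv.tsum_eq, ← e'.tsum_eq]
  simp only [e', Equiv.coe_fn_mk, add_sub_cancel]
  rw [hconv.tsum_prod]
  refine tsum_congr fun k => ?_
  rw [EllOne.mul_natAbs]
  exact tsum_mul_right.symm

open Polynomial.Chebyshev in
lemma chebSum_one (s : ℝ) : chebSum s (1 : EllOne ν) = 1 := by
  unfold chebSum
  rw [tsum_eq_single 0]
  · simp [EllOne.coe_one]
  · intro k hk; simp [EllOne.coe_one, hk]

/-- Summation of Chebyshev series at a point of `[-1, 1]`, as a linear map. -/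
def chebSumₗ (ν : ℝ) [Fact (1 < ν)] {s : ℝ} (hs : |s| ≤ 1) : EllOne ν →ₗ[ℝ] ℝ where
  toFun u := chebSum s u
  map_add' u v := by
    rw [← ((hasSum_chebSum u hs).add (hasSum_chebSum v hs)).tsum_eq, chebSum]
    refine tsum_congr fun k => ?_
    simp only [EllOne.coe_add, Pi.add_apply]; ring
  map_smul' c u := by
    rw [RingHom.id_apply, smul_eq_mul, ← ((hasSum_chebSum u hs).mul_left c).tsum_eq, chebSum]
    refine tsum_congr fun k => ?_
    simp only [EllOne.coe_smul, Pi.smul_apply, smul_eq_mul]; ring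

lemma chebSumₗ_apply {s : ℝ} (hs : |s| ≤ 1) (u : EllOne ν) : chebSumₗ ν hs u = chebSum s u := rfl

end Algebra


/-! ### The vector field as a polynomial -/

/-- The expression defining the vector field is natural in the algebra of its variables. -/
lemma fieldOver_map {R S : Type*} [AddCommGroup R] [Module ℝ R] [AddCommGroup S] [Module ℝ S]
    (P : Params) {mulR : R → R → R} {mulS : S → S → S} {oneR : R} {oneS : S} (φ : R →ₗ[ℝ] S)
    (hmul : ∀ a b, φ (mulR a b) = mulS (φ a) (φ b)) (hone : φ oneR = oneS) (X : Fin 6 → R)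
    (i : Fin 6) :
    fieldOver P mulS oneS (fun j => φ (X j)) i = φ (fieldOver P mulR oneR X i) := by
  unfold fieldOver
  refine Fin.cases ?_ (fun i => Fin.cases ?_ (fun i => ?_) i) i
  · simp [hmul, hone]
  · simp [hmul, hone]
  · simp [hmul, hone]

/-- The components of the vector field as polynomials in six variables. -/
def fieldPoly (P : Params) : Fin 6 → MvPolynomial (Fin 6) ℝ :=
  fieldOver P (fun a b => a * b) 1 MvPolynomial.X

lemma aeval_fieldPoly {R : Type*} [CommRing R] [Algebra ℝ R] (P : Params) (x : Fin 6 → R)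
    (i : Fin 6) :
    MvPolynomial.aeval x (fieldPoly P i) = fieldOver P (fun a b => a * b) 1 x i := by
  have := fieldOver_map P (mulR := fun a b => a * b) (mulS := fun a b : R => a * b)
    (MvPolynomial.aeval (R := ℝ) x).toLinearMap (by simp) (by simp) MvPolynomial.X i
    (oneR := (1 : MvPolynomial (Fin 6) ℝ)) (oneS := (1 : R))
  simpa [fieldPoly] using this.symm

lemma totalDegree_fieldPoly_le (P : Params) (i : Fin 6) : (fieldPoly P i).totalDegree ≤ 4 := by
  have hmul : ∀ {a b : ℕ} {p q : MvPolynomial (Fin 6) ℝ},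
      p ∈ MvPolynomial.restrictTotalDegree (Fin 6) ℝ a →
      q ∈ MvPolynomial.restrictTotalDegree (Fin 6) ℝ b →
      p * q ∈ MvPolynomial.restrictTotalDegree (Fin 6) ℝ (a + b) := by
    intro a b p q hp hq
    rw [MvPolynomial.mem_restrictTotalDegree] at *
    exact (MvPolynomial.totalDegree_mul p q).trans (add_le_add hp hq)
  have hX : ∀ j, (MvPolynomial.X j : MvPolynomial (Fin 6) ℝ) ∈
      MvPolynomial.restrictTotalDegree (Fin 6) ℝ 1 := by
    intro j; rw [MvPolynomial.mem_restrictTotalDegree, MvPolynomial.totalDegree_X]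
  have h1 : (1 : MvPolynomial (Fin 6) ℝ) ∈ MvPolynomial.restrictTotalDegree (Fin 6) ℝ 1 := by
    rw [MvPolynomial.mem_restrictTotalDegree, MvPolynomial.totalDegree_one]; exact Nat.zero_le _
  have hL : ∀ a b c : ℝ, a • MvPolynomial.X 0 + b • MvPolynomial.X 1 -
      c • (1 : MvPolynomial (Fin 6) ℝ) ∈ MvPolynomial.restrictTotalDegree (Fin 6) ℝ 1 :=
    fun a b c => Submodule.sub_mem _ (Submodule.add_mem _ (Submodule.smul_mem _ _ (hX 0))
      (Submodule.smul_mem _ _ (hX 1))) (Submodule.smul_mem _ _ h1)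
  have hG : ∀ a b c : Fin 4 → ℝ, ∑ i : Fin 4, (a i • MvPolynomial.X 0 + b i • MvPolynomial.X 1 -
      c i • (1 : MvPolynomial (Fin 6) ℝ)) * MvPolynomial.X i.succ.succ
      ∈ MvPolynomial.restrictTotalDegree (Fin 6) ℝ 2 :=
    fun a b c => Submodule.sum_mem _ fun i _ => hmul (hL _ _ _) (hX _)
  have h24 : ∀ p ∈ MvPolynomial.restrictTotalDegree (Fin 6) ℝ 2, p.totalDegree ≤ 4 := by
    intro p hp
    rw [MvPolynomial.mem_restrictTotalDegree] at hp
    omega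
  unfold fieldPoly fieldOver
  refine Fin.cases ?_ (fun i => Fin.cases ?_ (fun i => ?_) i) i
  · exact h24 _ (Submodule.neg_mem _ (hG _ _ _))
  · exact h24 _ (Submodule.neg_mem _ (hG _ _ _))
  · exact (MvPolynomial.mem_restrictTotalDegree _ _ _).1 (Submodule.neg_mem _
      (hmul (Submodule.add_mem _ (hmul (hL _ _ _) (hG _ _ _)) (hmul (hL _ _ _) (hG _ _ _))) (hX _)))

/-! ### Taylor's formula for polynomials -/

section Taylor

variable {σ : Type*} [Fintype σ] {R : Type*} [CommRing R] [Algebra ℝ R]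

/-- Iterated partial derivatives of a polynomial; the last variable of the list is applied first. -/
def pderivs (js : List σ) (p : MvPolynomial σ ℝ) : MvPolynomial σ ℝ :=
  js.foldr (fun j q => MvPolynomial.pderiv j q) p

open Polynomial in
/-- The restriction `ε ↦ p(x + ε h)` of a polynomial to a line. -/
def alongLine (x h : σ → R) (p : MvPolynomial σ ℝ) : R[X] :=
  MvPolynomial.aeval (fun j => C (x j) + C (h j) * X) p

open Polynomial in
lemma derivative_alongLine (x h : σ → R) (p : MvPolynomial σ ℝ) :
    derivative (alongLine x h p) = ∑ j, C (h j) * alongLine x h (MvPolynomial.pderiv j p) := by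
  classical
  induction p using MvPolynomial.induction_on with
  | C a => simp [alongLine, IsScalarTower.algebraMap_apply ℝ R R[X]]
  | add p q hp hq =>
    simp only [alongLine, map_add, mul_add, Finset.sum_add_distrib] at *
    rw [hp, hq]
  | mul_X p k hp =>
    simp only [alongLine] at hp
    simp only [alongLine, map_mul, MvPolynomial.aeval_X, Derivation.leibniz,
      smul_eq_mul, map_add]
    simp only [mul_add (C (h _)), Finset.sum_add_distrib]
    rw [derivative_mul, hp]
    have h0 : derivative (C (x k) + C (h k) * X : R[X]) = C (h k) := by simp
    rw [h0, Finset.sum_eq_single (f := fun j => C (h j) * (MvPolynomial.aeval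
      (fun j => C (x j) + C (h j) * X) p * MvPolynomial.aeval (fun j => C (x j) + C (h j) * X)
      (MvPolynomial.pderiv j (MvPolynomial.X k : MvPolynomial σ ℝ)))) k]
    · rw [MvPolynomial.pderiv_X_self, map_one, mul_one, add_comm, mul_comm (C (h k)),
        Finset.sum_mul]
      exact congrArg₂ (· + ·) (mul_comm _ _) (Finset.sum_congr rfl fun j _ => by ring)
    · intro j _ hj
      rw [MvPolynomial.pderiv_X_of_ne hj.symm]; simp
    · simp

open Polynomial in
lemma iterate_derivative_alongLine (x h : σ → R) (p : MvPolynomial σ ℝ) (k : ℕ) :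
    derivative^[k] (alongLine x h p) = ∑ js : Fin k → σ, C (∏ l, h (js l)) *
      alongLine x h (pderivs (List.ofFn js) p) := by
  induction k with
  | zero => simp [pderivs]
  | succ k ih =>
    rw [Function.iterate_succ_apply', ih, derivative_sum,
      ← (Fin.consEquiv fun _ : Fin (k + 1) => σ).sum_comp, Fintype.sum_prod_type, Finset.sum_comm]
    refine Finset.sum_congr rfl fun js _ => ?_
    rw [derivative_C_mul, derivative_alongLine, Finset.mul_sum]
    refine Finset.sum_congr rfl fun j _ => ?_
    simp [Fin.prod_univ_succ, pderivs]
    ring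

open Polynomial in
lemma eval_alongLine (x h : σ → R) (p : MvPolynomial σ ℝ) (r : R) :
    (alongLine x h p).eval r = MvPolynomial.aeval (fun j => x j + h j * r) p := by
  unfold alongLine
  have h1 := MvPolynomial.comp_aeval_apply (R := ℝ) (fun j => C (x j) + C (h j) * X)
    ((aeval r : R[X] →ₐ[R] R).restrictScalars ℝ) p
  simpa using h1

open Polynomial in
lemma natDegree_alongLine_le (x h : σ → R) (p : MvPolynomial σ ℝ) :
    (alongLine x h p).natDegree ≤ p.totalDegree := by
  unfold alongLine
  rw [MvPolynomial.aeval_def, MvPolynomial.eval₂_eq']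
  refine natDegree_sum_le_of_forall_le _ _ fun d hd => ?_
  have h1 : ∀ j, (C (x j) + C (h j) * X : R[X]).natDegree ≤ 1 := fun j => by compute_degree
  have h2 : (∏ j, (C (x j) + C (h j) * X : R[X]) ^ d j).natDegree ≤ ∑ j, d j :=
    (natDegree_prod_le _ _).trans (Finset.sum_le_sum fun j _ =>
      (natDegree_pow_le_of_le (d j) (h1 j)).trans (mul_one _).le)
  have h3 : ∑ j, d j ≤ p.totalDegree := by
    rw [← Finsupp.sum_fintype d (fun _ n => n) fun _ => rfl]
    exact MvPolynomial.le_totalDegree hd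
  rw [IsScalarTower.algebraMap_apply ℝ R R[X], algebraMap_eq]
  exact (natDegree_C_mul_le _ _).trans (h2.trans h3)

/-- Taylor's formula for a polynomial of degree at most `d` with values in an `ℝ`-algebra. -/
lemma aeval_add_eq_sum (x h : σ → R) (p : MvPolynomial σ ℝ) {d : ℕ} (hd : p.totalDegree ≤ d) :
    MvPolynomial.aeval (x + h) p = ∑ k ∈ Finset.range (d + 1), (1 / (k.factorial : ℝ)) •
      ∑ js : Fin k → σ, (∏ l, h (js l)) * MvPolynomial.aeval x (pderivs (List.ofFn js) p) := by
  have h1 := eval_alongLine x h p 1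
  rw [Polynomial.eval_eq_sum_range' (Nat.lt_succ_of_le ((natDegree_alongLine_le x h p).trans hd))]
    at h1
  simp only [one_pow, mul_one] at h1
  have h2 : (fun j => x j + h j) = x + h := rfl
  rw [h2] at h1
  rw [← h1]
  refine Finset.sum_congr rfl fun k _ => ?_
  have h3 := congrArg (Polynomial.eval 0) (iterate_derivative_alongLine x h p k)
  simp only [Polynomial.eval_finsetSum, Polynomial.eval_mul, Polynomial.eval_C,
    eval_alongLine, mul_zero, add_zero] at h3
  rw [← h3, ← Polynomial.coeff_zero_eq_eval_zero, Polynomial.coeff_iterate_derivative, zero_add,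
    Nat.descFactorial_self, ← Nat.cast_smul_eq_nsmul ℝ, smul_smul, one_div,
    inv_mul_cancel₀ (by exact_mod_cast Nat.factorial_ne_zero k), one_smul]

lemma totalDegree_pderiv_le (j : σ) (p : MvPolynomial σ ℝ) :
    (MvPolynomial.pderiv j p).totalDegree ≤ p.totalDegree - 1 := by
  conv_lhs => rw [p.as_sum, map_sum]
  refine MvPolynomial.totalDegree_finsetSum_le fun d hd => ?_
  rw [MvPolynomial.pderiv_monomial]
  by_cases h0 : d j = 0
  · simp [h0]
  · refine (MvPolynomial.totalDegree_monomial_le _ _).trans ?_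
    have h1 := MvPolynomial.le_totalDegree hd
    rw [Finsupp.sum_fintype d _ fun _ => rfl] at h1
    rw [Finsupp.sum_fintype _ _ fun _ => rfl]
    have h2 : ∑ i, d i = ∑ i, (id (((d - Finsupp.single j 1 : σ →₀ ℕ)) i) + Finsupp.single j 1 i) := by
      refine Finset.sum_congr rfl fun i _ => ?_
      by_cases hij : j = i
      · subst hij; simp; omega
      · simp [hij]
    rw [Finset.sum_add_distrib, ← Finsupp.sum_fintype (Finsupp.single j 1) (fun _ n => n) fun _ => rfl,
      Finsupp.sum_single_index rfl] at h2
    omega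

/-- The derivative at `ε = 0` of a real linear function of `p(x + ε h)`. -/
lemma hasDerivAt_aeval_line (φ : R →ₗ[ℝ] ℝ) (x h : σ → R) (p : MvPolynomial σ ℝ) :
    HasDerivAt (fun ε : ℝ => φ (MvPolynomial.aeval (x + ε • h) p))
      (φ (∑ j, h j * MvPolynomial.aeval x (MvPolynomial.pderiv j p))) 0 := by
  set q := alongLine x h p with hq
  have h1 : ∀ ε : ℝ, φ (MvPolynomial.aeval (x + ε • h) p)
      = ∑ k ∈ Finset.range (q.natDegree + 1), φ (q.coeff k) * ε ^ k := by
    intro ε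
    have h2 := eval_alongLine x h p (algebraMap ℝ R ε)
    have h3 : (fun j => x j + h j * algebraMap ℝ R ε) = x + ε • h := by
      funext j
      rw [mul_comm, ← Algebra.smul_def]; rfl
    rw [h3, ← hq, Polynomial.eval_eq_sum_range] at h2
    rw [← h2, map_sum]
    refine Finset.sum_congr rfl fun k _ => ?_
    rw [← map_pow, mul_comm, ← Algebra.smul_def, map_smul, smul_eq_mul, mul_comm]
  have h4 : ∑ j, h j * MvPolynomial.aeval x (MvPolynomial.pderiv j p) = q.coeff 1 := by
    have h5 := congrArg (Polynomial.eval 0) (derivative_alongLine x h p)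
    simp only [Polynomial.eval_finsetSum, Polynomial.eval_mul, Polynomial.eval_C,
      eval_alongLine, mul_zero, add_zero] at h5
    rw [← h5, ← Polynomial.coeff_zero_eq_eval_zero, Polynomial.coeff_derivative, hq]
    simp
  simp_rw [h1]
  rw [h4]
  have h6 : HasDerivAt (fun ε : ℝ => ∑ k ∈ Finset.range (q.natDegree + 1), φ (q.coeff k) * ε ^ k)
      (∑ k ∈ Finset.range (q.natDegree + 1), φ (q.coeff k) * (k * 0 ^ (k - 1))) 0 :=
    HasDerivAt.fun_sum fun k _ => (hasDerivAt_pow k (0 : ℝ)).const_mul _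
  convert h6 using 1
  by_cases hd : q.natDegree = 0
  · rw [hd]
    simp [Polynomial.coeff_eq_zero_of_natDegree_lt (show q.natDegree < 1 by omega)]
  · rw [Finset.sum_eq_single 1]
    · simp
    · intro k _ hk
      rcases Nat.eq_zero_or_pos k with h | h
      · simp [h]
      · rw [zero_pow (by omega)]; simp
    · intro hk
      exact absurd (Finset.mem_range.2 (by omega)) hk

lemma lineDeriv_eq_of_hasDerivAt {W : Type*} [AddCommGroup W] [Module ℝ W] {G : W → ℝ}
    {x h : W} {d : ℝ} (H : HasDerivAt (fun ε : ℝ => G (x + ε • h)) d 0) : lineDeriv ℝ G x h = d :=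
  H.deriv

end Taylor

/-! ### Coefficient sequences with bounded support -/

section Support

variable {ν : ℝ} [hν : Fact (1 < ν)]

lemma EllOne.mul_eq_zero_of_support {u v : EllOne ν} {a b : ℕ} (hu : ∀ k, a < k → u k = 0)
    (hv : ∀ k, b < k → v k = 0) (k : ℕ) (hk : a + b < k) : (u * v : EllOne ν) k = 0 := by
  rw [EllOne.coe_mul, conv]
  convert tsum_zero with l
  by_cases h : a < l.natAbs
  · rw [hu _ h, zero_mul]
  · rw [hv _ (by omega), mul_zero]

/-- A polynomial of degree at most `d` in sequences supported in `[0, a]` is supported in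
`[0, d a]`. -/
lemma aeval_eq_zero_of_support {σ : Type*} [Fintype σ] {x : σ → EllOne ν} {a d : ℕ}
    (hx : ∀ j k, a < k → x j k = 0) {p : MvPolynomial σ ℝ} (hp : p.totalDegree ≤ d) (k : ℕ)
    (hk : d * a < k) : (MvPolynomial.aeval x p : EllOne ν) k = 0 := by
  have hpow : ∀ j n k, n * a < k → (x j ^ n : EllOne ν) k = 0 := by
    intro j n
    induction n with
    | zero =>
      intro k hk
      rw [pow_zero, EllOne.coe_one]
      simp [show k ≠ 0 by omega]
    | succ n ih =>
      intro k hk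
      rw [pow_succ]
      exact EllOne.mul_eq_zero_of_support ih (hx j) k (by linarith [add_mul n 1 a])
  have hprod : ∀ (e : σ → ℕ) (s : Finset σ) k, (∑ j ∈ s, e j) * a < k →
      (∏ j ∈ s, x j ^ e j : EllOne ν) k = 0 := by
    classical
    intro e s
    induction s using Finset.induction_on with
    | empty =>
      intro k hk
      rw [Finset.prod_empty, EllOne.coe_one]
      simp [show k ≠ 0 by omega]
    | insert j s hj ih =>
      intro k hk
      rw [Finset.prod_insert hj]
      rw [Finset.sum_insert hj, add_mul] at hk
      exact EllOne.mul_eq_zero_of_support (hpow j _) ih k hk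
  rw [MvPolynomial.aeval_def, MvPolynomial.eval₂_eq', ← EllOne.coeffs_apply, map_sum,
    Finset.sum_apply]
  refine Finset.sum_eq_zero fun e he => ?_
  have he' : ∑ j, e j ≤ d := by
    rw [← Finsupp.sum_fintype e (fun _ n => n) fun _ => rfl]
    exact (MvPolynomial.le_totalDegree he).trans hp
  rw [← Algebra.smul_def, EllOne.coeffs_apply, EllOne.coe_smul, Pi.smul_apply,
    hprod _ _ _ (lt_of_le_of_lt (Nat.mul_le_mul_right a he') hk), smul_zero]

/-- On absolutely summable sequences the coefficient action of the field is evaluation of its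
polynomial components in the Banach algebra `EllOne ν`. -/
lemma seqField_coe (P : Params) (x : Fin 6 → EllOne ν) (i : Fin 6) :
    seqField P (fun j => (x j).coeff) i = (MvPolynomial.aeval x (fieldPoly P i) : EllOne ν).coeff := by
  rw [aeval_fieldPoly]
  exact fieldOver_map P (mulR := fun a b : EllOne ν => a * b) (mulS := conv) (EllOne.coeffs ν)
    (fun a b => rfl) (EllOne.coe_one (ν := ν)) x i

/-- Summing the Chebyshev series is an algebra homomorphism, hence commutes with the polynomial
field. -/
lemma chebSum_seqField (P : Params) (x : Fin 6 → EllOne ν) {s : ℝ} (hs : |s| ≤ 1) (i : Fin 6) :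
    chebSum s (seqField P (fun j => (x j).coeff) i) = field P (fun j => chebSum s (x j)) i := by
  rw [seqField_coe, aeval_fieldPoly]
  exact (fieldOver_map P (mulR := fun a b : EllOne ν => a * b) (mulS := fun x y : ℝ => x * y)
    (chebSumₗ ν hs) (fun a b => chebSum_mul a b hs) (chebSum_one s) x i).symm

end Support


/-! ### Derivatives of the zero-finding map -/

section Derivatives

variable {ν : ℝ} [hν : Fact (1 < ν)]

lemma memEll_mp {u : ℕ → ℝ} (hu : MemEll ν u) : MemEll ν (mp u) := by
  have h0 : 0 < ν := by linarith [hν.out]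
  rw [memEll_iff_pow hν.out] at hu ⊢
  rw [← summable_nat_add_iff 1]
  have h2 := (summable_nat_add_iff 2).2 hu
  refine Summable.of_nonneg_of_le (fun k => by positivity) (fun k => ?_)
    ((hu.mul_left ν).add h2)
  have h3 : |mp u (k + 1)| ≤ |u k| + |u (k + 2)| := abs_sub _ _
  calc |mp u (k + 1)| * ν ^ (k + 1) ≤ (|u k| + |u (k + 2)|) * ν ^ (k + 1) := by gcongr
    _ = ν * (|u k| * ν ^ k) + |u (k + 2)| * ν ^ (k + 1) := by ring
    _ ≤ _ := by
      gcongr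
      · exact hν.out.le
      · omega

/-- `u ↦ u_∓` as a linear map of `ℓ¹_ν`. -/
def mpₗ (ν : ℝ) [Fact (1 < ν)] : EllOne ν →ₗ[ℝ] EllOne ν where
  toFun u := ⟨mp u, memEll_mp u.memEll⟩
  map_add' u v := by
    refine EllOne.ext fun k => ?_
    cases k <;> simp [mp]; ring
  map_smul' c u := by
    refine EllOne.ext fun k => ?_
    cases k <;> simp [mp]; ring

lemma coe_mpₗ (u : EllOne ν) : (mpₗ ν u).coeff = mp u := rfl

open Polynomial.Chebyshev in
lemma rightVal_eq (u : EllOne ν) : rightVal u = chebSum 1 u := by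
  have h := (hasSum_chebSum u (s := 1) (by simp)).summable
  unfold rightVal chebSum
  rw [h.tsum_eq_zero_add, ← tsum_mul_left]
  simp

open Polynomial.Chebyshev in
lemma leftVal_eq (u : EllOne ν) : leftVal u = chebSum (-1) u := by
  have h := (hasSum_chebSum u (s := -1) (by simp)).summable
  unfold leftVal chebSum
  rw [h.tsum_eq_zero_add, ← tsum_mul_left]
  congr 1
  · simp
  · refine tsum_congr fun k => ?_
    rw [T_eval_neg_one, if_neg (by omega)]
    have : (((Int.negOnePow ((k + 1 : ℕ) : ℤ) : ℤˣ) : ℤ) : ℝ) = (-1) ^ (k + 1) := by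
      rw [Int.negOnePow_def]; norm_cast
    rw [this]; ring

/-- Sequences in `ℓ¹_ν` for each subinterval and component. -/
abbrev EllFam (ν : ℝ) (M : ℕ) := Fin M → Fin 6 → EllOne ν

/-- The family of coefficients of an element of `EllFam ν M`. -/
def toC {M : ℕ} (x : EllFam ν M) : Coeffs M := fun m i => (x m i).coeff

variable {M : ℕ}

lemma toC_sub (x y : EllFam ν M) : toC (x - y) = toC x - toC y := rfl

lemma toC_add_smul (x h : EllFam ν M) (c : ℝ) : toC x + c • toC h = toC (x + c • h) := rfl

lemma memX_toC (x : EllFam ν M) : MemX ν (toC x) := fun m i => (x m i).memEll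

/-- The element of `EllFam ν M` with a single nonzero component. -/
def emb (n : Fin M) (j : Fin 6) (u : EllOne ν) : EllFam ν M := Pi.single n (Pi.single j u)

lemma toC_emb (n : Fin M) (j : Fin 6) (u : EllOne ν) : toC (emb n j u) = embed n j u.coeff := by
  funext m i
  unfold toC emb embed
  by_cases hm : m = n
  · subst hm
    by_cases hi : i = j
    · subst hi; simp
    · simp [hi]
  · simp [hm]

/-- The index of the preceding subinterval. -/
def prevIdx (m : Fin M) : Fin M := ⟨(m : ℕ) - 1, lt_of_le_of_lt (Nat.sub_le _ _) m.isLt⟩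

/-- The linear part of `F`, without the contribution of the vector field. -/
def linPart (m : Fin M) (i : Fin 6) (k : ℕ) : EllFam ν M →ₗ[ℝ] ℝ :=
  if k = 0 then
    chebSumₗ ν (s := -1) (by simp) ∘ₗ LinearMap.proj i ∘ₗ LinearMap.proj m -
      if (m : ℕ) = 0 then 0
      else chebSumₗ ν (s := 1) (by simp) ∘ₗ LinearMap.proj i ∘ₗ LinearMap.proj (prevIdx m)
  else (k : ℝ) • (LinearMap.proj k ∘ₗ EllOne.coeffs ν ∘ₗ LinearMap.proj i ∘ₗ LinearMap.proj m)

lemma linPart_of_pos (m : Fin M) (i : Fin 6) {k : ℕ} (hk : k ≠ 0) (x : EllFam ν M) :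
    linPart m i k x = k * x m i k := by
  simp [linPart, hk]

lemma linPart_zero (m : Fin M) (i : Fin 6) (x : EllFam ν M) :
    linPart m i 0 x = chebSum (-1) (x m i) -
      if (m : ℕ) = 0 then 0 else chebSum 1 (x (prevIdx m) i) := by
  unfold linPart
  rw [if_pos rfl]
  split_ifs <;> simp [chebSumₗ_apply]

variable (P : Params) (t : Fin (M + 1) → ℝ) (p₁ : Phase)

/-- `h_m / 4`, where `h_m` is the length of the `m`-th subinterval. -/
def quarterStep (t : Fin (M + 1) → ℝ) (m : Fin M) : ℝ := (t m.succ - t m.castSucc) / 4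

/-- Splitting of `F` into a linear part, the constant boundary datum `p₁`, and a polynomial of
the algebra `EllOne ν` followed by `mpₗ`. -/
lemma F_toC (x : EllFam ν M) (m : Fin M) (i : Fin 6) (k : ℕ) :
    F P t p₁ (toC x) m i k = linPart m i k x - (if k = 0 ∧ (m : ℕ) = 0 then p₁ i else 0)
      - quarterStep t m * mpₗ ν (MvPolynomial.aeval (x m) (fieldPoly P i)) k := by
  cases k with
  | zero =>
    rw [linPart_zero, coe_mpₗ]
    have h1 := leftVal_eq (x m i)
    have h2 := rightVal_eq (x (prevIdx m) i)
    rw [← h1, ← h2]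
    by_cases h : (m : ℕ) = 0 <;> simp [F, mp, prevVal, toC, prevIdx, h]
  | succ k =>
    rw [linPart_of_pos _ _ (by omega), coe_mpₗ]
    have h1 := seqField_coe P (x m) i
    simp only [F, mp]
    have h2 : toC x m = fun j => (x m j).coeff := rfl
    rw [h2, h1]
    simp [quarterStep]

/-- The derivative of `F` at `x`, as a linear functional for each component of `F`. -/
def dF (x : EllFam ν M) (m : Fin M) (i : Fin 6) (k : ℕ) : EllFam ν M →ₗ[ℝ] ℝ :=
  linPart m i k - quarterStep t m • ∑ j, LinearMap.proj k ∘ₗ EllOne.coeffs ν ∘ₗ mpₗ ν ∘ₗ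
    (LinearMap.mulLeft ℝ (MvPolynomial.aeval (x m) (MvPolynomial.pderiv j (fieldPoly P i)))) ∘ₗ
      LinearMap.proj j ∘ₗ LinearMap.proj m

lemma dF_apply (x h : EllFam ν M) (m : Fin M) (i : Fin 6) (k : ℕ) :
    dF P t x m i k h = linPart m i k h - quarterStep t m * mpₗ ν (∑ j, h m j *
      MvPolynomial.aeval (x m) (MvPolynomial.pderiv j (fieldPoly P i))) k := by
  have h1 : mpₗ ν (∑ j, h m j *
      MvPolynomial.aeval (x m) (MvPolynomial.pderiv j (fieldPoly P i))) k = (LinearMap.proj k ∘ₗ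
      EllOne.coeffs ν ∘ₗ mpₗ ν) (∑ j, h m j *
      MvPolynomial.aeval (x m) (MvPolynomial.pderiv j (fieldPoly P i))) := rfl
  rw [h1, map_sum]
  simp [dF, mul_comm]

lemma lineDeriv_F (x h : EllFam ν M) (m : Fin M) (i : Fin 6) (k : ℕ) :
    lineDeriv ℝ (fun Z => F P t p₁ Z m i k) (toC x) (toC h) = dF P t x m i k h := by
  refine lineDeriv_eq_of_hasDerivAt ?_
  simp_rw [toC_add_smul, F_toC, map_add, map_smul]
  rw [dF_apply]
  have h1 := hasDerivAt_aeval_line (LinearMap.proj k ∘ₗ EllOne.coeffs ν ∘ₗ mpₗ ν) (x m) (h m)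
    (fieldPoly P i)
  have h2 : HasDerivAt (fun ε : ℝ => linPart m i k x + ε • linPart m i k h -
      (if k = 0 ∧ (m : ℕ) = 0 then p₁ i else 0)) (linPart m i k h) 0 := by
    have := ((hasDerivAt_id (0 : ℝ)).mul_const (linPart m i k h)).const_add (linPart m i k x)
    simpa using this.sub_const (if k = 0 ∧ (m : ℕ) = 0 then p₁ i else 0)
  exact h2.sub (h1.const_mul (quarterStep t m))

/-- Iterated directional derivatives of `F` along directions supported on a single subinterval.
The linear part survives only in the first derivative; the polynomial part gives the product of the
directions with a partial derivative of the field. -/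
lemma iterLineDeriv_F (n : Fin M) (i : Fin 6) (r : ℕ) (a : Fin 6 × EllOne ν)
    (hs : List (Fin 6 × EllOne ν)) (x : EllFam ν M) :
    iterLineDeriv (fun Z => F P t p₁ Z n i r)
        ((a :: hs).map fun b => embed n b.1 b.2.coeff) (toC x) =
      (if hs = [] then linPart n i r (emb n a.1 a.2) else 0) - quarterStep t n *
        mpₗ ν (((a :: hs).map Prod.snd).prod *
          MvPolynomial.aeval (x n) (pderivs ((a :: hs).map Prod.fst) (fieldPoly P i))) r := by
  have hsum : ∀ (b : Fin 6 × EllOne ν) (q : MvPolynomial (Fin 6) ℝ) (x : EllFam ν M),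
      ∑ j, (emb n b.1 b.2 : EllFam ν M) n j * MvPolynomial.aeval (x n) (MvPolynomial.pderiv j q)
        = b.2 * MvPolynomial.aeval (x n) (MvPolynomial.pderiv b.1 q) := by
    intro b q x
    rw [Finset.sum_eq_single b.1]
    · simp [emb]
    · intro j _ hj; simp [emb, hj]
    · simp
  induction hs generalizing a x with
  | nil =>
    simp only [List.map_cons, List.map_nil, iterLineDeriv]
    rw [← toC_emb, lineDeriv_F, dF_apply, hsum]
    simp [pderivs]
  | cons b hs ih =>
    rw [List.map_cons, iterLineDeriv]
    refine lineDeriv_eq_of_hasDerivAt ?_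
    simp_rw [← toC_emb n a.1 a.2, toC_add_smul]
    simp_rw [ih b]
    rw [if_neg (List.cons_ne_nil _ _)]
    have h1 := hasDerivAt_aeval_line ((LinearMap.proj r ∘ₗ EllOne.coeffs ν ∘ₗ mpₗ ν) ∘ₗ
      LinearMap.mulLeft ℝ ((b :: hs).map Prod.snd).prod) (x n) ((emb n a.1 a.2 : EllFam ν M) n)
      (pderivs ((b :: hs).map Prod.fst) (fieldPoly P i))
    rw [hsum] at h1
    have h2 := (h1.const_mul (quarterStep t n)).const_sub
      (if hs = [] then linPart n i r (emb n b.1 b.2) else 0)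
    refine HasDerivAt.congr_deriv (f' := _) h2 ?_
    rw [zero_sub, List.map_cons, List.prod_cons, List.map_cons (f := Prod.fst)]
    change -(quarterStep t n * mpₗ ν (((b :: hs).map Prod.snd).prod * (a.2 * _)) r) = _
    rw [mul_left_comm, ← mul_assoc]
    rfl

variable {K : ℕ} (Xbar : Fin M → Fin 6 → Fin K → ℝ)

/-- The approximate solution as an element of `EllFam ν M`. -/
def injE (ν : ℝ) (Xbar : Fin M → Fin 6 → Fin K → ℝ) : EllFam ν M :=
  fun m i => ⟨inj Xbar m i, memEll_of_finite K fun k hk => by simp [inj, not_lt.2 hk]⟩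

lemma toC_injE : toC (injE ν Xbar) = inj Xbar := rfl

lemma injE_eq_zero (m : Fin M) (i : Fin 6) {k : ℕ} (hk : K ≤ k) : injE ν Xbar m i k = 0 := by
  simp [injE, inj, not_lt.2 hk]

/-- The unit vectors of `ℓ¹_ν`. -/
def unitVec (ν : ℝ) (l : ℕ) : EllOne ν :=
  ⟨Pi.single l 1, memEll_of_finite (l + 1) fun k hk => by simp [show k ≠ l by omega]⟩

lemma DF_eq (r s : Idx M) : DF P t p₁ (inj Xbar) r s =
    dF P t (injE ν Xbar) r.1 r.2.1 r.2.2 (emb s.1 s.2.1 (unitVec ν s.2.2)) := by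
  rw [DF, ← toC_injE (ν := ν), ← lineDeriv_F P t p₁, toC_emb]; rfl

/-- The Chebyshev coefficients of the partial derivatives of the vector field along the approximate
solution. -/
def uE (ν : ℝ) [Fact (1 < ν)] (n : Fin M) (i j : Fin 6) : EllOne ν :=
  MvPolynomial.aeval (injE ν Xbar n) (MvPolynomial.pderiv j (fieldPoly P i))

lemma uCoeff_eq (n : Fin M) (i j : Fin 6) : uCoeff P Xbar n i j = uE P Xbar ν n i j := by
  funext k
  unfold uCoeff
  refine lineDeriv_eq_of_hasDerivAt ?_
  have h0 : ∀ ε : ℝ, seqField P (inj Xbar n + ε • (Pi.single j (Pi.single 0 1) : Fin 6 → ℕ → ℝ)) i k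
      = (LinearMap.proj k ∘ₗ EllOne.coeffs ν) (MvPolynomial.aeval
        (injE ν Xbar n + ε • (Pi.single j 1 : Fin 6 → EllOne ν)) (fieldPoly P i)) := by
    intro ε
    have h1 := seqField_coe P (injE ν Xbar n + ε • (Pi.single j (1 : EllOne ν) : Fin 6 → EllOne ν)) i
    have h2 : (fun l => ((injE ν Xbar n + ε • (Pi.single j (1 : EllOne ν) : Fin 6 → EllOne ν)) l).coeff)
        = inj Xbar n + ε • (Pi.single j (Pi.single 0 1) : Fin 6 → ℕ → ℝ) := by
      funext l
      by_cases hl : l = j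
      · subst hl; simp [injE, EllOne.coe_one]
      · simp [injE, hl]
    rw [h2] at h1
    rw [h1]; rfl
  simp_rw [h0]
  have h3 := hasDerivAt_aeval_line (LinearMap.proj k ∘ₗ EllOne.coeffs ν) (injE ν Xbar n)
    (Pi.single j (1 : EllOne ν)) (fieldPoly P i)
  convert h3 using 1
  rw [Finset.sum_eq_single j]
  · simp [uE]
  · intro l _ hl; simp [hl]
  · simp

lemma DkF_eq (k : ℕ) (hk : 2 ≤ k) (n : Fin M) (js : Fin k → Fin 6) (i : Fin 6)
    (U : Fin k → EllOne ν) :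
    DkF P t p₁ Xbar k n js i (fun l => (U l).coeff) = (-quarterStep t n • mpₗ ν ((∏ l, U l) *
      MvPolynomial.aeval (injE ν Xbar n) (pderivs (List.ofFn js) (fieldPoly P i))) : EllOne ν) := by
  funext r
  obtain ⟨k, rfl⟩ := Nat.exists_eq_add_of_le' hk
  have h1 : (List.ofFn fun l => embed n (js l) (U l).coeff)
      = ((js 0, U 0) :: List.ofFn fun l : Fin (k + 1) => (js l.succ, U l.succ)).map
        fun b => embed n b.1 b.2.coeff := by
    rw [List.map_cons, List.map_ofFn, List.ofFn_succ]; rfl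
  unfold DkF
  rw [h1, ← toC_injE (ν := ν), iterLineDeriv_F, if_neg (by simp), List.map_cons, List.map_ofFn,
    List.map_cons, List.map_ofFn]
  have h2 : (js 0 :: List.ofFn (Prod.fst ∘ fun l : Fin (k + 1) => (js l.succ, U l.succ)))
      = List.ofFn js := by
    rw [List.ofFn_succ (f := js)]; rfl
  have h3 : (U 0 :: List.ofFn (Prod.snd ∘ fun l : Fin (k + 1) => (js l.succ, U l.succ))).prod
      = ∏ l, U l := by
    rw [Fin.prod_univ_succ, List.prod_cons, List.prod_ofFn]; rfl
  simp only [h2, h3]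
  simp

end Derivatives


/-! ### Infinite matrices acting on `ℓ¹_ν` -/

section Kernels

variable {ν : ℝ} [hν : Fact (1 < ν)]

/-- A matrix whose `l`-th column has norm at most `c ξ_l` acts on `ℓ¹_ν` with norm at most `c`:
the double sum of `|b k l| ξ_k |h l|` converges, which is all that is needed to exchange the sums. -/
lemma kernel_aux {b : ℕ → ℕ → ℝ} {c : ℝ} (hcol : ∀ l, MemEll ν fun k => b k l)
    (hle : ∀ l, nuNorm ν (fun k => b k l) ≤ c * xi ν l) (h : EllOne ν) :
    (∀ k, Summable fun l => b k l * h l) ∧ MemEll ν (fun k => ∑' l, b k l * h l) ∧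
      nuNorm ν (fun k => ∑' l, b k l * h l) ≤ c * ‖h‖ := by
  have hξ : ∀ k, 0 < xi ν k := xi_pos hν.out
  have h1 : ∀ l, HasSum (fun k => |b k l| * xi ν k * |h l|) (nuNorm ν (fun k => b k l) * |h l|) :=
    fun l => (Summable.hasSum (hcol l)).mul_right _
  have h2 : ∀ l, nuNorm ν (fun k => b k l) * |h l| ≤ c * (|h l| * xi ν l) := fun l => by
    calc _ ≤ c * xi ν l * |h l| := mul_le_mul_of_nonneg_right (hle l) (abs_nonneg _)
      _ = _ := by ring
  have h2s : Summable fun l => nuNorm ν (fun k => b k l) * |h l| :=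
    Summable.of_nonneg_of_le (fun l => mul_nonneg (nuNorm_nonneg _) (abs_nonneg _)) h2
      (Summable.mul_left c h.memEll)
  have hs : Summable fun p : ℕ × ℕ => |b p.2 p.1| * xi ν p.2 * |h p.1| := by
    rw [summable_prod_of_nonneg fun p => by have := (hξ p.2).le; positivity]
    refine ⟨fun l => (h1 l).summable, ?_⟩
    simp only [(h1 _).tsum_eq]
    exact h2s
  have hs' : Summable fun p : ℕ × ℕ => |b p.1 p.2| * xi ν p.1 * |h p.2| := hs.prod_symm
  have hrow : ∀ k, Summable fun l => |b k l * h l| := fun k => by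
    have := (hs'.prod_factor k).mul_left (xi ν k)⁻¹
    refine this.congr fun l => ?_
    rw [abs_mul]; field_simp [(hξ k).ne']
  have hle' : ∀ k, |∑' l, b k l * h l| * xi ν k ≤ ∑' l, |b k l| * xi ν k * |h l| := fun k => by
    calc |∑' l, b k l * h l| * xi ν k ≤ (∑' l, |b k l * h l|) * xi ν k := by
          refine mul_le_mul_of_nonneg_right ?_ (hξ k).le
          have := norm_tsum_le_tsum_norm (f := fun l => b k l * h l) (hrow k).of_abs.norm
          simpa only [Real.norm_eq_abs] using this
      _ = _ := by
          rw [← tsum_mul_right]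
          exact tsum_congr fun l => by rw [abs_mul]; ring
  have hmem : MemEll ν (fun k => ∑' l, b k l * h l) :=
    Summable.of_nonneg_of_le (fun k => mul_nonneg (abs_nonneg _) (hξ k).le) hle' hs'.prod
  refine ⟨fun k => (hrow k).of_abs, hmem, ?_⟩
  calc nuNorm ν (fun k => ∑' l, b k l * h l) ≤ ∑' k, ∑' l, |b k l| * xi ν k * |h l| :=
        Summable.tsum_le_tsum hle' hmem hs'.prod
    _ = ∑' l, ∑' k, |b k l| * xi ν k * |h l| :=
        Summable.tsum_comm (f := fun l k => |b k l| * xi ν k * |h l|) hs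
    _ = ∑' l, nuNorm ν (fun k => b k l) * |h l| := tsum_congr fun l => (h1 l).tsum_eq
    _ ≤ ∑' l, c * (|h l| * xi ν l) := Summable.tsum_le_tsum h2 h2s (Summable.mul_left c h.memEll)
    _ = c * ‖h‖ := tsum_mul_left

/-- An infinite matrix whose columns belong to `ℓ¹_ν`, with bounded weighted norms. -/
def BddOp {M : ℕ} (ν : ℝ) (B : Op M) : Prop :=
  (∀ m i n j l, MemEll ν fun k => B (m, i, k) (n, j, l)) ∧
    ∃ c, ∀ m i n j l, colNorm ν B m i n j l ≤ c

variable {M : ℕ}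

lemma colNorm_nonneg (B : Op M) (m : Fin M) (i : Fin 6) (n : Fin M) (j : Fin 6) (l : ℕ) :
    0 ≤ colNorm ν B m i n j l :=
  mul_nonneg (one_div_nonneg.2 (xi_pos hν.out l).le) (nuNorm_nonneg _)

lemma nuNorm_col_le (B : Op M) {m : Fin M} {i : Fin 6} {n : Fin M} {j : Fin 6} {c : ℝ} {l : ℕ}
    (h : colNorm ν B m i n j l ≤ c) : nuNorm ν (fun k => B (m, i, k) (n, j, l)) ≤ c * xi ν l := by
  have h0 := xi_pos hν.out l
  unfold colNorm at h
  rwa [one_div, inv_mul_eq_div, div_le_iff₀ h0] at h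

lemma bddOp_of_eventually {B : Op M} (hcol : ∀ m i n j l, MemEll ν fun k => B (m, i, k) (n, j, l))
    (L : ℕ) (c : ℝ) (hc : ∀ m i n j l, L ≤ l → colNorm ν B m i n j l ≤ c) : BddOp ν B := by
  refine ⟨hcol, |c| + ∑ m, ∑ i, ∑ n, ∑ j, ∑ l ∈ Finset.range L, colNorm ν B m i n j l, ?_⟩
  intro m i n j l
  have h0 : ∀ m i n j l, 0 ≤ colNorm ν B m i n j l := colNorm_nonneg B
  rcases lt_or_ge l L with hl | hl
  · refine le_add_of_nonneg_of_le (abs_nonneg c) ?_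
    calc colNorm ν B m i n j l
        ≤ ∑ l ∈ Finset.range L, colNorm ν B m i n j l :=
          Finset.single_le_sum (f := fun l => colNorm ν B m i n j l) (fun l _ => h0 _ _ _ _ _)
            (Finset.mem_range.2 hl)
      _ ≤ ∑ j, ∑ l ∈ Finset.range L, colNorm ν B m i n j l :=
          Finset.single_le_sum (f := fun j => ∑ l ∈ Finset.range L, colNorm ν B m i n j l)
            (fun j _ => Finset.sum_nonneg fun l _ => h0 _ _ _ _ _) (Finset.mem_univ j)
      _ ≤ ∑ n, ∑ j, ∑ l ∈ Finset.range L, colNorm ν B m i n j l :=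
          Finset.single_le_sum (f := fun n => ∑ j, ∑ l ∈ Finset.range L, colNorm ν B m i n j l)
            (fun n _ => Finset.sum_nonneg fun j _ => Finset.sum_nonneg fun l _ => h0 _ _ _ _ _)
            (Finset.mem_univ n)
      _ ≤ ∑ i, ∑ n, ∑ j, ∑ l ∈ Finset.range L, colNorm ν B m i n j l :=
          Finset.single_le_sum
            (f := fun i => ∑ n, ∑ j, ∑ l ∈ Finset.range L, colNorm ν B m i n j l)
            (fun i _ => Finset.sum_nonneg fun n _ => Finset.sum_nonneg fun j _ =>
              Finset.sum_nonneg fun l _ => h0 _ _ _ _ _) (Finset.mem_univ i)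
      _ ≤ _ :=
          Finset.single_le_sum
            (f := fun m => ∑ i, ∑ n, ∑ j, ∑ l ∈ Finset.range L, colNorm ν B m i n j l)
            (fun m _ => Finset.sum_nonneg fun i _ => Finset.sum_nonneg fun n _ =>
              Finset.sum_nonneg fun j _ => Finset.sum_nonneg fun l _ => h0 _ _ _ _ _)
            (Finset.mem_univ m)
  · refine ((hc m i n j l hl).trans (le_abs_self c)).trans (le_add_of_nonneg_right ?_)
    exact Finset.sum_nonneg fun m _ => Finset.sum_nonneg fun i _ => Finset.sum_nonneg fun n _ =>
      Finset.sum_nonneg fun j _ => Finset.sum_nonneg fun l _ => h0 _ _ _ _ _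

lemma BddOp.colNorm_le_blockNorm {B : Op M} (hB : BddOp ν B) (m : Fin M) (i : Fin 6) (n : Fin M)
    (j : Fin 6) (l : ℕ) : colNorm ν B m i n j l ≤ blockNorm ν B m i n j := by
  obtain ⟨_, c, hc⟩ := hB
  exact le_ciSup (f := fun l => colNorm ν B m i n j l)
    ⟨c, by rintro _ ⟨l, rfl⟩; exact hc m i n j l⟩ l

lemma blockNorm_nonneg (B : Op M) (m : Fin M) (i : Fin 6) (n : Fin M) (j : Fin 6) :
    0 ≤ blockNorm ν B m i n j :=
  Real.iSup_nonneg fun l => colNorm_nonneg B m i n j l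

/-- The `(m, i; n, j)` block of a bounded infinite matrix, as an operator on `ℓ¹_ν`. -/
def BddOp.block {B : Op M} (hB : BddOp ν B) (m : Fin M) (i : Fin 6) (n : Fin M) (j : Fin 6) :
    EllOne ν →ₗ[ℝ] EllOne ν where
  toFun h := ⟨fun k => ∑' l, B (m, i, k) (n, j, l) * h l,
    (kernel_aux (hB.1 m i n j) (fun l => nuNorm_col_le B (hB.colNorm_le_blockNorm m i n j l)) h).2.1⟩
  map_add' g h := by
    have H := kernel_aux (hB.1 m i n j)
      (fun l => nuNorm_col_le B (hB.colNorm_le_blockNorm m i n j l))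
    refine EllOne.ext fun k => ?_
    simp only [EllOne.coe_add, Pi.add_apply, mul_add]
    exact ((H g).1 k).tsum_add ((H h).1 k)
  map_smul' c h := by
    refine EllOne.ext fun k => ?_
    simp only [EllOne.coe_smul, Pi.smul_apply, smul_eq_mul, RingHom.id_apply]
    rw [← tsum_mul_left]
    exact tsum_congr fun l => by ring

lemma BddOp.block_apply {B : Op M} (hB : BddOp ν B) (m : Fin M) (i : Fin 6) (n : Fin M) (j : Fin 6)
    (h : EllOne ν) (k : ℕ) : hB.block m i n j h k = ∑' l, B (m, i, k) (n, j, l) * h l := rfl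

lemma BddOp.norm_block_le {B : Op M} (hB : BddOp ν B) {m : Fin M} {i : Fin 6} {n : Fin M}
    {j : Fin 6} {c : ℝ} (hc : ∀ l, colNorm ν B m i n j l ≤ c) (h : EllOne ν) :
    ‖hB.block m i n j h‖ ≤ c * ‖h‖ :=
  (kernel_aux (hB.1 m i n j) (fun l => nuNorm_col_le B (hc l)) h).2.2

/-- The operator defined by a bounded infinite matrix. -/
def BddOp.op {B : Op M} (hB : BddOp ν B) : EllFam ν M →ₗ[ℝ] EllFam ν M :=
  LinearMap.pi fun m => LinearMap.pi fun i => ∑ n, ∑ j,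
    hB.block m i n j ∘ₗ LinearMap.proj j ∘ₗ LinearMap.proj n

lemma BddOp.op_apply {B : Op M} (hB : BddOp ν B) (x : EllFam ν M) (m : Fin M) (i : Fin 6) :
    hB.op x m i = ∑ n, ∑ j, hB.block m i n j (x n j) := by
  simp [BddOp.op]

lemma BddOp.op_apply_coeff {B : Op M} (hB : BddOp ν B) (x : EllFam ν M) (m : Fin M) (i : Fin 6)
    (k : ℕ) : hB.op x m i k = ∑ n, ∑ j, ∑' l, B (m, i, k) (n, j, l) * x n j l := by
  rw [hB.op_apply, ← EllOne.coeffs_apply]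
  simp only [map_sum, Finset.sum_apply, EllOne.coeffs_apply, hB.block_apply]

/-- The norm of the `m`-th component of an element of `EllFam ν M`. -/
def dnorm (η : Fin M → Fin 6 → ℝ) (m : Fin M) (x : EllFam ν M) : ℝ := ∑ i, ‖x m i‖ * η m i

lemma domNorm_toC (η : Fin M → Fin 6 → ℝ) (m : Fin M) (x : EllFam ν M) :
    domNorm ν (η m) (toC x m) = dnorm η m x := rfl

lemma le_weightedNorm_mul {ηn ηm : Fin 6 → ℝ} (hηn : ∀ j, 0 < ηn j) (b : Fin 6 → Fin 6 → ℝ)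
    (x : Fin 6 → ℝ) (hx : ∀ j, 0 ≤ x j) :
    ∑ i, (∑ j, b i j * x j) * ηm i ≤ weightedNorm ηn ηm b * ∑ j, x j * ηn j := by
  have h1 : ∀ j, (∑ i, b i j * ηm i) * x j ≤ weightedNorm ηn ηm b * (x j * ηn j) := by
    intro j
    have h2 : 1 / ηn j * ∑ i, b i j * ηm i ≤ weightedNorm ηn ηm b :=
      le_ciSup (f := fun j => 1 / ηn j * ∑ i, b i j * ηm i) (Set.finite_range _).bddAbove j
    rw [one_div, inv_mul_eq_div, div_le_iff₀ (hηn j)] at h2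
    calc _ ≤ (weightedNorm ηn ηm b * ηn j) * x j := mul_le_mul_of_nonneg_right h2 (hx j)
      _ = _ := by ring
  calc ∑ i, (∑ j, b i j * x j) * ηm i = ∑ j, (∑ i, b i j * ηm i) * x j := by
        simp_rw [Finset.sum_mul]
        rw [Finset.sum_comm]
        exact Finset.sum_congr rfl fun j _ => Finset.sum_congr rfl fun i _ => by ring
    _ ≤ ∑ j, weightedNorm ηn ηm b * (x j * ηn j) := Finset.sum_le_sum fun j _ => h1 j
    _ = _ := by rw [Finset.mul_sum]

lemma weightedNorm_nonneg {ηn ηm : Fin 6 → ℝ} (hηn : ∀ j, 0 < ηn j) (hηm : ∀ j, 0 < ηm j)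
    {b : Fin 6 → Fin 6 → ℝ} (hb : ∀ i j, 0 ≤ b i j) : 0 ≤ weightedNorm ηn ηm b :=
  Real.iSup_nonneg fun j => mul_nonneg (one_div_nonneg.2 (hηn j).le)
    (Finset.sum_nonneg fun i _ => mul_nonneg (hb i j) (hηm i).le)

/-- Block-wise bounds on the columns give a bound on the action in the weighted norms. -/
lemma BddOp.dnorm_op_le {B : Op M} (hB : BddOp ν B) {η : Fin M → Fin 6 → ℝ}
    (hη : ∀ m i, 0 < η m i) (m : Fin M) {b : Fin M → Fin 6 → Fin 6 → ℝ}
    (hb : ∀ n i j l, colNorm ν B m i n j l ≤ b n i j) {x : EllFam ν M} {d : ℝ}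
    (hx : ∀ n, dnorm η n x ≤ d) :
    dnorm η m (hB.op x) ≤ (∑ n, weightedNorm (η n) (η m) (b n)) * d := by
  have h1 : ∀ i, ‖hB.op x m i‖ ≤ ∑ n, ∑ j, b n i j * ‖x n j‖ := by
    intro i
    rw [hB.op_apply]
    exact norm_sum_le_of_le _ fun n _ => norm_sum_le_of_le _ fun j _ =>
      hB.norm_block_le (hb n i j) (x n j)
  have hb0 : ∀ n i j, 0 ≤ b n i j := fun n i j => (colNorm_nonneg B m i n j 0).trans (hb n i j 0)
  calc dnorm η m (hB.op x) ≤ ∑ i, (∑ n, ∑ j, b n i j * ‖x n j‖) * η m i :=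
        Finset.sum_le_sum fun i _ => mul_le_mul_of_nonneg_right (h1 i) (hη m i).le
    _ = ∑ n, ∑ i, (∑ j, b n i j * ‖x n j‖) * η m i := by
        simp_rw [Finset.sum_mul _ _ (η m _)]
        rw [Finset.sum_comm]
    _ ≤ ∑ n, weightedNorm (η n) (η m) (b n) * d := by
        refine Finset.sum_le_sum fun n _ => ?_
        refine (le_weightedNorm_mul (hη n) (b n) _ fun j => norm_nonneg _).trans ?_
        exact mul_le_mul_of_nonneg_left (hx n) (weightedNorm_nonneg (hη n) (hη m) (hb0 n))
    _ = _ := by rw [Finset.sum_mul]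

/-! ### Expansion of continuous functionals in unit vectors -/

lemma continuous_coeff (k : ℕ) : Continuous fun u : EllOne ν => u k := by
  have : Continuous (LinearMap.proj k ∘ₗ EllOne.coeffs ν) := by
    refine AddMonoidHomClass.continuous_of_bound _ 1 fun u => ?_
    rw [one_mul]
    exact abs_le_nuNorm u.memEll k
  exact this

lemma hasSum_unitVec (u : EllOne ν) : HasSum (fun l => u l • unitVec ν l) u := by
  have hn : ∀ l, ‖u l • unitVec ν l‖ = |u l| * xi ν l := by
    intro l
    rw [norm_smul, EllOne.norm_def, nuNorm, tsum_eq_single l]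
    · simp [unitVec]
    · intro k hk; simp [unitVec, hk]
  have hs : Summable fun l => u l • unitVec ν l :=
    Summable.of_norm (by simp_rw [hn]; exact u.memEll)
  have h1 : ∑' l, u l • unitVec ν l = u := by
    refine EllOne.ext fun k => ?_
    have h2 := hs.hasSum.map (LinearMap.proj k ∘ₗ EllOne.coeffs ν) (continuous_coeff k)
    have h3 : ((LinearMap.proj k ∘ₗ EllOne.coeffs ν) : EllOne ν →ₗ[ℝ] ℝ) (∑' l, u l • unitVec ν l)
      = (∑' l, u l • unitVec ν l : EllOne ν) k := rfl
    rw [← h3, ← h2.tsum_eq, tsum_eq_single k]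
    · simp [unitVec]
    · intro l hl; simp [unitVec, Ne.symm hl]
  simpa [h1] using hs.hasSum

/-- A continuous functional restricted to one component is the sum of its values on unit vectors;
this recovers the action of an infinite matrix from its entries. -/
lemma hasSum_functional {φ : EllFam ν M →ₗ[ℝ] ℝ} (hφ : Continuous φ) (x : EllFam ν M) (n : Fin M)
    (j : Fin 6) : HasSum (fun l => φ (emb n j (unitVec ν l)) * x n j l) (φ (emb n j (x n j))) := by
  have h1 : Continuous fun u : EllOne ν => emb n j u := by
    unfold emb
    refine continuous_pi fun m => continuous_pi fun i => ?_
    by_cases hm : m = n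
    · subst hm
      by_cases hi : i = j
      · subst hi; simpa using continuous_id'
      · simpa [hi] using continuous_const
    · simpa [hm] using continuous_const
  let e : EllOne ν →ₗ[ℝ] EllFam ν M :=
    LinearMap.single ℝ (fun _ : Fin M => Fin 6 → EllOne ν) n ∘ₗ
      LinearMap.single ℝ (fun _ : Fin 6 => EllOne ν) j
  have h2 := (hasSum_unitVec (x n j)).map (φ ∘ₗ e) (hφ.comp h1)
  refine h2.congr_fun fun l => ?_
  simp only [Function.comp_apply, map_smul, smul_eq_mul]
  exact mul_comm _ _

lemma functional_eq_sum (φ : EllFam ν M →ₗ[ℝ] ℝ) (x : EllFam ν M) :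
    φ x = ∑ n, ∑ j, φ (emb n j (x n j)) := by
  have h : x = ∑ n, ∑ j, emb n j (x n j) := by
    funext n j
    rw [Finset.sum_apply, Finset.sum_apply, Finset.sum_eq_single n]
    · rw [Finset.sum_apply, Finset.sum_apply, Finset.sum_eq_single j]
      · simp [emb]
      · intro i _ hi; simp [emb, hi.symm]
      · simp
    · intro m _ hm
      simp [emb, hm.symm]
    · simp
  conv_lhs => rw [h]
  simp

end Kernels


/-! ### The operators `A`, `I - A A†` and `A (DF - A†)` -/

section Operators

variable {ν : ℝ} [hν : Fact (1 < ν)] {M K : ℕ}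
  (AK : Matrix (Fin M × Fin 6 × Fin K) (Fin M × Fin 6 × Fin K) ℝ)

/-- A finite set containing the nonzero entries of a row of `A`. -/
def rowSupp (K : ℕ) (r : Idx M) : Finset (Idx M) :=
  insert r (Finset.univ ×ˢ Finset.univ ×ˢ Finset.range K)

lemma Aop_eq_zero {r q : Idx M} (h : q ∉ rowSupp K r) : Aop AK r q = 0 := by
  simp only [rowSupp, Finset.mem_insert, Finset.mem_product, Finset.mem_univ, Finset.mem_range,
    true_and, not_or, not_lt] at h
  have h1 : ¬(r.2.2 < K ∧ q.2.2 < K) := fun h' => absurd h'.2 (not_lt.2 h.2)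
  unfold Aop
  rw [dif_neg h1, if_neg (Ne.symm h.1)]

/-- A row of `A`, applied to a family of real numbers. -/
def rowA (r : Idx M) : (Idx M → ℝ) →ₗ[ℝ] ℝ :=
  ∑ q ∈ rowSupp K r, Aop AK r q • LinearMap.proj q

lemma rowA_apply (r : Idx M) (y : Idx M → ℝ) : rowA AK r y = ∑' q, Aop AK r q * y q := by
  rw [tsum_eq_sum (s := rowSupp K r) fun q hq => by rw [Aop_eq_zero AK hq, zero_mul]]
  simp [rowA]

lemma rowA_of_lt {r : Idx M} (hr : r.2.2 < K) (y : Idx M → ℝ) :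
    rowA AK r y = ∑ q : Fin M × Fin 6 × Fin K, AK (r.1, r.2.1, ⟨r.2.2, hr⟩) q *
      y (q.1, q.2.1, (q.2.2 : ℕ)) := by
  have hinj : Function.Injective fun q : Fin M × Fin 6 × Fin K => ((q.1, q.2.1, (q.2.2 : ℕ)) : Idx M) := by
    rintro ⟨a, b, c⟩ ⟨a', b', c'⟩ h
    simp only [Prod.mk.injEq] at h
    obtain ⟨rfl, rfl, h⟩ := h
    rw [Fin.ext h]
  rw [rowA_apply, ← hinj.tsum_eq, tsum_fintype]
  · refine Finset.sum_congr rfl fun q _ => ?_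
    congr 1
    unfold Aop
    rw [dif_pos ⟨hr, q.2.2.2⟩]
  · intro q hq
    have hqK : q.2.2 < K := by
      by_contra h
      have h1 : ¬(r.2.2 < K ∧ q.2.2 < K) := fun h' => h h'.2
      refine hq ?_
      simp only [Aop, dif_neg h1]
      rw [if_neg, zero_mul]
      rintro rfl; exact h hr
    exact ⟨(q.1, q.2.1, ⟨q.2.2, hqK⟩), rfl⟩

lemma rowA_of_ge {r : Idx M} (hr : K ≤ r.2.2) (y : Idx M → ℝ) :
    rowA AK r y = 1 / (r.2.2 : ℝ) * y r := by
  have h1 : ∀ q : Idx M, ¬(r.2.2 < K ∧ q.2.2 < K) := fun q h' => absurd h'.1 (not_lt.2 hr)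
  rw [rowA_apply, tsum_eq_single r]
  · simp only [Aop, dif_neg (h1 r), if_true]
  · intro q hq
    simp only [Aop, dif_neg (h1 q)]
    rw [if_neg (Ne.symm hq), zero_mul]

lemma opMul_eq (B : Op M) (r s : Idx M) : opMul (Aop AK) B r s = rowA AK r fun q => B q s :=
  (rowA_apply AK r _).symm

lemma bddOp_Aop (hK : 1 ≤ K) : BddOp ν (Aop AK) := by
  refine bddOp_of_eventually (fun m i n j l => ?_) K 1 fun m i n j l hl => ?_
  · refine memEll_of_finite (max K (l + 1)) fun k hk => ?_
    have h1 : ¬(k < K ∧ l < K) := by omega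
    simp only [Aop, dif_neg h1]
    rw [if_neg]
    simp only [Prod.mk.injEq, not_and]
    intro _ _; omega
  · have h0 := xi_pos hν.out l
    have h2 : nuNorm ν (fun k => Aop AK (m, i, k) (n, j, l)) ≤ xi ν l := by
      have h1 : ∀ k, ¬(k < K ∧ l < K) := by omega
      unfold nuNorm
      rw [tsum_eq_single l]
      · simp only [Aop, dif_neg (h1 l)]
        refine mul_le_of_le_one_left h0.le ?_
        split_ifs
        · rw [abs_of_nonneg (by positivity)]
          exact div_le_one_of_le₀ (by exact_mod_cast hK.trans hl) (by positivity)
        · simp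
      · intro k hk
        simp only [Aop, dif_neg (h1 k)]
        rw [if_neg]
        · simp
        · simp only [Prod.mk.injEq, not_and]
          intro _ _; exact hk
    unfold colNorm
    rw [one_div, inv_mul_le_one₀ h0]
    exact h2

lemma memEll_opMul_col {B : Op M} (m : Fin M) (i : Fin 6) (s : Idx M) (N : ℕ)
    (hB : ∀ q : Idx M, N ≤ q.2.2 → B q s = 0) :
    MemEll ν fun k => opMul (Aop AK) B (m, i, k) s := by
  refine memEll_of_finite (max K N) fun k hk => ?_
  rw [opMul_eq, rowA_of_ge AK (r := (m, i, k)) (by simp; omega), hB _ (by simp; omega), mul_zero]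

variable (P : Params) (t : Fin (M + 1) → ℝ) (p₁ : Phase) (Xbar : Fin M → Fin 6 → Fin K → ℝ)

lemma Bop_eq_zero (hK : 1 ≤ K) (r s : Idx M) (h : K ≤ r.2.2 ∨ K ≤ s.2.2) :
    Bop P t p₁ Xbar AK r s = 0 := by
  have h1 : ∀ q : Idx M, (K ≤ q.2.2 ∨ K ≤ s.2.2) →
      Adag P t p₁ Xbar q s = if q = s then (q.2.2 : ℝ) else 0 := by
    intro q hq
    unfold Adag
    rw [if_neg (by omega)]
  rw [Bop, Matrix.sub_apply, Matrix.one_apply, opMul_eq]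
  rcases lt_or_ge r.2.2 K with hr | hr
  · have hs : K ≤ s.2.2 := by omega
    rw [rowA_of_lt AK hr, Finset.sum_eq_zero, if_neg, sub_zero]
    · rintro rfl; omega
    · intro q _
      rw [h1 _ (Or.inr hs), if_neg, mul_zero]
      rintro rfl
      exact absurd q.2.2.2 (not_lt.2 hs)
  · rw [rowA_of_ge AK hr, h1 _ (Or.inl hr)]
    split_ifs
    · have : (r.2.2 : ℝ) ≠ 0 := by exact_mod_cast (by omega : r.2.2 ≠ 0)
      rw [one_div_mul_cancel this, sub_self]
    · simp

lemma colNorm_eq_zero {B : Op M} {m : Fin M} {i : Fin 6} {n : Fin M} {j : Fin 6} {l : ℕ}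
    (h : ∀ k, B (m, i, k) (n, j, l) = 0) : colNorm ν B m i n j l = 0 := by
  simp [colNorm, nuNorm, h]

lemma bddOp_Bop (hK : 1 ≤ K) : BddOp ν (Bop P t p₁ Xbar AK) := by
  refine bddOp_of_eventually (fun m i n j l => ?_) K 0 fun m i n j l hl => ?_
  · exact memEll_of_finite K fun k hk => Bop_eq_zero AK P t p₁ Xbar hK _ _ (Or.inl hk)
  · exact (colNorm_eq_zero fun k => Bop_eq_zero AK P t p₁ Xbar hK _ _ (Or.inr hl)).le

/-! ### Columns of high order -/

lemma unitVec_mul_apply {l : ℕ} (hl : l ≠ 0) (u : EllOne ν) (k : ℤ) :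
    (unitVec ν l * u : EllOne ν) k.natAbs = u (k - l).natAbs + u (k + l).natAbs := by
  rw [EllOne.mul_natAbs, tsum_eq_sum (s := {(l : ℤ), -(l : ℤ)})]
  · rw [Finset.sum_pair (by omega)]
    simp [unitVec]
  · intro m hm
    have h : m.natAbs ≠ l := by
      simp only [Finset.mem_insert, Finset.mem_singleton, not_or] at hm
      omega
    simp [unitVec, h]

lemma norm_unitVec (l : ℕ) : ‖unitVec ν l‖ = xi ν l := by
  rw [EllOne.norm_def, nuNorm, tsum_eq_single l]
  · simp [unitVec]
  · intro k hk; simp [unitVec, hk]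

lemma nuNorm_mono {u v : ℕ → ℝ} (hv : MemEll ν v) (h : ∀ k, |u k| ≤ |v k|) :
    MemEll ν u ∧ nuNorm ν u ≤ nuNorm ν v := by
  have h1 : ∀ k, |u k| * xi ν k ≤ |v k| * xi ν k :=
    fun k => mul_le_mul_of_nonneg_right (h k) (xi_pos hν.out k).le
  have h2 : MemEll ν u := Summable.of_nonneg_of_le
    (fun k => mul_nonneg (abs_nonneg _) (xi_pos hν.out k).le) h1 hv
  exact ⟨h2, Summable.tsum_le_tsum h1 h2 hv⟩

/-- The odd extension of `u_∓` is `d ↦ u_{|d-1|} - u_{|d+1|}`, hence `(e_l ∗ u)_∓` is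
bounded by `e_l ∗ |u_∓|`. -/
lemma nuNorm_mp_unitVec_mul_le {l : ℕ} (hl : l ≠ 0) (u : EllOne ν) :
    nuNorm ν (mpₗ ν (unitVec ν l * u)) ≤ xi ν l * nuNorm ν (mp u) := by
  have hg : MemEll ν fun k => |mp u k| :=
    (nuNorm_mono (memEll_mp u.memEll) fun k => (abs_abs _).le).1
  let g : EllOne ν := ⟨fun k => |mp u k|, hg⟩
  have hodd : ∀ d : ℤ, |u (d - 1).natAbs - u (d + 1).natAbs| = |mp u d.natAbs| := by
    intro d
    rcases lt_trichotomy d 0 with h | h | h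
    · obtain ⟨e, rfl⟩ : ∃ e : ℕ, d = -((e : ℤ) + 1) := ⟨(-d - 1).toNat, by omega⟩
      have h1 : (-((e : ℤ) + 1)).natAbs = e + 1 := by omega
      have h2 : (-((e : ℤ) + 1) - 1).natAbs = e + 2 := by omega
      have h3 : (-((e : ℤ) + 1) + 1).natAbs = e := by omega
      rw [h1, h2, h3, abs_sub_comm]; rfl
    · subst h; simp [mp]
    · obtain ⟨e, rfl⟩ : ∃ e : ℕ, d = (e : ℤ) + 1 := ⟨(d - 1).toNat, by omega⟩
      have h1 : ((e : ℤ) + 1).natAbs = e + 1 := by omega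
      have h2 : ((e : ℤ) + 1 - 1).natAbs = e := by omega
      have h3 : ((e : ℤ) + 1 + 1).natAbs = e + 2 := by omega
      rw [h1, h2, h3]; rfl
  have hle : ∀ k, |mpₗ ν (unitVec ν l * u) k| ≤ |(unitVec ν l * g : EllOne ν) k| := by
    intro k
    cases k with
    | zero => simp [coe_mpₗ, mp]
    | succ k =>
      have e1 := unitVec_mul_apply hl u (k : ℤ)
      have e2 := unitVec_mul_apply hl u ((k : ℤ) + 2)
      have e3 := unitVec_mul_apply hl g ((k : ℤ) + 1)
      have h1 : ((k : ℤ) + 2).natAbs = k + 2 := by omega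
      have h2 : ((k : ℤ) + 1).natAbs = k + 1 := by omega
      rw [Int.natAbs_natCast] at e1
      rw [h1] at e2
      rw [h2] at e3
      rw [coe_mpₗ, mp, e1, e2, e3]
      have o1 := hodd ((k : ℤ) + 1 - l)
      have o2 := hodd ((k : ℤ) + 1 + l)
      rw [show (k : ℤ) + 1 - l - 1 = k - l by ring, show (k : ℤ) + 1 - l + 1 = k + 2 - l by ring]
        at o1
      rw [show (k : ℤ) + 1 + l - 1 = k + l by ring, show (k : ℤ) + 1 + l + 1 = k + 2 + l by ring]
        at o2
      have hg1 : ∀ d, g d = |mp u d| := fun _ => rfl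
      rw [hg1, hg1, ← o1, ← o2, abs_of_nonneg (a := |_| + |_|) (by positivity)]
      refine le_trans (le_of_eq ?_) (abs_add_le _ _)
      congr 1; ring
  have h1 := (nuNorm_mono (unitVec ν l * g).memEll hle).2
  have h2 : nuNorm ν (unitVec ν l * g : EllOne ν) ≤ ‖unitVec ν l‖ * ‖g‖ :=
    norm_mul_le (unitVec ν l) g
  rw [norm_unitVec] at h2
  have h3 : ‖g‖ = nuNorm ν (mp u) := by
    rw [EllOne.norm_def]; simp [g, nuNorm]
  rw [h3] at h2
  exact h1.trans h2

lemma dF_emb (m : Fin M) (i : Fin 6) (k : ℕ) (n : Fin M) (j : Fin 6) (u : EllOne ν) :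
    dF P t (injE ν Xbar) m i k (emb n j u) = linPart m i k (emb n j u) -
      if m = n then quarterStep t n * mpₗ ν (u * uE P Xbar ν n i j) k else 0 := by
  rw [dF_apply]
  congr 1
  split_ifs with h
  · subst h
    rw [Finset.sum_eq_single j]
    · simp [emb, uE]
    · intro l _ hl; simp [emb, hl]
    · simp
  · simp [emb, h]

lemma uE_eq_zero (n : Fin M) (i j : Fin 6) {k : ℕ} (hk : 3 * (K - 1) < k) :
    uE P Xbar ν n i j k = 0 := by
  refine aeval_eq_zero_of_support (a := K - 1) (d := 3) (fun j k hk => ?_) ?_ k hk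
  · exact injE_eq_zero Xbar n j (by omega)
  · refine (totalDegree_pderiv_le j _).trans ?_
    have := totalDegree_fieldPoly_le P i
    omega

lemma emb_coeff (n m : Fin M) (i j : Fin 6) (l k : ℕ) :
    (emb n j (unitVec ν l) : EllFam ν M) m i k = if m = n ∧ i = j ∧ k = l then 1 else 0 := by
  by_cases hm : m = n
  · subst hm
    by_cases hi : i = j
    · subst hi
      by_cases hk : k = l
      · subst hk; simp [emb, unitVec]
      · simp [emb, unitVec, hk]
    · simp [emb, hi]
  · simp [emb, hm]

lemma DF_eq_zero (q s : Idx M) (h : s.2.2 + 3 * K + 2 ≤ q.2.2) (hν : 1 < ν) :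
    DF P t p₁ (inj Xbar) q s = 0 := by
  have : Fact (1 < ν) := ⟨hν⟩
  rw [DF_eq (ν := ν) P t p₁ Xbar, dF_emb, linPart_of_pos _ _ (by omega), emb_coeff, if_neg (by omega),
    mul_zero, zero_sub, neg_eq_zero]
  split_ifs
  · have h1 : ∀ k, s.2.2 + 3 * (K - 1) < k → (unitVec ν s.2.2 * uE P Xbar ν s.1 q.2.1 s.2.1 : EllOne ν) k = 0 :=
      EllOne.mul_eq_zero_of_support (fun k hk => by simp [unitVec, show k ≠ s.2.2 by omega])
        fun k hk => uE_eq_zero P Xbar _ _ _ hk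
    obtain ⟨k, hk⟩ : ∃ k, q.2.2 = k + 1 := ⟨q.2.2 - 1, by omega⟩
    rw [coe_mpₗ, hk, mp, h1 _ (by omega), h1 _ (by omega)]; simp
  · rfl

lemma memEll_Cop_col (m : Fin M) (i : Fin 6) (n : Fin M) (j : Fin 6) (l : ℕ) :
    MemEll ν fun k => Cop P t p₁ Xbar AK (m, i, k) (n, j, l) := by
  refine memEll_opMul_col AK m i (n, j, l) (max K (l + 3 * K + 2)) fun q hq => ?_
  have h1 : K ≤ q.2.2 := (le_max_left _ _).trans hq
  have h2 : l + 3 * K + 2 ≤ q.2.2 := (le_max_right _ _).trans hq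
  have h3 : q ≠ (n, j, l) := by rintro rfl; simp at h2; omega
  have h4 : ¬(q.2.2 < K ∧ l < K) := by omega
  rw [Matrix.sub_apply, DF_eq_zero P t p₁ Xbar q _ h2 hν.out, Adag, if_neg h4, if_neg h3, sub_zero]

lemma rowA_single (r q : Idx M) (c : ℝ) : rowA AK r (Pi.single q c) = Aop AK r q * c := by
  rw [rowA_apply, tsum_eq_single q]
  · simp
  · intro q' hq'; simp [hq']

lemma chebSum_emb (s : ℝ) (n m : Fin M) (i j : Fin 6) {l : ℕ} (hl : l ≠ 0) :
    chebSum s ((emb n j (unitVec ν l) : EllFam ν M) m i) =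
      if m = n ∧ i = j then 2 * (Polynomial.Chebyshev.T ℝ l).eval s else 0 := by
  unfold chebSum
  rw [tsum_eq_single l]
  · rw [emb_coeff]
    by_cases h : m = n ∧ i = j
    · simp [h, hl]
    · have h' : ¬(m = n ∧ i = j ∧ l = l) := fun h'' => h ⟨h''.1, h''.2.1⟩
      rw [if_neg h, if_neg h']; simp
  · intro k hk
    rw [emb_coeff, if_neg (show ¬(m = n ∧ i = j ∧ k = l) by tauto)]; simp

open Polynomial.Chebyshev in
/-- The entries of a column of order at least `4 K - 1` of `A (DF - A†)`. -/
lemma Cop_tail (hK : 1 ≤ K) (m : Fin M) (i : Fin 6) (k : ℕ) (n : Fin M) (j : Fin 6) (l : ℕ)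
    (hl : 4 * K - 1 ≤ l) : Cop P t p₁ Xbar AK (m, i, k) (n, j, l) =
      2 * (-1) ^ l * Aop AK (m, i, k) (n, j, 0)
      - 2 * (if h : (n : ℕ) + 1 < M then Aop AK (m, i, k) (⟨n + 1, h⟩, j, 0) else 0)
      - if m = n ∧ K ≤ k then 1 / (k : ℝ) * (quarterStep t n *
          mpₗ ν (unitVec ν l * uE P Xbar ν n i j) k) else 0 := by
  have hl0 : l ≠ 0 := by omega
  rw [Cop, opMul_eq]
  rcases lt_or_ge k K with hk | hk
  · rw [if_neg (by omega), sub_zero]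
    have hT1 : (T ℝ l).eval (-1) = (-1) ^ l := by
      rw [T_eval_neg_one, Int.negOnePow_def]; norm_cast
    -- only the two entries of order zero of the column contribute to the rows of order below `K`
    let y : Idx M → ℝ := Pi.single (n, j, 0) (2 * (-1) ^ l) -
      (if h : (n : ℕ) + 1 < M then Pi.single (⟨n + 1, h⟩, j, 0) 2 else 0)
    have hy : ∀ q : Fin M × Fin 6 × Fin K, (DF P t p₁ (inj Xbar) - Adag P t p₁ Xbar)
        (q.1, q.2.1, (q.2.2 : ℕ)) (n, j, l) = y (q.1, q.2.1, (q.2.2 : ℕ)) := by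
      rintro ⟨m', i', k', hk'⟩
      have h4 : ¬(k' < K ∧ l < K) := by omega
      have h5 : ((m', i', k') : Idx M) ≠ (n, j, l) := by
        simp only [ne_eq, Prod.mk.injEq, not_and]; intro _ _; omega
      simp only [Matrix.sub_apply]
      rw [Adag, if_neg h4, if_neg h5, sub_zero, DF_eq (ν := ν), dF_emb]
      rcases Nat.eq_zero_or_pos k' with h0 | h0
      · subst h0
        rw [linPart_zero, chebSum_emb _ _ _ _ _ hl0, hT1]
        have h6 : ∀ u : EllOne ν, mpₗ ν u 0 = 0 := fun u => rfl
        simp only [h6, mul_zero, ite_self, sub_zero]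
        simp only [y, Pi.sub_apply]
        congr 1
        · by_cases h : m' = n ∧ i' = j
          · obtain ⟨rfl, rfl⟩ := h; simp
          · rw [if_neg h, Pi.single_eq_of_ne]
            simpa using h
        · by_cases hm0 : (m' : ℕ) = 0
          · rw [if_pos hm0]
            split_ifs with h
            · rw [Pi.single_eq_of_ne]
              intro h'
              have := congrArg (fun q : Idx M => (q.1 : ℕ)) h'
              simp at this; omega
            · rfl
          · rw [if_neg hm0, chebSum_emb _ _ _ _ _ hl0]
            have hT2 : (T ℝ l).eval 1 = 1 := T_eval_one _ _
            rw [hT2, mul_one]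
            by_cases h : prevIdx m' = n ∧ i' = j
            · obtain ⟨h, rfl⟩ := h
              have hn : (n : ℕ) = m' - 1 := by rw [← h]; rfl
              have hlt : (n : ℕ) + 1 < M := by have := m'.2; omega
              have hm' : m' = ⟨n + 1, hlt⟩ := Fin.ext (by simp; omega)
              rw [if_pos ⟨h, rfl⟩, dif_pos hlt, ← hm']
              simp
            · rw [if_neg h]
              split_ifs with hlt
              · rw [Pi.single_eq_of_ne]
                intro h'
                simp only [Prod.mk.injEq] at h'
                refine h ⟨Fin.ext ?_, h'.2.1⟩
                rw [h'.1]; simp [prevIdx]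
              · rfl
      · have hu : ∀ a : ℤ, 3 * (K - 1) < a.natAbs → uE P Xbar ν n i' j a.natAbs = 0 :=
          fun a ha => uE_eq_zero P Xbar n i' j ha
        have hmp : mpₗ ν (unitVec ν l * uE P Xbar ν n i' j) k' = 0 := by
          obtain ⟨e, rfl⟩ : ∃ e, k' = e + 1 := ⟨k' - 1, by omega⟩
          have e1 := unitVec_mul_apply hl0 (uE P Xbar ν n i' j) (e : ℤ)
          have e2 := unitVec_mul_apply hl0 (uE P Xbar ν n i' j) ((e : ℤ) + 2)
          rw [Int.natAbs_natCast] at e1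
          rw [show ((e : ℤ) + 2).natAbs = e + 2 by omega] at e2
          rw [coe_mpₗ, mp, e1, e2, hu _ (by omega), hu _ (by omega), hu _ (by omega),
            hu _ (by omega)]
          simp
        have h7 : ¬(m' = n ∧ i' = j ∧ k' = l) := by omega
        have h8 : k' ≠ 0 := by omega
        simp only
        rw [linPart_of_pos _ _ h8, emb_coeff, if_neg h7, hmp]
        simp only [mul_zero, ite_self, sub_zero]
        simp only [y, Pi.sub_apply]
        rw [Pi.single_eq_of_ne (by simp; omega)]
        split_ifs
        · rw [Pi.single_eq_of_ne (by simp; omega)]; simp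
        · simp
    rw [rowA_of_lt AK (r := (m, i, k)) hk, Finset.sum_congr rfl fun q _ => by rw [hy q],
      ← rowA_of_lt AK (r := (m, i, k)) hk y]
    simp only [y, map_sub, rowA_single]
    congr 1
    · ring
    · split_ifs
      · rw [rowA_single]; ring
      · simp
  · have h1 : ∀ q : Idx M, ¬(k < K ∧ q.2.2 < K) := fun q h' => absurd h'.1 (not_lt.2 hk)
    have hA : ∀ n', Aop AK (m, i, k) (n', j, 0) = 0 := by
      intro n'
      simp only [Aop, dif_neg (h1 (n', j, 0))]
      rw [if_neg]
      simp only [Prod.mk.injEq, not_and]; intro _ _; omega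
    have h4 : ¬(k < K ∧ l < K) := by omega
    rw [rowA_of_ge AK (r := (m, i, k)) hk, Matrix.sub_apply, DF_eq (ν := ν), dF_emb,
      linPart_of_pos _ _ (by simp; omega), emb_coeff, Adag, if_neg h4]
    simp only [hA, Prod.mk.injEq, dite_eq_ite, ite_self, mul_zero, sub_zero, zero_sub, and_iff_left hk]
    by_cases h : m = n ∧ i = j ∧ k = l
    · rw [if_pos h, if_pos h, if_pos h.1, if_pos h.1]; ring
    · rw [if_neg h, if_neg h]
      split_ifs <;> ring

/-- For `l ≥ 4K - 1` the unit vector of order `l` times the coefficients of `∂_j f(X̄)`, whose order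
is at most `3(K - 1)`, has order at least `K + 2`. So `A (DF - A†)` acts on it through the two boundary
conditions that see the `n`-th subinterval, each with entry `± 2`, and through the tail `1/k ≤ 1/K`. -/
lemma colNorm_Cop_tail (hK : 1 ≤ K) (ht : StrictMono t) (m : Fin M) (i : Fin 6) (n : Fin M)
    (j : Fin 6) (l : ℕ) (hl : 4 * K - 1 ≤ l) :
    colNorm ν (Cop P t p₁ Xbar AK) m i n j l ≤ Ctail P t ν Xbar AK m i n j := by
  have hl0 : l ≠ 0 := by omega
  have hν0 : 0 < ν := by linarith [hν.out]
  have hq : 0 < quarterStep t n := by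
    have := ht (Fin.castSucc_lt_succ (i := n))
    unfold quarterStep; linarith
  have hA := bddOp_Aop (ν := ν) AK hK
  let a₁ : EllOne ν := ⟨_, hA.1 m i n j 0⟩
  let a₂ : EllOne ν := if h : (n : ℕ) + 1 < M then ⟨_, hA.1 m i ⟨n + 1, h⟩ j 0⟩ else 0
  let z : EllOne ν := mpₗ ν (unitVec ν l * uE P Xbar ν n i j)
  have hw := nuNorm_mono (ν := ν) (u := fun k : ℕ => if m = n ∧ K ≤ k then 1 / (k : ℝ) *
    (quarterStep t n * z k) else 0) (v := (if m = n then 1 / (K : ℝ) * quarterStep t n else 0) • ⇑z)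
    ((if m = n then 1 / (K : ℝ) * quarterStep t n else 0) • z).memEll (by
      intro k
      by_cases h : m = n
      · by_cases hk : K ≤ k
        · have hK0 : (0 : ℝ) < K := by exact_mod_cast hK
          simp only [h, hk, and_self, if_true, Pi.smul_apply, smul_eq_mul, abs_mul, mul_assoc]
          refine mul_le_mul_of_nonneg_right ?_ (by positivity)
          rw [abs_of_nonneg (by positivity), abs_of_nonneg (by positivity)]
          exact one_div_le_one_div_of_le hK0 (by exact_mod_cast hk)
        · simp [hk]
      · simp [h])
  let w : EllOne ν := ⟨_, hw.1⟩
  have hC : (fun k => Cop P t p₁ Xbar AK (m, i, k) (n, j, l))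
      = ((2 * (-1 : ℝ) ^ l) • a₁ - (2 : ℝ) • a₂ - w : EllOne ν).coeff := by
    funext k
    rw [Cop_tail (ν := ν) AK P t p₁ Xbar hK m i k n j l hl]
    simp only [EllOne.coe_sub, EllOne.coe_smul, Pi.sub_apply, Pi.smul_apply, smul_eq_mul]
    have h2 : a₂ k = if h : (n : ℕ) + 1 < M then Aop AK (m, i, k) (⟨n + 1, h⟩, j, 0) else 0 := by
      simp only [a₂]
      split_ifs <;> rfl
    rw [h2]
  have hn : ‖((2 * (-1 : ℝ) ^ l) • a₁ - (2 : ℝ) • a₂ - w : EllOne ν)‖ ≤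
      2 * ‖a₁‖ + 2 * ‖a₂‖ + ‖w‖ := by
    refine (norm_sub_le _ _).trans (add_le_add_left ((norm_sub_le _ _).trans ?_) _)
    rw [norm_smul, norm_smul]
    simp
  have hwn : ‖w‖ ≤ xi ν l * if m = n then 1 / (K : ℝ) * quarterStep t n *
      nuNorm ν (mp (uCoeff P Xbar n i j)) else 0 := by
    refine hw.2.trans ?_
    rw [nuNorm_smul, uCoeff_eq (ν := ν)]
    have h1 := nuNorm_mp_unitVec_mul_le hl0 (uE P Xbar ν n i j)
    split_ifs
    · rw [abs_of_nonneg (by positivity)]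
      calc _ ≤ 1 / (K : ℝ) * quarterStep t n * (xi ν l * nuNorm ν (mp (uE P Xbar ν n i j))) :=
            mul_le_mul_of_nonneg_left h1 (by positivity)
        _ = _ := by ring
    · simp
  have ha₂ : ‖a₂‖ = if h : (n : ℕ) + 1 < M then
      nuNorm ν (fun k => Aop AK (m, i, k) (⟨n + 1, h⟩, j, 0)) else 0 := by
    simp only [a₂]
    split_ifs
    · rfl
    · exact norm_zero
  have hξ : xi ν l = 2 * ν ^ l := by simp [xi, hl0]
  have hpow : ν ^ K ≤ ν ^ l := pow_le_pow_right₀ hν.out.le (by omega)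
  have hKp : 0 < ν ^ K := by positivity
  unfold colNorm Ctail
  rw [hC, ← ha₂, one_div, inv_mul_le_iff₀ (xi_pos hν.out l)]
  have ha₁ : nuNorm ν (fun k => Aop AK (m, i, k) (n, j, 0)) = ‖a₁‖ := rfl
  rw [ha₁, mul_add]
  refine hn.trans (add_le_add ?_ ?_)
  · rw [hξ]
    have h3 : 1 ≤ ν ^ l / ν ^ K := (one_le_div hKp).2 hpow
    have h4 : 0 ≤ ‖a₁‖ + ‖a₂‖ := by positivity
    calc 2 * ‖a₁‖ + 2 * ‖a₂‖ = 2 * 1 * (‖a₁‖ + ‖a₂‖) := by ring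
      _ ≤ 4 * (ν ^ l / ν ^ K) * (‖a₁‖ + ‖a₂‖) := by gcongr; norm_num
      _ = _ := by ring
  · refine hwn.trans (le_of_eq ?_)
    by_cases h : m = n
    · subst h; simp [quarterStep]
    · simp [h]

lemma bddOp_Cop (hK : 1 ≤ K) (ht : StrictMono t) : BddOp ν (Cop P t p₁ Xbar AK) := by
  refine bddOp_of_eventually (memEll_Cop_col AK P t p₁ Xbar) (4 * K - 1)
    (∑ m, ∑ i, ∑ n, ∑ j, |Ctail P t ν Xbar AK m i n j|) fun m i n j l hl => ?_
  refine ((colNorm_Cop_tail AK P t p₁ Xbar hK ht m i n j l hl).trans (le_abs_self _)).trans ?_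
  calc |Ctail P t ν Xbar AK m i n j| ≤ ∑ j, |Ctail P t ν Xbar AK m i n j| :=
        Finset.single_le_sum (f := fun j => |Ctail P t ν Xbar AK m i n j|)
          (fun j _ => abs_nonneg _) (Finset.mem_univ j)
    _ ≤ ∑ n, ∑ j, |Ctail P t ν Xbar AK m i n j| :=
        Finset.single_le_sum (f := fun n => ∑ j, |Ctail P t ν Xbar AK m i n j|)
          (fun n _ => Finset.sum_nonneg fun j _ => abs_nonneg _) (Finset.mem_univ n)
    _ ≤ ∑ i, ∑ n, ∑ j, |Ctail P t ν Xbar AK m i n j| :=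
        Finset.single_le_sum (f := fun i => ∑ n, ∑ j, |Ctail P t ν Xbar AK m i n j|)
          (fun i _ => Finset.sum_nonneg fun n _ => Finset.sum_nonneg fun j _ => abs_nonneg _)
          (Finset.mem_univ i)
    _ ≤ _ :=
        Finset.single_le_sum (f := fun m => ∑ i, ∑ n, ∑ j, |Ctail P t ν Xbar AK m i n j|)
          (fun m _ => Finset.sum_nonneg fun i _ => Finset.sum_nonneg fun n _ =>
            Finset.sum_nonneg fun j _ => abs_nonneg _) (Finset.mem_univ m)

lemma colNorm_Cop_le (hK : 1 ≤ K) (ht : StrictMono t) (m : Fin M) (i : Fin 6) (n : Fin M)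
    (j : Fin 6) (l : ℕ) : colNorm ν (Cop P t p₁ Xbar AK) m i n j l ≤
      max (Cfinite P t p₁ ν Xbar AK m i n j) (Ctail P t ν Xbar AK m i n j) := by
  rcases lt_or_ge l (4 * K - 1) with hl | hl
  · refine le_max_of_le_left ?_
    exact le_ciSup (f := fun l : Fin (4 * K - 1) => colNorm ν (Cop P t p₁ Xbar AK) m i n j l)
      (Set.finite_range _).bddAbove ⟨l, hl⟩
  · exact le_max_of_le_right (colNorm_Cop_tail AK P t p₁ Xbar hK ht m i n j l hl)

end Operators


/-! ### The Newton-like operator and its bounds -/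

section Newton

variable {ν : ℝ} [hν : Fact (1 < ν)] {M K : ℕ}

lemma norm_mpₗ_le (u : EllOne ν) : ‖mpₗ ν u‖ ≤ (2 * ν + 1) * ‖u‖ := by
  have h0 : 0 < ν := by linarith [hν.out]
  have hξ : ∀ k, 0 < xi ν k := xi_pos hν.out
  have h1 : ‖mpₗ ν u‖ = ∑' k, |mp u (k + 1)| * xi ν (k + 1) := by
    rw [EllOne.norm_def, coe_mpₗ, nuNorm, Summable.tsum_eq_zero_add (memEll_mp u.memEll)]
    simp [mp]
  have h2 := (summable_nat_add_iff 2).2 u.memEll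
  have h3 : ∑' k, |u (k + 2)| * xi ν (k + 2) ≤ ‖u‖ := by
    have := Summable.sum_add_tsum_nat_add 2 u.memEll
    rw [EllOne.norm_def, nuNorm, ← this]
    refine le_add_of_nonneg_left (Finset.sum_nonneg fun k _ => mul_nonneg (abs_nonneg _) (hξ k).le)
  rw [h1, add_mul, one_mul]
  refine le_trans ?_ (add_le_add_right h3 _)
  rw [EllOne.norm_def, nuNorm, ← tsum_mul_left, ← Summable.tsum_add (Summable.mul_left _ u.memEll) h2]
  refine Summable.tsum_le_tsum (fun k => ?_) ((summable_nat_add_iff 1).2 (memEll_mp u.memEll))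
    ((Summable.mul_left _ u.memEll).add h2)
  have h4 : |mp u (k + 1)| ≤ |u k| + |u (k + 2)| := abs_sub _ _
  have h5 : xi ν (k + 1) ≤ 2 * ν * xi ν k := by
    rw [xi, if_neg (by omega), pow_succ]
    have := pow_le_xi hν.out k
    nlinarith
  have h6 : xi ν (k + 1) ≤ xi ν (k + 2) := by
    rw [xi, xi, if_neg (by omega), if_neg (by omega)]
    have := pow_le_pow_right₀ hν.out.le (show k + 1 ≤ k + 2 by omega)
    linarith
  calc |mp u (k + 1)| * xi ν (k + 1) ≤ (|u k| + |u (k + 2)|) * xi ν (k + 1) :=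
        mul_le_mul_of_nonneg_right h4 (hξ _).le
    _ = |u k| * xi ν (k + 1) + |u (k + 2)| * xi ν (k + 1) := by ring
    _ ≤ |u k| * (2 * ν * xi ν k) + |u (k + 2)| * xi ν (k + 2) := by gcongr
    _ = _ := by ring

lemma continuous_mpₗ : Continuous (mpₗ ν) :=
  AddMonoidHomClass.continuous_of_bound _ _ norm_mpₗ_le

lemma continuous_chebSum {s : ℝ} (hs : |s| ≤ 1) : Continuous fun u : EllOne ν => chebSum s u := by
  have : Continuous (chebSumₗ ν hs) := by
    refine AddMonoidHomClass.continuous_of_bound _ 1 fun u => ?_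
    rw [one_mul, chebSumₗ_apply, EllOne.norm_def, chebSum, nuNorm]
    refine tsum_of_norm_bounded u.memEll.hasSum fun k => ?_
    rw [norm_mul, norm_mul, Real.norm_eq_abs, Real.norm_eq_abs, Real.norm_eq_abs, xi_eq]
    have h1 := Polynomial.Chebyshev.abs_eval_T_real_le_one k hs
    have h2 : 1 ≤ ν ^ k := one_le_pow₀ hν.out.le
    have h3 : |if k = 0 then (1 : ℝ) else 2| = if k = 0 then 1 else 2 := by split_ifs <;> simp
    rw [h3]
    calc _ ≤ (if k = 0 then (1 : ℝ) else 2) * |u k| * ν ^ k := by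
          refine mul_le_mul_of_nonneg_left (h1.trans h2) ?_
          split_ifs <;> positivity
      _ = _ := by ring
  exact this

lemma continuous_linPart (m : Fin M) (i : Fin 6) (k : ℕ) :
    Continuous (linPart (ν := ν) m i k) := by
  rcases Nat.eq_zero_or_pos k with h | h
  · subst h
    have : ⇑(linPart (ν := ν) m i 0) = fun x : EllFam ν M => chebSum (-1) (x m i) -
      if (m : ℕ) = 0 then 0 else chebSum 1 (x (prevIdx m) i) := funext fun x => linPart_zero m i x
    rw [this]
    have hc : ∀ n : Fin M, Continuous fun x : EllFam ν M => x n i := fun n =>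
      (continuous_apply i).comp (continuous_apply n)
    refine ((continuous_chebSum (by simp)).comp (hc m)).sub ?_
    split_ifs
    · exact continuous_const
    · exact (continuous_chebSum (by simp)).comp (hc _)
  · have : ⇑(linPart (ν := ν) m i k) = fun x : EllFam ν M => k * x m i k :=
      funext fun x => linPart_of_pos m i (by omega) x
    rw [this]
    exact continuous_const.mul ((continuous_coeff k).comp
      ((continuous_apply i).comp (continuous_apply m)))

lemma continuous_dF (P : Params) (t : Fin (M + 1) → ℝ) (x : EllFam ν M) (m : Fin M) (i : Fin 6)
    (k : ℕ) : Continuous (dF P t x m i k) := by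
  have : ⇑(dF P t x m i k) = fun h : EllFam ν M => linPart m i k h - quarterStep t m *
      mpₗ ν (∑ j, h m j * MvPolynomial.aeval (x m) (MvPolynomial.pderiv j (fieldPoly P i))) k :=
    funext fun h => dF_apply P t x h m i k
  rw [this]
  refine (continuous_linPart m i k).sub (continuous_const.mul ((continuous_coeff k).comp
    (continuous_mpₗ.comp (continuous_finsetSum _ fun j _ => ?_))))
  have hc : Continuous fun h : EllFam ν M => h m j := (continuous_apply j).comp (continuous_apply m)
  exact hc.mul continuous_const

variable (P : Params) (t : Fin (M + 1) → ℝ) (p₁ : Phase) (Xbar : Fin M → Fin 6 → Fin K → ℝ)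
  (AK : Matrix (Fin M × Fin 6 × Fin K) (Fin M × Fin 6 × Fin K) ℝ)

/-- The `k`-th derivative of the part of `F` coming from the vector field, at the approximate
solution. -/
def derivF (ν : ℝ) [Fact (1 < ν)] (k : ℕ) :
    MultilinearMap ℝ (fun _ : Fin k => EllFam ν M) (EllFam ν M) :=
  MultilinearMap.pi fun n => MultilinearMap.pi fun i => ∑ js : Fin k → Fin 6,
    ((-quarterStep t n • mpₗ ν) ∘ₗ LinearMap.mulRight ℝ (MvPolynomial.aeval (injE ν Xbar n)
      (pderivs (List.ofFn js) (fieldPoly P i)))).compMultilinearMap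
      ((MultilinearMap.mkPiAlgebra ℝ (Fin k) (EllOne ν)).compLinearMap fun l =>
        LinearMap.proj (js l) ∘ₗ LinearMap.proj n)

lemma derivF_apply (k : ℕ) (v : Fin k → EllFam ν M) (n : Fin M) (i : Fin 6) :
    derivF P t Xbar ν k v n i = ∑ js : Fin k → Fin 6, -quarterStep t n • mpₗ ν
      ((∏ l, v l n (js l)) * MvPolynomial.aeval (injE ν Xbar n)
        (pderivs (List.ofFn js) (fieldPoly P i))) := by
  simp [derivF]

/-- Taylor's formula for `F` at the approximate solution. -/
lemma F_add (h : EllFam ν M) (m : Fin M) (i : Fin 6) (k : ℕ) :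
    F P t p₁ (toC (injE ν Xbar + h)) m i k = F P t p₁ (inj Xbar) m i k +
      dF P t (injE ν Xbar) m i k h + ((1 / 2 : ℝ) • derivF P t Xbar ν 2 (fun _ => h) +
        (1 / 6 : ℝ) • derivF P t Xbar ν 3 (fun _ => h) +
        (1 / 24 : ℝ) • derivF P t Xbar ν 4 (fun _ => h)) m i k := by
  have hT := aeval_add_eq_sum (injE ν Xbar m) (h m) (fieldPoly P i) (totalDegree_fieldPoly_le P i)
  rw [← toC_injE (ν := ν), F_toC, F_toC, dF_apply, map_add, Pi.add_apply, hT]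
  have h1 : ∑ js : Fin 1 → Fin 6, (∏ l, h m (js l)) *
      MvPolynomial.aeval (injE ν Xbar m) (pderivs (List.ofFn js) (fieldPoly P i)) =
      ∑ j, h m j * MvPolynomial.aeval (injE ν Xbar m) (MvPolynomial.pderiv j (fieldPoly P i)) := by
    rw [← (Equiv.funUnique (Fin 1) (Fin 6)).symm.sum_comp]
    refine Finset.sum_congr rfl fun j _ => ?_
    simp [pderivs, Equiv.funUnique]
  have hd : ∀ k, derivF P t Xbar ν k (fun _ => h) m i = -quarterStep t m • mpₗ ν
      (∑ js : Fin k → Fin 6, (∏ l, h m (js l)) *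
      MvPolynomial.aeval (injE ν Xbar m) (pderivs (List.ofFn js) (fieldPoly P i))) := by
    intro k
    rw [derivF_apply, map_sum, Finset.smul_sum]
  have e : ((1 / 2 : ℝ) • derivF P t Xbar ν 2 (fun _ => h) +
        (1 / 6 : ℝ) • derivF P t Xbar ν 3 (fun _ => h) +
        (1 / 24 : ℝ) • derivF P t Xbar ν 4 (fun _ => h)) m i =
      (1 / 2 : ℝ) • derivF P t Xbar ν 2 (fun _ => h) m i +
        (1 / 6 : ℝ) • derivF P t Xbar ν 3 (fun _ => h) m i +
        (1 / 24 : ℝ) • derivF P t Xbar ν 4 (fun _ => h) m i := rfl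
  rw [e, hd, hd, hd]
  simp only [Finset.sum_range_succ, Finset.sum_range_zero, zero_add, h1, map_add, map_smul]
  have h0 : ∑ js : Fin 0 → Fin 6, (∏ l, h m (js l)) *
      MvPolynomial.aeval (injE ν Xbar m) (pderivs (List.ofFn js) (fieldPoly P i))
      = MvPolynomial.aeval (injE ν Xbar m) (fieldPoly P i) := by
    simp [pderivs]
  rw [h0]
  simp only [EllOne.coe_add, EllOne.coe_smul, Pi.add_apply, Pi.smul_apply, smul_eq_mul]
  norm_num [Nat.factorial]
  ring

/-- The norm of a multilinear map, defined through arguments of norm at most one, bounds its value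
at arbitrary arguments: normalise each argument, the case of a zero argument being trivial. -/
lemma multiNorm_bound {k : ℕ} (hk : 2 ≤ k) (n : Fin M) (js : Fin k → Fin 6) (i : Fin 6)
    (U : Fin k → EllOne ν) :
    ‖-quarterStep t n • mpₗ ν ((∏ l, U l) * MvPolynomial.aeval (injE ν Xbar n)
        (pderivs (List.ofFn js) (fieldPoly P i)))‖ ≤
      multiNorm ν k (DkF P t p₁ Xbar k n js i) * ∏ l, ‖U l‖ := by
  set w : EllOne ν := MvPolynomial.aeval (injE ν Xbar n) (pderivs (List.ofFn js) (fieldPoly P i))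
    with hw
  have hne : (Finset.univ : Finset (Fin k)).Nonempty := ⟨⟨0, by omega⟩, Finset.mem_univ _⟩
  by_cases h0 : ∃ l, U l = 0
  · obtain ⟨l, hl⟩ := h0
    rw [Finset.prod_eq_zero (Finset.mem_univ l) hl,
      Finset.prod_eq_zero (Finset.mem_univ l) (by rw [hl, norm_zero])]
    simp
  · push Not at h0
    let U' : Fin k → EllOne ν := fun l => ‖U l‖⁻¹ • U l
    have hU' : ∀ l, ‖U' l‖ = 1 := fun l => by
      simp only [U', norm_smul, norm_inv, norm_norm]
      exact inv_mul_cancel₀ (norm_ne_zero_iff.2 (h0 l))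
    have hU : ∏ l, U l = (∏ l, ‖U l‖) • ∏ l, U' l := by
      rw [← Finset.prod_smul]
      refine Finset.prod_congr rfl fun l _ => ?_
      simp only [U', smul_smul]
      rw [mul_inv_cancel₀ (norm_ne_zero_iff.2 (h0 l)), one_smul]
    have hbdd : BddAbove {r | ∃ u : Fin k → ℕ → ℝ, (∀ l, MemEll ν (u l) ∧ nuNorm ν (u l) = 1) ∧
        r = nuNorm ν (DkF P t p₁ Xbar k n js i u)} := by
      refine ⟨|quarterStep t n| * ((2 * ν + 1) * ‖w‖), ?_⟩
      rintro _ ⟨u, hu, rfl⟩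
      let W : Fin k → EllOne ν := fun l => ⟨u l, (hu l).1⟩
      have h1 := DkF_eq P t p₁ Xbar k hk n js i W
      have h2 : (fun l => (W l).coeff) = u := rfl
      rw [h2] at h1
      rw [h1, ← EllOne.norm_def, norm_smul, norm_neg, Real.norm_eq_abs]
      refine mul_le_mul_of_nonneg_left ((norm_mpₗ_le _).trans ?_) (abs_nonneg _)
      have hν0 : 0 < ν := by linarith [hν.out]
      refine mul_le_mul_of_nonneg_left ?_ (by positivity)
      refine (norm_mul_le _ _).trans ?_
      refine mul_le_of_le_one_left (norm_nonneg _) ?_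
      refine (Finset.norm_prod_le' _ hne _).trans (le_of_eq ?_)
      exact Finset.prod_eq_one fun l _ => (hu l).2
    have h1 := DkF_eq P t p₁ Xbar k hk n js i U'
    have h2 : ‖-quarterStep t n • mpₗ ν ((∏ l, U' l) * w)‖ ≤
        multiNorm ν k (DkF P t p₁ Xbar k n js i) := by
      refine le_csSup hbdd ⟨fun l => (U' l).coeff, fun l => ⟨(U' l).memEll, hU' l⟩, ?_⟩
      rw [h1]; rfl
    rw [hU, smul_mul_assoc, map_smul, smul_comm, norm_smul, mul_comm,
      Real.norm_of_nonneg (Finset.prod_nonneg fun l _ => norm_nonneg _)]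
    exact mul_le_mul_of_nonneg_right h2 (Finset.prod_nonneg fun l _ => norm_nonneg _)

lemma multiNorm_nonneg (k : ℕ) (B : (Fin k → ℕ → ℝ) → ℕ → ℝ) : 0 ≤ multiNorm ν k B :=
  Real.sSup_nonneg (by rintro _ ⟨u, _, rfl⟩; exact nuNorm_nonneg _)

lemma Z_nonneg {η : Fin M → Fin 6 → ℝ} (hη : ∀ m i, 0 < η m i) (k : ℕ) (m : Fin M) :
    0 ≤ Z P t p₁ ν η Xbar AK k m :=
  Finset.sum_nonneg fun _ _ => Real.iSup_nonneg fun _ => Finset.sum_nonneg fun _ _ =>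
    mul_nonneg (div_nonneg (hη _ _).le (Finset.prod_nonneg fun _ _ => (hη _ _).le))
      (Finset.sum_nonneg fun _ _ => mul_nonneg (blockNorm_nonneg _ _ _ _ _) (multiNorm_nonneg _ _))

/-- `Z_k` bounds `A D^k F(X̄)` as a `k`-linear map. Since the `k`-th derivative with `k ≥ 2` does
not couple different subintervals, only arguments from one subinterval occur in each summand. -/
lemma dnorm_op_derivF_le (hK : 1 ≤ K) {η : Fin M → Fin 6 → ℝ} (hη : ∀ m i, 0 < η m i) {k : ℕ}
    (hk : 2 ≤ k) (m : Fin M) (v : Fin k → EllFam ν M) {d : Fin k → ℝ}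
    (hd : ∀ n l, dnorm η n (v l) ≤ d l) :
    dnorm η m ((bddOp_Aop AK hK).op (derivF P t Xbar ν k v)) ≤
      Z P t p₁ ν η Xbar AK k m * ∏ l, d l := by
  have hA := bddOp_Aop (ν := ν) AK hK
  have h1 : ∀ i, ‖hA.op (derivF P t Xbar ν k v) m i‖ ≤ ∑ n, ∑ i₂, blockNorm ν (Aop AK) m i n i₂ *
      ∑ js : Fin k → Fin 6, multiNorm ν k (DkF P t p₁ Xbar k n js i₂) * ∏ l, ‖v l n (js l)‖ := by
    intro i
    rw [hA.op_apply]
    refine norm_sum_le_of_le _ fun n _ => norm_sum_le_of_le _ fun i₂ _ => ?_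
    refine (hA.norm_block_le (hA.colNorm_le_blockNorm m i n i₂) _).trans ?_
    refine mul_le_mul_of_nonneg_left ?_ (blockNorm_nonneg _ _ _ _ _)
    rw [derivF_apply]
    exact norm_sum_le_of_le _ fun js _ =>
      multiNorm_bound P t p₁ Xbar hk n js i₂ fun l => v l n (js l)
  let c : Fin M → (Fin k → Fin 6) → ℝ := fun n js => ∑ i₁, η m i₁ / (∏ l, η n (js l)) *
    ∑ i₂, blockNorm ν (Aop AK) m i₁ n i₂ * multiNorm ν k (DkF P t p₁ Xbar k n js i₂)
  have hc0 : ∀ n, 0 ≤ ⨆ js, c n js := fun n => Real.iSup_nonneg fun js =>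
    Finset.sum_nonneg fun i _ =>
    mul_nonneg (div_nonneg (hη _ _).le (Finset.prod_nonneg fun l _ => (hη _ _).le))
      (Finset.sum_nonneg fun i _ => mul_nonneg (blockNorm_nonneg _ _ _ _ _) (multiNorm_nonneg _ _))
  have hc : ∀ n js, c n js ≤ ⨆ js, c n js := fun n js =>
    le_ciSup (f := c n) (Set.finite_range _).bddAbove js
  have hprod : ∀ n (js : Fin k → Fin 6), 0 < ∏ l, η n (js l) := fun n js =>
    Finset.prod_pos fun l _ => hη _ _
  calc dnorm η m (hA.op (derivF P t Xbar ν k v))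
      ≤ ∑ i, (∑ n, ∑ i₂, blockNorm ν (Aop AK) m i n i₂ * ∑ js : Fin k → Fin 6,
        multiNorm ν k (DkF P t p₁ Xbar k n js i₂) * ∏ l, ‖v l n (js l)‖) * η m i :=
        Finset.sum_le_sum fun i _ => mul_le_mul_of_nonneg_right (h1 i) (hη m i).le
    _ = ∑ n, ∑ js : Fin k → Fin 6, c n js * ∏ l, (‖v l n (js l)‖ * η n (js l)) := by
        simp_rw [Finset.sum_mul, Finset.mul_sum, Finset.sum_mul]
        rw [Finset.sum_comm]
        refine Finset.sum_congr rfl fun n _ => ?_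
        have h2 : ∀ js : Fin k → Fin 6, c n js * ∏ l, (‖v l n (js l)‖ * η n (js l)) =
            ∑ i, ∑ i₂, blockNorm ν (Aop AK) m i n i₂ * (multiNorm ν k
              (DkF P t p₁ Xbar k n js i₂) * ∏ l, ‖v l n (js l)‖) * η m i := by
          intro js
          have h3 := (hprod n js).ne'
          rw [Finset.prod_mul_distrib]
          simp only [c, Finset.sum_mul, Finset.mul_sum]
          refine Finset.sum_congr rfl fun i _ => Finset.sum_congr rfl fun i₂ _ => ?_
          field_simp
        simp_rw [h2]
        rw [Finset.sum_comm (s := (Finset.univ : Finset (Fin k → Fin 6)))]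
        refine Finset.sum_congr rfl fun i _ => ?_
        rw [Finset.sum_comm]
    _ ≤ ∑ n, ∑ js : Fin k → Fin 6, (⨆ js, c n js) * ∏ l, (‖v l n (js l)‖ * η n (js l)) :=
        Finset.sum_le_sum fun n _ => Finset.sum_le_sum fun js _ =>
          mul_le_mul_of_nonneg_right (hc n js)
            (Finset.prod_nonneg fun l _ => mul_nonneg (norm_nonneg _) (hη _ _).le)
    _ = ∑ n, (⨆ js, c n js) * ∏ l, dnorm η n (v l) := by
        refine Finset.sum_congr rfl fun n _ => ?_
        rw [← Finset.mul_sum]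
        simp only [dnorm]
        rw [Finset.prod_univ_sum, Fintype.piFinset_univ]
    _ ≤ ∑ n, (⨆ js, c n js) * ∏ l, d l := by
        refine Finset.sum_le_sum fun n _ => mul_le_mul_of_nonneg_left ?_ (hc0 n)
        refine Finset.prod_le_prod (fun l _ => ?_) fun l _ => hd n l
        exact Finset.sum_nonneg fun i _ => mul_nonneg (norm_nonneg _) (hη _ _).le
    _ = _ := by rw [← Finset.sum_mul]; rfl

end Newton


/-! ### The contraction argument -/

section FixedPoint

variable {ν : ℝ} [hν : Fact (1 < ν)] {M K : ℕ}

/-- `ℓ¹_ν`-valued families, with the maximum over the subintervals of the `ℓ¹` norms over the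
components. -/
abbrev NormFam (ν : ℝ) (M : ℕ) := Fin M → PiLp 1 fun _ : Fin 6 => EllOne ν

/-- Multiplication by the weights, which turns the weighted norm into that of `NormFam ν M`. -/
def scale {η : Fin M → Fin 6 → ℝ} (hη : ∀ m i, 0 < η m i) : EllFam ν M ≃ₗ[ℝ] NormFam ν M where
  toFun x m := WithLp.toLp 1 fun i => η m i • x m i
  invFun w m i := (η m i)⁻¹ • w m i
  map_add' x y := by
    funext m; ext i : 1
    simp
  map_smul' c x := by
    funext m; ext i : 1
    simp [smul_comm c]
  left_inv x := by
    funext m i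
    simp [smul_smul, inv_mul_cancel₀ (hη m i).ne']
  right_inv w := by
    funext m; ext i : 1
    simp [smul_smul, mul_inv_cancel₀ (hη m i).ne']

lemma norm_scale {η : Fin M → Fin 6 → ℝ} (hη : ∀ m i, 0 < η m i) (x : EllFam ν M) (m : Fin M) :
    ‖scale hη x m‖ = dnorm η m x := by
  rw [PiLp.norm_eq_of_L1]
  refine Finset.sum_congr rfl fun i _ => ?_
  simp only [scale, LinearEquiv.coe_mk, LinearMap.coe_mk, AddHom.coe_mk]
  rw [norm_smul, Real.norm_of_nonneg (hη m i).le, mul_comm]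

lemma dnorm_symm_le {η : Fin M → Fin 6 → ℝ} (hη : ∀ m i, 0 < η m i) (w : NormFam ν M) (m : Fin M) :
    dnorm η m ((scale hη).symm w) ≤ ‖w‖ := by
  rw [← norm_scale hη, LinearEquiv.apply_symm_apply]
  exact norm_le_pi_norm w m

lemma norm_scale_le_iff {η : Fin M → Fin 6 → ℝ} (hη : ∀ m i, 0 < η m i) (x : EllFam ν M) {d : ℝ}
    (hd : 0 ≤ d) : ‖scale hη x‖ ≤ d ↔ ∀ m, dnorm η m x ≤ d := by
  rw [pi_norm_le_iff_of_nonneg hd]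
  simp only [norm_scale]

/-- The contraction mapping theorem on a ball of the weighted norm. -/
lemma exists_fixedPoint {η : Fin M → Fin 6 → ℝ} (hη : ∀ m i, 0 < η m i)
    (T : EllFam ν M → EllFam ν M) {ρ κ : ℝ} (hρ : 0 ≤ ρ) (hκ0 : 0 ≤ κ) (hκ : κ < 1)
    (hself : ∀ x, (∀ n, dnorm η n x ≤ ρ) → ∀ m, dnorm η m (T x) ≤ ρ)
    (hlip : ∀ x y d, (∀ n, dnorm η n x ≤ ρ) → (∀ n, dnorm η n y ≤ ρ) →
      (∀ n, dnorm η n (x - y) ≤ d) → ∀ m, dnorm η m (T x - T y) ≤ κ * d) :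
    ∃ x, (∀ n, dnorm η n x ≤ ρ) ∧ T x = x := by
  let T' : NormFam ν M → NormFam ν M := fun w => scale hη (T ((scale hη).symm w))
  let S : Set (NormFam ν M) := Metric.closedBall 0 ρ
  have hS : ∀ w ∈ S, ∀ n, dnorm η n ((scale hη).symm w) ≤ ρ := fun w hw n =>
    (dnorm_symm_le hη w n).trans (by simpa [S] using hw)
  have hmap : MapsTo T' S S := by
    intro w hw
    have := (norm_scale_le_iff hη (T ((scale hη).symm w)) hρ).2 (hself _ (hS w hw))
    simpa [S] using this
  have hcon : ContractingWith ⟨κ, hκ0⟩ (hmap.restrict T' S S) := by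
    refine ⟨by exact_mod_cast hκ, LipschitzWith.of_dist_le_mul ?_⟩
    rintro ⟨a, ha⟩ ⟨b, hb⟩
    change dist (T' a) (T' b) ≤ κ * dist a b
    rw [dist_eq_norm, dist_eq_norm]
    have h1 : T' a - T' b = scale hη (T ((scale hη).symm a) - T ((scale hη).symm b)) :=
      (map_sub _ _ _).symm
    rw [h1, norm_scale_le_iff hη _ (by positivity)]
    refine hlip _ _ _ (hS a ha) (hS b hb) fun n => ?_
    rw [← map_sub]
    exact dnorm_symm_le hη _ n
  obtain ⟨w, hw, hfix, -⟩ := ContractingWith.exists_fixedPoint' Metric.isClosed_closedBall.isComplete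
    hmap hcon (x := 0) (by simpa [S] using hρ) (edist_ne_top _ _)
  refine ⟨(scale hη).symm w, hS w hw, ?_⟩
  apply (scale hη).injective
  rw [LinearEquiv.apply_symm_apply]
  exact hfix

/-- Lipschitz bound for the diagonal of a bounded multilinear map. -/
lemma dnorm_multilinear_sub_le {η : Fin M → Fin 6 → ℝ} (hη : ∀ m i, 0 < η m i) {k : ℕ}
    (f : MultilinearMap ℝ (fun _ : Fin k => EllFam ν M) (EllFam ν M)) (m : Fin M) {C : ℝ}
    (hC : 0 ≤ C) (hf : ∀ (v : Fin k → EllFam ν M) (d : Fin k → ℝ),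
      (∀ n l, dnorm η n (v l) ≤ d l) → dnorm η m (f v) ≤ C * ∏ l, d l)
    {x y : EllFam ν M} {ρ d : ℝ} (hρ : 0 ≤ ρ) (hx : ∀ n, dnorm η n x ≤ ρ)
    (hy : ∀ n, dnorm η n y ≤ ρ) (hd0 : 0 ≤ d) (hd : ∀ n, dnorm η n (x - y) ≤ d) :
    dnorm η m (f (fun _ => x) - f fun _ => y) ≤ C * k * ρ ^ (k - 1) * d := by
  let g : MultilinearMap ℝ (fun _ : Fin k => NormFam ν M) (PiLp 1 fun _ : Fin 6 => EllOne ν) :=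
    ((LinearMap.proj m : NormFam ν M →ₗ[ℝ] _) ∘ₗ (scale hη).toLinearMap).compMultilinearMap
      (f.compLinearMap fun _ => (scale hη).symm.toLinearMap)
  have hg : ∀ w, ‖g w‖ ≤ C * ∏ l, ‖w l‖ := fun w => by
    have : ‖g w‖ = dnorm η m (f fun l => (scale hη).symm (w l)) := norm_scale hη _ m
    rw [this]
    exact hf _ _ fun n l => dnorm_symm_le hη _ n
  have h1 := g.norm_image_sub_le_of_bound hC hg (fun _ => scale hη x) (fun _ => scale hη y)
  have h2 : g (fun _ => scale hη x) - g (fun _ => scale hη y) =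
      scale hη (f (fun _ => x) - f fun _ => y) m := by
    simp [g]
  rw [h2, norm_scale, Fintype.card_fin] at h1
  refine h1.trans ?_
  have hx' := (norm_scale_le_iff hη x hρ).2 hx
  have hy' := (norm_scale_le_iff hη y hρ).2 hy
  have hd' := (norm_scale_le_iff hη _ hd0).2 hd
  rw [map_sub] at hd'
  gcongr
  · exact max_le ((pi_norm_le_iff_of_nonneg hρ).2 fun _ => hx')
      ((pi_norm_le_iff_of_nonneg hρ).2 fun _ => hy')
  · exact (pi_norm_le_iff_of_nonneg hd0).2 fun _ => hd'

/-! ### Zeros of `F` as fixed points -/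

variable (P : Params) (t : Fin (M + 1) → ℝ) (p₁ : Phase) (Xbar : Fin M → Fin 6 → Fin K → ℝ)
  (AK : Matrix (Fin M × Fin 6 × Fin K) (Fin M × Fin 6 × Fin K) ℝ)

lemma rowA_eq_sum (r : Idx M) (y : Idx M → ℝ) :
    rowA AK r y = ∑ n, ∑ j, ∑' l, Aop AK r (n, j, l) * y (n, j, l) := by
  have hs : Summable fun q : Idx M => Aop AK r q * y q :=
    summable_of_ne_finset_zero (s := rowSupp K r) fun q hq => by rw [Aop_eq_zero AK hq, zero_mul]
  rw [rowA_apply, hs.tsum_prod, tsum_fintype]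
  refine Finset.sum_congr rfl fun n _ => ?_
  rw [(hs.prod_factor n).tsum_prod, tsum_fintype]

lemma op_Aop_coeff (hK : 1 ≤ K) (x : EllFam ν M) (r : Idx M) :
    (bddOp_Aop AK hK).op x r.1 r.2.1 r.2.2 = rowA AK r fun q => x q.1 q.2.1 q.2.2 := by
  rw [BddOp.op_apply_coeff, rowA_eq_sum]

/-- On `ℓ¹_ν`, `1 - A DF(X̄)` is the difference of the operators `1 - A A†` and `A (DF(X̄) - A†)`. -/
lemma op_Bop_sub_op_Cop (hK : 1 ≤ K) (ht : StrictMono t) (x : EllFam ν M) (r : Idx M) :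
    ((bddOp_Bop (ν := ν) AK P t p₁ Xbar hK).op x - (bddOp_Cop AK P t p₁ Xbar hK ht).op x) r.1 r.2.1
      r.2.2 = x r.1 r.2.1 r.2.2 -
        rowA AK r fun q => dF P t (injE ν Xbar) q.1 q.2.1 q.2.2 x := by
  let hB := bddOp_Bop (ν := ν) AK P t p₁ Xbar hK
  let hC := bddOp_Cop (ν := ν) AK P t p₁ Xbar hK ht
  let φ : EllFam ν M →ₗ[ℝ] ℝ := (LinearMap.proj r.2.2 ∘ₗ EllOne.coeffs ν ∘ₗ
    LinearMap.proj r.2.1 ∘ₗ LinearMap.proj r.1) -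
    rowA AK r ∘ₗ LinearMap.pi fun q => dF P t (injE ν Xbar) q.1 q.2.1 q.2.2
  have hφ : ∀ y, φ y = y r.1 r.2.1 r.2.2 -
    rowA AK r fun q => dF P t (injE ν Xbar) q.1 q.2.1 q.2.2 y := fun y => rfl
  have hcont : Continuous φ := by
    have : ⇑φ = fun y => y r.1 r.2.1 r.2.2 - ∑ q ∈ rowSupp K r,
        Aop AK r q * dF P t (injE ν Xbar) q.1 q.2.1 q.2.2 y := by
      funext y
      rw [hφ]
      simp [rowA]
    rw [this]
    refine ((continuous_coeff r.2.2).comp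
      ((continuous_apply r.2.1).comp (continuous_apply r.1))).sub ?_
    exact continuous_finsetSum _ fun q _ => continuous_const.mul (continuous_dF P t _ _ _ _)
  have hunit : ∀ n j l, φ (emb n j (unitVec ν l)) =
      Bop P t p₁ Xbar AK r (n, j, l) - Cop P t p₁ Xbar AK r (n, j, l) := by
    intro n j l
    have h1 : ∀ q : Idx M, dF P t (injE ν Xbar) q.1 q.2.1 q.2.2 (emb n j (unitVec ν l)) =
      DF P t p₁ (inj Xbar) q (n, j, l) := fun q => (DF_eq P t p₁ Xbar q (n, j, l)).symm
    have h2 : (fun q => (DF P t p₁ (inj Xbar) - Adag P t p₁ Xbar) q (n, j, l)) =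
      (fun q => DF P t p₁ (inj Xbar) q (n, j, l)) - fun q => Adag P t p₁ Xbar q (n, j, l) := rfl
    rw [hφ, Bop, Cop, Matrix.sub_apply, Matrix.one_apply, opMul_eq, opMul_eq, h2, map_sub,
      emb_coeff]
    simp_rw [h1]
    have h3 : (r = (n, j, l)) ↔ (r.1 = n ∧ r.2.1 = j ∧ r.2.2 = l) := by
      simp only [Prod.ext_iff]
    simp only [h3]
    ring
  rw [← hφ, functional_eq_sum φ x]
  have h4 : (hB.op x - hC.op x) r.1 r.2.1 r.2.2 = hB.op x r.1 r.2.1 r.2.2 - hC.op x r.1 r.2.1 r.2.2 :=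
    rfl
  refine h4.trans ?_
  rw [hB.op_apply_coeff, hC.op_apply_coeff, ← Finset.sum_sub_distrib]
  refine Finset.sum_congr rfl fun n _ => ?_
  rw [← Finset.sum_sub_distrib]
  refine Finset.sum_congr rfl fun j _ => ?_
  rw [← (hasSum_functional hcont x n j).tsum_eq]
  simp_rw [hunit, sub_mul]
  have hs : ∀ {B : Op M} (_ : BddOp ν B), Summable fun l => B (r.1, r.2.1, r.2.2) (n, j, l) * x n j l :=
    fun {B} hB => (kernel_aux (hB.1 r.1 r.2.1 n j)
      (fun l => nuNorm_col_le B (hB.colNorm_le_blockNorm _ _ _ _ l)) (x n j)).1 r.2.2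
  exact ((hs hB).tsum_sub (hs hC)).symm

/-- `F` at the approximate solution. -/
def Fbar (ν : ℝ) [Fact (1 < ν)] : EllFam ν M := fun m i => ⟨F P t p₁ (inj Xbar) m i, by
  have h1 : MemEll ν fun k => linPart m i k (injE ν Xbar) -
      if k = 0 ∧ (m : ℕ) = 0 then p₁ i else 0 := by
    refine memEll_of_finite (max K 1) fun k hk => ?_
    rw [linPart_of_pos _ _ (by omega), injE_eq_zero Xbar m i (by omega),
      if_neg (by omega), mul_zero, sub_zero]
  have h2 : F P t p₁ (inj Xbar) m i = ((⟨_, h1⟩ : EllOne ν) - quarterStep t m •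
      mpₗ ν (MvPolynomial.aeval (injE ν Xbar m) (fieldPoly P i)) : EllOne ν).coeff := by
    funext k
    rw [← toC_injE (ν := ν), F_toC]; rfl
  rw [h2]
  exact EllOne.memEll _⟩

lemma dnorm_op_Fbar (hK : 1 ≤ K) (η : Fin M → Fin 6 → ℝ) (m : Fin M) :
    dnorm η m ((bddOp_Aop AK hK).op (Fbar P t p₁ Xbar ν)) = Y P t p₁ ν η Xbar AK m := by
  have h : ∀ i k, (bddOp_Aop AK hK).op (Fbar P t p₁ Xbar ν) m i k =
      ∑' q : Idx M, Aop AK (m, i, k) q * F P t p₁ (inj Xbar) q.1 q.2.1 q.2.2 := fun i k => by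
    rw [← rowA_apply]
    exact op_Aop_coeff AK hK (Fbar P t p₁ Xbar ν) (m, i, k)
  unfold Y domNorm
  simp_rw [← h]
  rfl

/-- The operator `H ↦ H - A F(X̄ + H)`, written in terms of the operators that the bounds control. -/
def newtonOp (hK : 1 ≤ K) (ht : StrictMono t) (H : EllFam ν M) : EllFam ν M :=
  (bddOp_Bop AK P t p₁ Xbar hK).op H - (bddOp_Cop AK P t p₁ Xbar hK ht).op H -
    (bddOp_Aop AK hK).op (Fbar P t p₁ Xbar ν) -
    ((1 / 2 : ℝ) • (bddOp_Aop AK hK).op (derivF P t Xbar ν 2 fun _ => H) +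
      (1 / 6 : ℝ) • (bddOp_Aop AK hK).op (derivF P t Xbar ν 3 fun _ => H) +
      (1 / 24 : ℝ) • (bddOp_Aop AK hK).op (derivF P t Xbar ν 4 fun _ => H))

/-- The Newton-like operator is `H - A F(X̄ + H)`, entry by entry. -/
lemma newtonOp_apply (hK : 1 ≤ K) (ht : StrictMono t) (H : EllFam ν M) (r : Idx M) :
    newtonOp P t p₁ Xbar AK hK ht H r.1 r.2.1 r.2.2 = H r.1 r.2.1 r.2.2 -
      rowA AK r fun q => F P t p₁ (toC (injE ν Xbar + H)) q.1 q.2.1 q.2.2 := by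
  let N : EllFam ν M := (1 / 2 : ℝ) • derivF P t Xbar ν 2 (fun _ => H) +
        (1 / 6 : ℝ) • derivF P t Xbar ν 3 (fun _ => H) +
        (1 / 24 : ℝ) • derivF P t Xbar ν 4 (fun _ => H)
  have h1 : newtonOp P t p₁ Xbar AK hK ht H r.1 r.2.1 r.2.2 =
      ((bddOp_Bop AK P t p₁ Xbar hK).op H - (bddOp_Cop AK P t p₁ Xbar hK ht).op H) r.1 r.2.1 r.2.2 -
      (bddOp_Aop AK hK).op (Fbar P t p₁ Xbar ν) r.1 r.2.1 r.2.2 -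
      (bddOp_Aop AK hK).op N r.1 r.2.1 r.2.2 := by
    simp only [N, map_add, map_smul]
    rfl
  have h2 : (fun q : Idx M => F P t p₁ (toC (injE ν Xbar + H)) q.1 q.2.1 q.2.2) =
      (fun q => Fbar P t p₁ Xbar ν q.1 q.2.1 q.2.2) +
      (fun q => dF P t (injE ν Xbar) q.1 q.2.1 q.2.2 H) + fun q => N q.1 q.2.1 q.2.2 := by
    funext q
    rw [F_add]; rfl
  rw [h1, h2, op_Bop_sub_op_Cop P t p₁ Xbar AK hK ht, op_Aop_coeff AK hK, op_Aop_coeff AK hK,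
    map_add, map_add]
  ring

lemma Z₁_nonneg (hK : 1 ≤ K) (ht : StrictMono t) {η : Fin M → Fin 6 → ℝ} (hη : ∀ m i, 0 < η m i)
    (m : Fin M) : 0 ≤ Z₁ P t p₁ ν η Xbar AK m :=
  Finset.sum_nonneg fun n _ => weightedNorm_nonneg (hη n) (hη m) fun i j =>
    (colNorm_nonneg _ _ _ _ _ 0).trans (colNorm_Cop_le AK P t p₁ Xbar hK ht m i n j 0)

lemma Z₀_nonneg {η : Fin M → Fin 6 → ℝ} (hη : ∀ m i, 0 < η m i)
    (m : Fin M) : 0 ≤ Z₀ P t p₁ ν η Xbar AK m :=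
  Finset.sum_nonneg fun n _ => weightedNorm_nonneg (hη n) (hη m) fun _ _ => blockNorm_nonneg _ _ _ _ _

lemma dnorm_op_Bop_le (hK : 1 ≤ K) {η : Fin M → Fin 6 → ℝ} (hη : ∀ m i, 0 < η m i) (m : Fin M)
    {x : EllFam ν M} {d : ℝ} (hx : ∀ n, dnorm η n x ≤ d) :
    dnorm η m ((bddOp_Bop AK P t p₁ Xbar hK).op x) ≤ Z₀ P t p₁ ν η Xbar AK m * d :=
  BddOp.dnorm_op_le _ hη m (fun n i j l => (bddOp_Bop AK P t p₁ Xbar hK).colNorm_le_blockNorm m i n j l)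
    hx

lemma dnorm_op_Cop_le (hK : 1 ≤ K) (ht : StrictMono t) {η : Fin M → Fin 6 → ℝ}
    (hη : ∀ m i, 0 < η m i) (m : Fin M) {x : EllFam ν M} {d : ℝ} (hx : ∀ n, dnorm η n x ≤ d) :
    dnorm η m ((bddOp_Cop AK P t p₁ Xbar hK ht).op x) ≤ Z₁ P t p₁ ν η Xbar AK m * d :=
  BddOp.dnorm_op_le _ hη m (fun n i j l => colNorm_Cop_le AK P t p₁ Xbar hK ht m i n j l) hx

lemma dnorm_add_le {η : Fin M → Fin 6 → ℝ} (hη : ∀ m i, 0 < η m i) (m : Fin M) (x y : EllFam ν M) :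
    dnorm η m (x + y) ≤ dnorm η m x + dnorm η m y := by
  rw [← norm_scale hη, ← norm_scale hη, ← norm_scale hη, map_add]
  exact norm_add_le _ _

lemma dnorm_sub_le {η : Fin M → Fin 6 → ℝ} (hη : ∀ m i, 0 < η m i) (m : Fin M) (x y : EllFam ν M) :
    dnorm η m (x - y) ≤ dnorm η m x + dnorm η m y := by
  rw [← norm_scale hη, ← norm_scale hη, ← norm_scale hη, map_sub]
  exact norm_sub_le _ _

lemma dnorm_smul {η : Fin M → Fin 6 → ℝ} (hη : ∀ m i, 0 < η m i) (m : Fin M) (c : ℝ)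
    (x : EllFam ν M) : dnorm η m (c • x) = |c| * dnorm η m x := by
  rw [← norm_scale hη, ← norm_scale hη, map_smul]
  exact norm_smul c (scale hη x m)

lemma dnorm_nonneg {η : Fin M → Fin 6 → ℝ} (hη : ∀ m i, 0 < η m i) (m : Fin M) (x : EllFam ν M) :
    0 ≤ dnorm η m x := by
  rw [← norm_scale hη]; exact norm_nonneg _

lemma eq_zero_of_dnorm {η : Fin M → Fin 6 → ℝ} (hη : ∀ m i, 0 < η m i) {x : EllFam ν M}
    (h : ∀ m, dnorm η m x ≤ 0) : x = 0 := by
  have := (norm_scale_le_iff hη x le_rfl).2 h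
  rw [norm_le_zero_iff] at this
  exact (LinearEquiv.map_eq_zero_iff _).1 this

end FixedPoint


section Existence

variable {ν : ℝ} [hν : Fact (1 < ν)] {M K : ℕ}
  (P : Params) (t : Fin (M + 1) → ℝ) (p₁ : Phase) (Xbar : Fin M → Fin 6 → Fin K → ℝ)
  (AK : Matrix (Fin M × Fin 6 × Fin K) (Fin M × Fin 6 × Fin K) ℝ)

/-- If `‖1 - A A†‖ < 1`, then the matrix `A^[K]` is invertible: its product with the finite block of
`A†` has no kernel. -/
lemma isUnit_of_Z₀_lt_one (hK : 1 ≤ K) {η : Fin M → Fin 6 → ℝ} (hη : ∀ m i, 0 < η m i)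
    (hZ : ∀ m, Z₀ P t p₁ ν η Xbar AK m < 1) : IsUnit AK := by
  let J : Matrix (Fin M × Fin 6 × Fin K) (Fin M × Fin 6 × Fin K) ℝ := fun q s =>
    Adag P t p₁ Xbar (q.1, q.2.1, (q.2.2 : ℕ)) (s.1, s.2.1, (s.2.2 : ℕ))
  have hker : ∀ w, (AK * J).mulVec w = 0 → w = 0 := by
    intro w hw
    let x : EllFam ν M := fun m i => ⟨fun k => if h : k < K then w (m, i, ⟨k, h⟩) else 0,
      memEll_of_finite K fun k hk => dif_neg (not_lt.2 hk)⟩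
    have hxk : ∀ m i k, K ≤ k → x m i k = 0 := fun m i k hk => dif_neg (not_lt.2 hk)
    have hxw : ∀ m i (k : Fin K), x m i k = w (m, i, k) := fun m i k => dif_pos k.2
    have hBx : (bddOp_Bop (ν := ν) AK P t p₁ Xbar hK).op x = x := by
      funext m i
      refine EllOne.ext fun k => ?_
      rw [BddOp.op_apply_coeff]
      rcases lt_or_ge k K with hk | hk
      · have hB : ∀ n j (l : Fin K), Bop P t p₁ Xbar AK (m, i, k) (n, j, (l : ℕ)) =
            (1 - AK * J : Matrix _ _ ℝ) (m, i, ⟨k, hk⟩) (n, j, l) := by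
          intro n j l
          rw [Bop, Matrix.sub_apply, Matrix.sub_apply, Matrix.one_apply, Matrix.one_apply, opMul_eq,
            rowA_of_lt AK (r := (m, i, k)) hk, Matrix.mul_apply]
          congr 1
          simp only [Prod.ext_iff, Fin.ext_iff]
        have h1 : ∀ n j, ∑' l, Bop P t p₁ Xbar AK (m, i, k) (n, j, l) * x n j l =
            ∑ l : Fin K, (1 - AK * J : Matrix _ _ ℝ) (m, i, ⟨k, hk⟩) (n, j, l) * w (n, j, l) := by
          intro n j
          rw [tsum_eq_sum (s := Finset.range K) fun l hl => by
            rw [hxk n j l (by simpa using hl), mul_zero], Finset.sum_range]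
          refine Finset.sum_congr rfl fun l _ => ?_
          rw [hB, hxw]
        simp_rw [h1]
        have h2 : ((1 - AK * J : Matrix _ _ ℝ).mulVec w) (m, i, ⟨k, hk⟩) = w (m, i, ⟨k, hk⟩) := by
          rw [Matrix.sub_mulVec, hw, Matrix.one_mulVec, sub_zero]
        rw [← hxw] at h2
        rw [← h2, Matrix.mulVec, dotProduct, Fintype.sum_prod_type]
        refine Finset.sum_congr rfl fun n _ => ?_
        rw [Fintype.sum_prod_type]
      · rw [hxk m i k hk]
        refine Finset.sum_eq_zero fun n _ => Finset.sum_eq_zero fun j _ => ?_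
        simp_rw [Bop_eq_zero AK P t p₁ Xbar hK (m, i, k) _ (Or.inl hk), zero_mul, tsum_zero]
    have hx0 : x = 0 := by
      refine eq_zero_of_dnorm hη fun m => ?_
      have : Nonempty (Fin M) := ⟨m⟩
      obtain ⟨m₀, hm₀⟩ := Finite.exists_max fun m => dnorm η m x
      refine (hm₀ m).trans ?_
      have h1 := dnorm_op_Bop_le P t p₁ Xbar AK hK hη m₀ hm₀
      rw [hBx] at h1
      by_contra! h2
      have := hZ m₀
      nlinarith
    funext q
    rw [← hxw q.1 q.2.1 q.2.2, hx0]; rfl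
  have h1 : IsUnit (AK * J) := by
    rw [← Matrix.mulVec_injective_iff_isUnit]
    intro a b hab
    rw [← sub_eq_zero]
    refine hker _ ?_
    rw [Matrix.mulVec_sub, sub_eq_zero]
    exact hab
  rw [Matrix.isUnit_iff_isUnit_det, Matrix.det_mul] at h1
  rw [Matrix.isUnit_iff_isUnit_det]
  exact isUnit_of_mul_isUnit_left h1

/-- `A` is injective on all families, its tail being multiplication by `1/k`. -/
lemma eq_zero_of_rowA_eq_zero (hK : 1 ≤ K) (hAK : IsUnit AK) {y : Idx M → ℝ}
    (h : ∀ r, rowA AK r y = 0) : y = 0 := by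
  have hfin : (fun q : Fin M × Fin 6 × Fin K => y (q.1, q.2.1, (q.2.2 : ℕ))) = 0 := by
    apply Matrix.mulVec_injective_iff_isUnit.2 hAK
    funext r
    rw [Matrix.mulVec_zero]
    have := h (r.1, r.2.1, (r.2.2 : ℕ))
    rw [rowA_of_lt AK (r := (r.1, r.2.1, (r.2.2 : ℕ))) r.2.2.2] at this
    exact this
  funext r
  rcases lt_or_ge r.2.2 K with hr | hr
  · exact congrFun hfin (r.1, r.2.1, ⟨r.2.2, hr⟩)
  · have h1 := h r
    have : (r.2.2 : ℝ) ≠ 0 := by exact_mod_cast (by omega : r.2.2 ≠ 0)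
    rw [rowA_of_ge AK hr] at h1
    simpa [this] using h1

/-- The derivative of order `k` of the nonlinear part of `A F`, at the approximate solution. -/
def derivAF (ν : ℝ) [Fact (1 < ν)] (hK : 1 ≤ K) (k : ℕ) :
    MultilinearMap ℝ (fun _ : Fin k => EllFam ν M) (EllFam ν M) :=
  (bddOp_Aop AK hK).op.compMultilinearMap (derivF P t Xbar ν k)

lemma dnorm_derivAF_le (hK : 1 ≤ K) {η : Fin M → Fin 6 → ℝ} (hη : ∀ m i, 0 < η m i) {k : ℕ}
    (hk : 2 ≤ k) (m : Fin M) (v : Fin k → EllFam ν M) (d : Fin k → ℝ)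
    (hd : ∀ n l, dnorm η n (v l) ≤ d l) :
    dnorm η m (derivAF P t Xbar AK ν hK k v) ≤ Z P t p₁ ν η Xbar AK k m * ∏ l, d l :=
  dnorm_op_derivF_le P t p₁ Xbar AK hK hη hk m v hd

/-- The quantity `P⁽ᵐ⁾(ρ) + ρ` bounds the Newton-like operator on the ball of radius `ρ`. -/
lemma newtonOp_mem_ball (hK : 1 ≤ K) (ht : StrictMono t) {η : Fin M → Fin 6 → ℝ}
    (hη : ∀ m i, 0 < η m i) {ρ : ℝ} {x : EllFam ν M} (hx : ∀ n, dnorm η n x ≤ ρ) (m : Fin M) :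
    dnorm η m (newtonOp P t p₁ Xbar AK hK ht x) ≤ radiiP P t p₁ ν η Xbar AK m ρ + ρ := by
  have hG : ∀ k, 2 ≤ k → dnorm η m (derivAF P t Xbar AK ν hK k fun _ => x) ≤
      Z P t p₁ ν η Xbar AK k m * ρ ^ k := fun k hk => by
    have := dnorm_derivAF_le P t p₁ Xbar AK hK hη hk m (fun _ => x) (fun _ => ρ) fun n _ => hx n
    simpa using this
  have hB := dnorm_op_Bop_le P t p₁ Xbar AK hK hη m hx
  have hC := dnorm_op_Cop_le P t p₁ Xbar AK hK ht hη m hx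
  have hY := dnorm_op_Fbar (ν := ν) P t p₁ Xbar AK hK η m
  have h2 := hG 2 le_rfl
  have h3 := hG 3 (by norm_num)
  have h4 := hG 4 (by norm_num)
  have e : newtonOp P t p₁ Xbar AK hK ht x =
      (bddOp_Bop AK P t p₁ Xbar hK).op x - (bddOp_Cop AK P t p₁ Xbar hK ht).op x -
      (bddOp_Aop AK hK).op (Fbar P t p₁ Xbar ν) -
      ((1 / 2 : ℝ) • derivAF P t Xbar AK ν hK 2 (fun _ => x) +
        (1 / 6 : ℝ) • derivAF P t Xbar AK ν hK 3 (fun _ => x) +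
        (1 / 24 : ℝ) • derivAF P t Xbar AK ν hK 4 (fun _ => x)) := rfl
  rw [e]
  refine (dnorm_sub_le hη m _ _).trans ?_
  refine (add_le_add ((dnorm_sub_le hη m _ _).trans (add_le_add_left (dnorm_sub_le hη m _ _) _))
    ((dnorm_add_le hη m _ _).trans (add_le_add_left (dnorm_add_le hη m _ _) _))).trans ?_
  rw [dnorm_smul hη, dnorm_smul hη, dnorm_smul hη, hY, abs_of_pos (by norm_num),
    abs_of_pos (by norm_num), abs_of_pos (by norm_num)]
  unfold radiiP
  linarith

/-- The quantity `Q⁽ᵐ⁾(ρ) + 1` is a Lipschitz constant of the Newton-like operator on the ball of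
radius `ρ`; the `k`-linear terms contribute `k ρ^(k-1)` each. -/
lemma newtonOp_lipschitz (hK : 1 ≤ K) (ht : StrictMono t) {η : Fin M → Fin 6 → ℝ}
    (hη : ∀ m i, 0 < η m i) {ρ d : ℝ} (hρ : 0 ≤ ρ) {x y : EllFam ν M} (hx : ∀ n, dnorm η n x ≤ ρ)
    (hy : ∀ n, dnorm η n y ≤ ρ) (hd : ∀ n, dnorm η n (x - y) ≤ d) (m : Fin M) :
    dnorm η m (newtonOp P t p₁ Xbar AK hK ht x - newtonOp P t p₁ Xbar AK hK ht y) ≤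
      (radiiQ P t p₁ ν η Xbar AK m ρ + 1) * d := by
  have hd0 : 0 ≤ d := (dnorm_nonneg hη m _).trans (hd m)
  have hB := dnorm_op_Bop_le P t p₁ Xbar AK hK hη m hd
  have hC := dnorm_op_Cop_le P t p₁ Xbar AK hK ht hη m hd
  have hG : ∀ k, 2 ≤ k → dnorm η m (derivAF P t Xbar AK ν hK k (fun _ => x) -
      derivAF P t Xbar AK ν hK k fun _ => y) ≤ Z P t p₁ ν η Xbar AK k m * k * ρ ^ (k - 1) * d :=
    fun k hk => dnorm_multilinear_sub_le hη (derivAF P t Xbar AK ν hK k) m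
      (Z_nonneg P t p₁ Xbar AK hη k m) (dnorm_derivAF_le P t p₁ Xbar AK hK hη hk m) hρ hx hy hd0 hd
  have h2 := hG 2 le_rfl
  have h3 := hG 3 (by norm_num)
  have h4 := hG 4 (by norm_num)
  have e : newtonOp P t p₁ Xbar AK hK ht x - newtonOp P t p₁ Xbar AK hK ht y =
      (bddOp_Bop AK P t p₁ Xbar hK).op (x - y) - (bddOp_Cop AK P t p₁ Xbar hK ht).op (x - y) -
      ((1 / 2 : ℝ) • (derivAF P t Xbar AK ν hK 2 (fun _ => x) -
          derivAF P t Xbar AK ν hK 2 fun _ => y) +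
        (1 / 6 : ℝ) • (derivAF P t Xbar AK ν hK 3 (fun _ => x) -
          derivAF P t Xbar AK ν hK 3 fun _ => y) +
        (1 / 24 : ℝ) • (derivAF P t Xbar AK ν hK 4 (fun _ => x) -
          derivAF P t Xbar AK ν hK 4 fun _ => y)) := by
    simp only [newtonOp, derivAF, LinearMap.compMultilinearMap_apply, map_sub, smul_sub]
    abel
  rw [e]
  refine (dnorm_sub_le hη m _ _).trans ?_
  refine (add_le_add (dnorm_sub_le hη m _ _)
    ((dnorm_add_le hη m _ _).trans (add_le_add_left (dnorm_add_le hη m _ _) _))).trans ?_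
  rw [dnorm_smul hη, dnorm_smul hη, dnorm_smul hη, abs_of_pos (by norm_num),
    abs_of_pos (by norm_num), abs_of_pos (by norm_num)]
  unfold radiiQ
  norm_num at h2 h3 h4
  linarith

/-- The radii polynomial theorem: `F` has a zero within distance `ρ` of the approximate solution. -/
lemma exists_zero (hM : 1 ≤ M) (hK : 1 ≤ K) (ht : StrictMono t) {η : Fin M → Fin 6 → ℝ}
    (hη : ∀ m i, 0 < η m i) {ρ : ℝ} (hρ : 0 < ρ)
    (hP : ∀ m, radiiP P t p₁ ν η Xbar AK m ρ < 0) (hQ : ∀ m, radiiQ P t p₁ ν η Xbar AK m ρ < 0) :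
    ∃ H : EllFam ν M, (∀ m, dnorm η m H ≤ ρ) ∧ F P t p₁ (toC (injE ν Xbar + H)) = 0 := by
  have : Nonempty (Fin M) := ⟨⟨0, hM⟩⟩
  have hQ1 : ∀ m, Z₀ P t p₁ ν η Xbar AK m ≤ radiiQ P t p₁ ν η Xbar AK m ρ + 1 := fun m => by
    have h2 := Z_nonneg (ν := ν) P t p₁ Xbar AK hη 2 m
    have h3 := Z_nonneg (ν := ν) P t p₁ Xbar AK hη 3 m
    have h4 := Z_nonneg (ν := ν) P t p₁ Xbar AK hη 4 m
    have h1 := Z₁_nonneg (ν := ν) P t p₁ Xbar AK hK ht hη m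
    have : 0 ≤ Z P t p₁ ν η Xbar AK 4 m / 6 * ρ ^ 3 + Z P t p₁ ν η Xbar AK 3 m / 2 * ρ ^ 2
      + Z P t p₁ ν η Xbar AK 2 m * ρ + Z₁ P t p₁ ν η Xbar AK m := by positivity
    unfold radiiQ
    linarith
  obtain ⟨m₀, hm₀⟩ := Finite.exists_max fun m => radiiQ P t p₁ ν η Xbar AK m ρ
  have hself : ∀ x : EllFam ν M, (∀ n, dnorm η n x ≤ ρ) →
      ∀ m, dnorm η m (newtonOp P t p₁ Xbar AK hK ht x) ≤ ρ := fun x hx m =>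
    (newtonOp_mem_ball P t p₁ Xbar AK hK ht hη hx m).trans (by linarith [hP m])
  have hlip : ∀ (x y : EllFam ν M) (d : ℝ), (∀ n, dnorm η n x ≤ ρ) → (∀ n, dnorm η n y ≤ ρ) →
      (∀ n, dnorm η n (x - y) ≤ d) →
      ∀ m, dnorm η m (newtonOp P t p₁ Xbar AK hK ht x - newtonOp P t p₁ Xbar AK hK ht y) ≤
        (radiiQ P t p₁ ν η Xbar AK m₀ ρ + 1) * d := fun x y d hx hy hd m =>
    (newtonOp_lipschitz P t p₁ Xbar AK hK ht hη hρ.le hx hy hd m).trans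
      (mul_le_mul_of_nonneg_right (by linarith [hm₀ m]) ((dnorm_nonneg hη m _).trans (hd m)))
  obtain ⟨H, hH, hfix⟩ := exists_fixedPoint hη (newtonOp P t p₁ Xbar AK hK ht) hρ.le
    ((Z₀_nonneg P t p₁ Xbar AK hη m₀).trans (hQ1 m₀)) (by linarith [hQ m₀]) hself hlip
  have hAK : IsUnit AK := isUnit_of_Z₀_lt_one P t p₁ Xbar AK hK hη fun m => by
    linarith [hQ1 m, hQ m]
  refine ⟨H, hH, ?_⟩
  have h0 := eq_zero_of_rowA_eq_zero AK hK hAK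
    (y := fun q => F P t p₁ (toC (injE ν Xbar + H)) q.1 q.2.1 q.2.2) fun r => by
      have := newtonOp_apply P t p₁ Xbar AK hK ht H r
      rw [hfix] at this
      linarith
  funext m i k
  exact congrFun h0 (m, i, k)

end Existence


/-! ### Zeros of `F` and solutions of the differential equation -/

section Analysis

/-- A function with a continuous derivative in the open interval, both continuous up to the end
points, is differentiable in the closed interval. -/
lemma hasDerivWithinAt_Icc_of_Ioo {f f' : ℝ → ℝ} {a b : ℝ} (hab : a < b)
    (hf : ContinuousOn f (Icc a b)) (hf' : ContinuousOn f' (Icc a b))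
    (hd : ∀ s ∈ Ioo a b, HasDerivAt f (f' s) s) {s : ℝ} (hs : s ∈ Icc a b) :
    HasDerivWithinAt f (f' s) (Icc a b) s := by
  have hcl : closure (Ioo a b) = Icc a b := closure_Ioo hab.ne
  have h := hasFDerivWithinAt_closure_of_tendsto_fderiv (f := f) (s := Ioo a b) (x := s)
    (f' := ContinuousLinearMap.toSpanSingleton ℝ (f' s))
    (fun x hx => (hd x hx).differentiableAt.differentiableWithinAt) (convex_Ioo a b) isOpen_Ioo
    (fun y hy => (hf y (hcl ▸ hy)).mono Ioo_subset_Icc_self) (by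
      have h1 : Tendsto (fun y => ContinuousLinearMap.toSpanSingleton ℝ (f' y)) (𝓝[Ioo a b] s)
          (𝓝 (ContinuousLinearMap.toSpanSingleton ℝ (f' s))) := by
        have hc : Continuous fun c : ℝ => ContinuousLinearMap.toSpanSingleton ℝ c :=
          (ContinuousLinearMap.toSpanSingletonLE ℝ ℝ ℝ).toContinuousLinearEquiv.continuous
        exact (hc.tendsto _).comp ((hf' s hs).mono Ioo_subset_Icc_self)
      refine h1.congr' ?_
      filter_upwards [self_mem_nhdsWithin] with y hy
      exact (hd y hy).hasFDerivAt.fderiv.symm)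
  rw [hcl] at h
  exact h.hasDerivWithinAt.congr_deriv (by simp)

/-- Differentiability within a finite union of closed sets. -/
lemma hasDerivWithinAt_iUnion {E ι : Type*} [NormedAddCommGroup E] [NormedSpace ℝ E] [Finite ι]
    {f : ℝ → E} {f' : E} {S : ι → Set ℝ} {x : ℝ} (hS : ∀ i, IsClosed (S i))
    (h : ∀ i, x ∈ S i → HasDerivWithinAt f f' (S i) x) : HasDerivWithinAt f f' (⋃ i, S i) x := by
  have h' : ∀ i, HasDerivWithinAt f f' (S i) x := fun i => by
    by_cases hx : x ∈ S i
    · exact h i hx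
    · exact HasFDerivWithinAt.of_notMem_closure (by rwa [(hS i).closure_eq])
  rw [hasDerivWithinAt_iff_isLittleO, Asymptotics.isLittleO_iff]
  intro c hc
  rw [nhdsWithin_iUnion, eventually_iSup]
  intro i
  have := h' i
  rw [hasDerivWithinAt_iff_isLittleO, Asymptotics.isLittleO_iff] at this
  exact this hc

end Analysis

section ChebDeriv

open Polynomial.Chebyshev

variable {ν : ℝ} [hν : Fact (1 < ν)]

lemma continuousOn_chebSum (u : EllOne ν) : ContinuousOn (fun s => chebSum s u) (Icc (-1) 1) := by
  refine continuousOn_tsum (u := fun k => 2 * |u k|) (fun k => ?_)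
    ((u.memEll.summable_abs hν.out).mul_left 2) fun k s hs => ?_
  · exact (continuous_const.mul (Polynomial.continuous _)).continuousOn
  · have h1 := abs_eval_T_real_le_one k (abs_le.2 ⟨hs.1, hs.2⟩)
    rw [norm_mul, norm_mul, Real.norm_eq_abs, Real.norm_eq_abs, Real.norm_eq_abs]
    refine (mul_le_of_le_one_right (by positivity) h1).trans ?_
    gcongr
    split_ifs <;> simp

lemma abs_eval_U_le (k : ℕ) {s : ℝ} (hs : |s| ≤ 1) : |(U ℝ k).eval s| ≤ k + 1 := by
  induction k using Nat.twoStepInduction with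
  | zero => simp
  | one =>
    simp only [Nat.cast_one, U_one, Polynomial.eval_mul, Polynomial.eval_ofNat, Polynomial.eval_X,
      abs_mul, abs_two]
    linarith
  | more k ih _ =>
    have h1 := abs_eval_T_real_le_one (k + 2) hs
    have h2 : (U ℝ ((k + 2 : ℕ) : ℤ)).eval s = 2 * (T ℝ (k + 2)).eval s + (U ℝ k).eval s := by
      push_cast
      rw [U_eq_two_mul_T_add_U]
      simp
    rw [h2]
    refine (abs_add_le _ _).trans ?_
    rw [abs_mul, abs_two]
    push_cast
    linarith

lemma summable_abs_mul_succ (w : EllOne ν) : Summable fun k => |w k| * ((k : ℝ) + 1) := by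
  have h0 : 0 < ν - 1 := by linarith [hν.out]
  refine Summable.of_nonneg_of_le (fun k => by positivity) (fun k => ?_)
    (((memEll_iff_pow hν.out).1 w.memEll).mul_left (1 + 1 / (ν - 1)))
  have h1 : 1 + (k : ℝ) * (ν - 1) ≤ ν ^ k := by
    have := one_add_mul_le_pow (a := ν - 1) (by linarith) k
    simpa using this
  have h2 : (k : ℝ) ≤ 1 / (ν - 1) * ν ^ k := by
    rw [one_div, inv_mul_eq_div, le_div_iff₀ h0]; linarith
  have h3 : (1 : ℝ) ≤ ν ^ k := one_le_pow₀ hν.out.le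
  calc |w k| * ((k : ℝ) + 1) ≤ |w k| * ((1 + 1 / (ν - 1)) * ν ^ k) := by gcongr; linarith
    _ = _ := by ring

lemma summable_mul_eval_U (w : EllOne ν) {s : ℝ} (hs : |s| ≤ 1) :
    Summable fun k : ℕ => w k * (U ℝ k).eval s := by
  refine Summable.of_norm_bounded (summable_abs_mul_succ w) fun k => ?_
  rw [norm_mul, Real.norm_eq_abs, Real.norm_eq_abs]
  exact mul_le_mul_of_nonneg_left (abs_eval_U_le k hs) (abs_nonneg _)

lemma summable_shift_mul_eval_U (w : EllOne ν) {s : ℝ} (hs : |s| ≤ 1) :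
    Summable fun k : ℕ => w (k + 2) * (U ℝ k).eval s := by
  refine Summable.of_norm_bounded ((summable_nat_add_iff 2).2 (summable_abs_mul_succ w)) fun k => ?_
  rw [norm_mul, Real.norm_eq_abs, Real.norm_eq_abs]
  refine mul_le_mul_of_nonneg_left ((abs_eval_U_le k hs).trans ?_) (abs_nonneg _)
  push_cast; linarith

lemma tsum_mp_mul_eval_U (w : EllOne ν) {s : ℝ} (hs : |s| ≤ 1) :
    ∑' k : ℕ, (w k - w (k + 2)) * (U ℝ k).eval s = chebSum s w := by
  have hU := summable_mul_eval_U w hs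
  have hV := summable_shift_mul_eval_U w hs
  have hT := (hasSum_chebSum w hs).summable
  have h1 : ∀ k : ℕ, (if k + 2 = 0 then (1 : ℝ) else 2) * w (k + 2) * (T ℝ ((k + 2 : ℕ) : ℤ)).eval s =
      w (k + 2) * (U ℝ ((k + 2 : ℕ) : ℤ)).eval s - w (k + 2) * (U ℝ k).eval s := by
    intro k
    have h2 : (U ℝ ((k + 2 : ℕ) : ℤ)).eval s = 2 * (T ℝ (k + 2)).eval s + (U ℝ k).eval s := by
      push_cast
      rw [U_eq_two_mul_T_add_U]
      simp
    rw [h2, if_neg (by omega)]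
    push_cast
    ring
  simp_rw [sub_mul]
  rw [hU.tsum_sub hV, chebSum, ← Summable.sum_add_tsum_nat_add 2 hU,
    ← Summable.sum_add_tsum_nat_add 2 hT]
  simp_rw [h1]
  rw [((summable_nat_add_iff 2).2 hU).tsum_sub hV]
  simp [Finset.sum_range_succ]
  ring

/-- If the coefficients satisfy `(k+1) u_{k+1} = c (w_k - w_{k+2})`, then the Chebyshev series of `u`
is a primitive of `2c` times that of `w`, since `T_{k+1}' = (k+1) U_k` and
`U_{k+2} - U_k = 2 T_{k+2}`. -/
lemma hasDerivWithinAt_chebSum {u w : EllOne ν} {c : ℝ}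
    (h : ∀ k : ℕ, ((k : ℝ) + 1) * u (k + 1) = c * (w k - w (k + 2))) {s : ℝ}
    (hs : s ∈ Icc (-1 : ℝ) 1) :
    HasDerivWithinAt (fun s => chebSum s u) (2 * c * chebSum s w) (Icc (-1) 1) s := by
  refine hasDerivWithinAt_Icc_of_Ioo (f' := fun s => 2 * c * chebSum s w) (by norm_num)
    (continuousOn_chebSum u) (continuousOn_const.mul (continuousOn_chebSum w)) (fun s hs => ?_) hs
  have habs : ∀ {y : ℝ}, y ∈ Ioo (-1 : ℝ) 1 → |y| ≤ 1 := fun hy => abs_le.2 ⟨hy.1.le, hy.2.le⟩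
  have hb : Summable fun k : ℕ => 2 * |c| * (|w k| * ((k : ℝ) + 1) +
      |w (k + 2)| * (((k + 2 : ℕ) : ℝ) + 1)) :=
    ((summable_abs_mul_succ w).add ((summable_nat_add_iff 2).2 (summable_abs_mul_succ w))).mul_left _
  have hsum : ∀ {y : ℝ}, y ∈ Ioo (-1 : ℝ) 1 →
      Summable fun k : ℕ => 2 * u (k + 1) * (T ℝ ((k + 1 : ℕ) : ℤ)).eval y := fun {y} hy => by
    have := (summable_nat_add_iff 1).2 ((summable_mul_eval_T u (habs hy)).mul_left 2)
    exact this.congr fun k => by ring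
  have hT : ∀ (k : ℕ) (y : ℝ), HasDerivAt (fun y => 2 * u (k + 1) * (T ℝ ((k + 1 : ℕ) : ℤ)).eval y)
      (2 * (c * (w k - w (k + 2))) * (U ℝ k).eval y) y := by
    intro k y
    have h1 := ((T ℝ ((k + 1 : ℕ) : ℤ)).hasDerivAt y).const_mul (2 * u (k + 1))
    refine h1.congr_deriv ?_
    rw [T_derivative_eq_U, ← h k]
    push_cast
    simp
    ring
  have hder := hasDerivAt_tsum_of_isPreconnected hb isOpen_Ioo isPreconnected_Ioo
    (fun k y _ => hT k y) (fun k y hy => by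
      rw [norm_mul, norm_mul, norm_mul, Real.norm_eq_abs, Real.norm_eq_abs, Real.norm_eq_abs,
        Real.norm_eq_abs, abs_two]
      have h1 := abs_eval_U_le k (habs hy)
      calc 2 * (|c| * |w k - w (k + 2)|) * |(U ℝ k).eval y|
          ≤ 2 * (|c| * (|w k| + |w (k + 2)|)) * ((k : ℝ) + 1) := by
            gcongr
            exact abs_sub _ _
        _ = 2 * |c| * (|w k| * ((k : ℝ) + 1) + |w (k + 2)| * ((k : ℝ) + 1)) := by ring
        _ ≤ _ := by
            push_cast
            gcongr
            linarith) hs (hsum hs) hs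
  have hval : ∑' k : ℕ, 2 * (c * (w k - w (k + 2))) * (U ℝ k).eval s = 2 * c * chebSum s w := by
    rw [← tsum_mp_mul_eval_U w (habs hs), ← tsum_mul_left]
    exact tsum_congr fun k => by ring
  rw [hval] at hder
  refine (hder.const_add (u 0)).congr_of_eventuallyEq ?_
  filter_upwards [isOpen_Ioo.mem_nhds hs] with y hy
  rw [chebSum, (hasSum_chebSum u (habs hy)).summable.tsum_eq_zero_add]
  simp

end ChebDeriv


section Gluing

variable {ν : ℝ} [hν : Fact (1 < ν)] {M : ℕ} (P : Params) (t : Fin (M + 1) → ℝ) (p₁ : Phase)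
  (x : EllFam ν M)

/-- The variable in `[-1, 1]` that parameterizes the `m`-th subinterval. -/
def chebVar (m : Fin M) (s : ℝ) : ℝ := (2 * s - t m.succ - t m.castSucc) / (t m.succ - t m.castSucc)

/-- The rescaled Chebyshev series on the `m`-th subinterval. -/
def piece (m : Fin M) (s : ℝ) : Phase := fun i => chebSum (chebVar t m s) (x m i)

open Classical in
/-- The piecewise Chebyshev series. -/
def glued (s : ℝ) : Phase :=
  if h : ∃ m : Fin M, s ∈ Icc (t m.castSucc) (t m.succ) then piece t x h.choose s else 0

variable {t}

lemma chebVar_mem (ht : StrictMono t) {m : Fin M} {s : ℝ}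
    (hs : s ∈ Icc (t m.castSucc) (t m.succ)) : chebVar t m s ∈ Icc (-1 : ℝ) 1 := by
  have h : 0 < t m.succ - t m.castSucc := sub_pos.2 (ht m.castSucc_lt_succ)
  rw [chebVar, mem_Icc, le_div_iff₀ h, div_le_one h]
  constructor <;> linarith [hs.1, hs.2]

lemma chebVar_left (ht : StrictMono t) (m : Fin M) : chebVar t m (t m.castSucc) = -1 := by
  have h : 0 < t m.succ - t m.castSucc := sub_pos.2 (ht m.castSucc_lt_succ)
  rw [chebVar, div_eq_iff h.ne']; ring

lemma chebVar_right (ht : StrictMono t) (m : Fin M) : chebVar t m (t m.succ) = 1 := by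
  have h : 0 < t m.succ - t m.castSucc := sub_pos.2 (ht m.castSucc_lt_succ)
  rw [chebVar, div_eq_iff h.ne']; ring

variable {x P p₁}

/-- On its own subinterval each piece solves the differential equation: the components of order
`k ≥ 1` of `F = 0`, rescaled from `[-1, 1]`. -/
lemma hasDerivWithinAt_piece (ht : StrictMono t) (hF : F P t p₁ (toC x) = 0) {m : Fin M} {s : ℝ}
    (hs : s ∈ Icc (t m.castSucc) (t m.succ)) :
    HasDerivWithinAt (piece t x m) (field P (piece t x m s)) (Icc (t m.castSucc) (t m.succ)) s := by
  have h : 0 < t m.succ - t m.castSucc := sub_pos.2 (ht m.castSucc_lt_succ)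
  have hmem := chebVar_mem ht hs
  rw [hasDerivWithinAt_pi]
  intro i
  have hco : ∀ k : ℕ, ((k : ℝ) + 1) * x m i (k + 1) = (t m.succ - t m.castSucc) / 4 *
      ((MvPolynomial.aeval (x m) (fieldPoly P i) : EllOne ν) k -
        (MvPolynomial.aeval (x m) (fieldPoly P i) : EllOne ν) (k + 2)) := by
    intro k
    have h1 : F P t p₁ (toC x) m i (k + 1) = 0 := by rw [hF]; rfl
    have h2 := seqField_coe P (x m) i
    have h3 : toC x m = fun j => (x m j).coeff := rfl
    simp only [F, h3, h2] at h1
    linarith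
  have h1 := hasDerivWithinAt_chebSum hco hmem
  have h2 : HasDerivWithinAt (chebVar t m) (2 / (t m.succ - t m.castSucc))
      (Icc (t m.castSucc) (t m.succ)) s := by
    have := (((hasDerivAt_id s).const_mul 2).sub_const (t m.succ)).sub_const (t m.castSucc)
    exact (this.div_const (t m.succ - t m.castSucc)).hasDerivWithinAt.congr_deriv (by simp)
  have h3 := h1.comp s h2 fun y hy => chebVar_mem ht hy
  refine h3.congr_deriv ?_
  have h4 := chebSum_seqField P (x m) (abs_le.2 ⟨hmem.1, hmem.2⟩) i
  rw [seqField_coe] at h4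
  rw [h4]
  have h5 : field P (fun j => chebSum (chebVar t m s) (x m j)) i = field P (piece t x m s) i := rfl
  rw [h5]
  field_simp
  norm_num

lemma piece_left (ht : StrictMono t) (hF : F P t p₁ (toC x) = 0) (m : Fin M) (i : Fin 6) :
    piece t x m (t m.castSucc) i = prevVal p₁ (toC x) m i := by
  have h1 : F P t p₁ (toC x) m i 0 = 0 := by rw [hF]; rfl
  rw [piece, chebVar_left ht, ← leftVal_eq]
  exact sub_eq_zero.1 h1

lemma piece_right (ht : StrictMono t) (m : Fin M) (i : Fin 6) :
    piece t x m (t m.succ) i = rightVal (x m i) := by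
  rw [piece, chebVar_right ht, ← rightVal_eq]

/-- Pieces agree where their subintervals meet, by the components of order zero of `F = 0`. -/
lemma piece_eq_piece (ht : StrictMono t) (hF : F P t p₁ (toC x) = 0) {m n : Fin M} {s : ℝ}
    (hm : s ∈ Icc (t m.castSucc) (t m.succ)) (hn : s ∈ Icc (t n.castSucc) (t n.succ)) :
    piece t x m s = piece t x n s := by
  wlog hlt : m < n generalizing m n
  · rcases (not_lt.1 hlt).eq_or_lt with h | h
    · rw [h]
    · exact (this hn hm h).symm
  have hle : m.succ ≤ n.castSucc := Fin.le_def.2 (by simpa using hlt)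
  have h1 : s = t m.succ := le_antisymm hm.2 ((ht.monotone hle).trans hn.1)
  have h2 : s = t n.castSucc := le_antisymm (hm.2.trans (ht.monotone hle)) hn.1
  have h3 : m.succ = n.castSucc := ht.injective (h1.symm.trans h2)
  have h4 : (m : ℕ) + 1 = n := by simpa using congrArg Fin.val h3
  funext i
  conv_rhs => rw [h2]
  rw [h1, piece_right ht, piece_left ht hF, prevVal, if_neg (by omega)]
  have h5 : (⟨(n : ℕ) - 1, lt_of_le_of_lt (Nat.sub_le _ _) n.isLt⟩ : Fin M) = m :=
    Fin.ext (by simp; omega)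
  rw [h5]; rfl

lemma glued_eq (ht : StrictMono t) (hF : F P t p₁ (toC x) = 0) {m : Fin M} {s : ℝ}
    (hm : s ∈ Icc (t m.castSucc) (t m.succ)) : glued t x s = piece t x m s := by
  have h : ∃ m : Fin M, s ∈ Icc (t m.castSucc) (t m.succ) := ⟨m, hm⟩
  rw [glued, dif_pos h]
  exact piece_eq_piece ht hF h.choose_spec hm

lemma Icc_eq_iUnion (hM : 1 ≤ M) (ht : StrictMono t) :
    Icc (t 0) (t (Fin.last M)) = ⋃ m : Fin M, Icc (t m.castSucc) (t m.succ) := by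
  ext s
  rw [mem_iUnion]
  constructor
  · intro hs
    have hex : ∃ k : ℕ, ∃ h : k < M + 1, s ≤ t ⟨k, h⟩ := ⟨M, by omega, hs.2⟩
    obtain ⟨k, ⟨hk, hle⟩, hmin⟩ : ∃ k, (∃ h : k < M + 1, s ≤ t ⟨k, h⟩) ∧
        ∀ j < k, ¬∃ h : j < M + 1, s ≤ t ⟨j, h⟩ := by
      classical
      exact ⟨Nat.find hex, Nat.find_spec hex, fun j => Nat.find_min hex⟩
    rcases Nat.eq_zero_or_pos k with h0 | h0
    · subst h0
      exact ⟨⟨0, hM⟩, hs.1, hle.trans (ht.monotone (Fin.zero_le _))⟩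
    · refine ⟨⟨k - 1, by omega⟩, ?_, ?_⟩
      · by_contra! hlt
        exact hmin (k - 1) (by omega) ⟨by omega, hlt.le⟩
      · refine hle.trans (le_of_eq (congrArg t (Fin.ext ?_)))
        simp; omega
  · rintro ⟨m, hm⟩
    exact ⟨(ht.monotone (Fin.zero_le _)).trans hm.1, hm.2.trans (ht.monotone (Fin.le_last _))⟩

lemma hasDerivWithinAt_glued (hM : 1 ≤ M) (ht : StrictMono t) (hF : F P t p₁ (toC x) = 0) (s : ℝ) :
    HasDerivWithinAt (glued t x) (field P (glued t x s)) (Icc (t 0) (t (Fin.last M))) s := by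
  rw [Icc_eq_iUnion hM ht]
  refine hasDerivWithinAt_iUnion (fun _ => isClosed_Icc) fun m hm => ?_
  rw [glued_eq ht hF hm]
  exact (hasDerivWithinAt_piece ht hF hm).congr (fun y hy => glued_eq ht hF hy) (glued_eq ht hF hm)

lemma isPiecewiseCheb_glued (ht : StrictMono t) (hF : F P t p₁ (toC x) = 0) :
    IsPiecewiseCheb t (toC x) (glued t x) := by
  intro m s hs i
  have hmem := chebVar_mem ht hs
  rw [glued_eq ht hF hs]
  exact hasSum_chebSum (x m i) (abs_le.2 ⟨hmem.1, hmem.2⟩)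

lemma glued_zero (hM : 1 ≤ M) (ht : StrictMono t) (hF : F P t p₁ (toC x) = 0) :
    glued t x (t 0) = p₁ := by
  let m : Fin M := ⟨0, hM⟩
  have h0 : t 0 = t m.castSucc := rfl
  have hm : t 0 ∈ Icc (t m.castSucc) (t m.succ) := ⟨le_rfl, ht.monotone (Fin.zero_le _)⟩
  rw [glued_eq ht hF hm]
  funext i
  rw [h0, piece_left ht hF, prevVal, if_pos rfl]

end Gluing


/-! ### The gradient system and the extended system -/

section Extended

variable (P : Params)

/-- The exponent of the `j`-th term of the potential. -/
def expo (j : Fin 4) (x y : ℝ) : ℝ :=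
  P.a j * (x - P.x₀ j) ^ 2 + P.b j * (x - P.x₀ j) * (y - P.y₀ j) + P.c j * (y - P.y₀ j) ^ 2

lemma psi_eq (j : Fin 4) (q : Plane) : psi P j q = P.α j * Real.exp (expo P j (q 0) (q 1)) := rfl

/-- The partial derivative of `expo P j` with respect to `x`. -/
def lin₁ (j : Fin 4) (x y : ℝ) : ℝ := 2 * P.a j * x + P.b j * y - P.w₁ j

/-- The partial derivative of `expo P j` with respect to `y`. -/
def lin₂ (j : Fin 4) (x y : ℝ) : ℝ := P.b j * x + 2 * P.c j * y - P.w₂ j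

lemma field_zero (X : Phase) : field P X 0 = -∑ i : Fin 4, lin₁ P i (X 0) (X 1) * X i.succ.succ := by
  simp [field, fieldOver, lin₁]

lemma field_one (X : Phase) : field P X 1 = -∑ i : Fin 4, lin₂ P i (X 0) (X 1) * X i.succ.succ := by
  simp [field, fieldOver, lin₂]

lemma field_succ_succ (X : Phase) (j : Fin 4) : field P X j.succ.succ =
    (lin₁ P j (X 0) (X 1) * field P X 0 + lin₂ P j (X 0) (X 1) * field P X 1) * X j.succ.succ := by
  rw [field_zero, field_one]
  simp only [field, fieldOver, Matrix.cons_val_succ, lin₁, lin₂, smul_eq_mul, mul_one]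
  ring

lemma hasDerivWithinAt_expo {x y : ℝ → ℝ} {x' y' : ℝ} {S : Set ℝ} {s : ℝ} (j : Fin 4)
    (hx : HasDerivWithinAt x x' S s) (hy : HasDerivWithinAt y y' S s) :
    HasDerivWithinAt (fun s => expo P j (x s) (y s))
      (lin₁ P j (x s) (y s) * x' + lin₂ P j (x s) (y s) * y') S s := by
  have h1 := hx.sub_const (P.x₀ j)
  have h2 := hy.sub_const (P.y₀ j)
  have h := (((h1.pow 2).const_mul (P.a j)).add ((h1.const_mul (P.b j)).mul h2)).add
    ((h2.pow 2).const_mul (P.c j))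
  refine h.congr_deriv ?_
  simp only [lin₁, lin₂, Params.w₁, Params.w₂]
  push_cast
  ring

/-- The quantity `z⁽ʲ⁾ exp(-E_j(x, y))`, conserved by the extended vector field. -/
def conserved (j : Fin 4) (X : Phase) : ℝ := X j.succ.succ * Real.exp (-expo P j (X 0) (X 1))

lemma hasDerivWithinAt_conserved {Y : ℝ → Phase} {S : Set ℝ} {s : ℝ} (j : Fin 4)
    (hY : HasDerivWithinAt Y (field P (Y s)) S s) :
    HasDerivWithinAt (fun s => conserved P j (Y s)) 0 S s := by
  rw [hasDerivWithinAt_pi] at hY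
  have h1 := hasDerivWithinAt_expo P j (hY 0) (hY 1)
  have h2 := (hY j.succ.succ).mul h1.neg.exp
  refine h2.congr_deriv ?_
  rw [field_succ_succ]
  ring

lemma conserved_eq {Y : ℝ → Phase} {S : Set ℝ} (hS : Convex ℝ S)
    (hY : ∀ s ∈ S, HasDerivWithinAt Y (field P (Y s)) S s) (j : Fin 4) {r s : ℝ} (hr : r ∈ S)
    (hs : s ∈ S) : conserved P j (Y r) = conserved P j (Y s) := by
  have := hS.norm_image_sub_le_of_norm_hasDerivWithin_le (C := 0)
    (fun s hs => hasDerivWithinAt_conserved P j (hY s hs)) (fun s _ => by simp) hs hr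
  rw [zero_mul, norm_le_zero_iff, sub_eq_zero] at this
  exact this

lemma conserved_lift (j : Fin 4) (q : Plane) : conserved P j (lift P q) = P.α j := by
  have h0 : lift P q 0 = q 0 := rfl
  have h1 : lift P q 1 = q 1 := rfl
  have h2 : lift P q j.succ.succ = psi P j q := rfl
  rw [conserved, h0, h1, h2, psi_eq, mul_assoc, ← Real.exp_add, add_neg_cancel, Real.exp_zero,
    mul_one]

lemma proj_lift (q : Plane) : proj (lift P q) = q := by
  ext i
  fin_cases i <;> rfl

lemma lift_proj_eq {X : Phase} (h : ∀ j, conserved P j X = P.α j) : lift P (proj X) = X := by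
  funext i
  refine Fin.cases rfl (fun i => Fin.cases rfl (fun j => ?_) i) i
  have h2 : lift P (proj X) j.succ.succ = P.α j * Real.exp (expo P j (X 0) (X 1)) := rfl
  rw [h2, ← h j, conserved, mul_assoc, ← Real.exp_add, neg_add_cancel, Real.exp_zero, mul_one]

lemma hasFDerivAt_psi (j : Fin 4) (q : Plane) : HasFDerivAt (psi P j)
    (psi P j q • (lin₁ P j (q 0) (q 1) • (EuclideanSpace.proj 0 : Plane →L[ℝ] ℝ) +
      lin₂ P j (q 0) (q 1) • (EuclideanSpace.proj 1 : Plane →L[ℝ] ℝ))) q := by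
  have h1 := (EuclideanSpace.proj 0 : Plane →L[ℝ] ℝ).hasFDerivAt (x := q) |>.sub_const (P.x₀ j)
  have h2 := (EuclideanSpace.proj 1 : Plane →L[ℝ] ℝ).hasFDerivAt (x := q) |>.sub_const (P.y₀ j)
  have h := (((((h1.pow 2).const_mul (P.a j)).add ((h1.const_mul (P.b j)).mul h2)).add
    ((h2.pow 2).const_mul (P.c j))).exp).const_mul (P.α j)
  refine h.congr_fderiv ?_
  ext r
  simp [psi_eq, expo, lin₁, lin₂, Params.w₁, Params.w₂]
  ring

lemma hasFDerivAt_V (q : Plane) : HasFDerivAt (V P)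
    (∑ j, psi P j q • (lin₁ P j (q 0) (q 1) • (EuclideanSpace.proj 0 : Plane →L[ℝ] ℝ) +
      lin₂ P j (q 0) (q 1) • (EuclideanSpace.proj 1 : Plane →L[ℝ] ℝ))) q :=
  HasFDerivAt.fun_sum fun j _ => hasFDerivAt_psi P j q

lemma hasGradientAt_V (q : Plane) : HasGradientAt (V P) (-proj (field P (lift P q))) q := by
  rw [hasGradientAt_iff_hasFDerivAt]
  refine (hasFDerivAt_V P q).congr_fderiv ?_
  have h0 : field P (lift P q) 0 = -∑ i : Fin 4, lin₁ P i (q 0) (q 1) * psi P i q :=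
    field_zero P (lift P q)
  have h1 : field P (lift P q) 1 = -∑ i : Fin 4, lin₂ P i (q 0) (q 1) * psi P i q :=
    field_one P (lift P q)
  ext r
  rw [InnerProductSpace.toDual_apply_apply, PiLp.inner_apply, Fin.sum_univ_two]
  simp only [proj, h0, h1]
  simp [Finset.mul_sum, Finset.sum_add_distrib]
  congr 1 <;> exact Finset.sum_congr rfl fun j _ => by ring

lemma negGrad_eq (q : Plane) : negGrad P q = proj (field P (lift P q)) := by
  rw [negGrad, (hasGradientAt_V P q).gradient, neg_neg]

/-- The projection to the plane, as a continuous linear map. -/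
def projL : Phase →L[ℝ] Plane := LinearMap.toContinuousLinearMap
  { toFun := proj
    map_add' := fun X Y => by ext i; fin_cases i <;> simp [proj]
    map_smul' := fun c X => by ext i; fin_cases i <;> simp [proj] }

lemma projL_apply (X : Phase) : projL X = proj X := rfl

/-- Where the conserved quantities have the values that they take on the graph of `ψ`, solutions of
the extended system project to solutions of the gradient system. -/
lemma hasDerivWithinAt_proj {Y : ℝ → Phase} {S : Set ℝ} {s : ℝ}
    (hY : HasDerivWithinAt Y (field P (Y s)) S s) (hc : ∀ j, conserved P j (Y s) = P.α j) :
    HasDerivWithinAt (fun s => proj (Y s)) (negGrad P (proj (Y s))) S s := by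
  rw [negGrad_eq, lift_proj_eq P hc]
  exact projL.hasFDerivAt.comp_hasDerivWithinAt s hY

end Extended

/-! ### The unstable manifold -/

section Unstable

variable {P : Params} {q₀ : Plane} {lam : ℝ} {v : Phase} {γ : ℝ} {N : ℕ} {ηp : Fin 6 → ℝ}
  {phat : Fin N → Phase} {rbar : ℝ} {p : ℕ → Phase}

lemma norm_powerSum_sub_le (hs : ∀ i, Summable fun n => |p n i|) {θ : ℝ} (h0 : 0 ≤ θ) (h1 : θ ≤ 1) :
    ‖powerSum p θ - p 0‖ ≤ (∑ i, ∑' n, |p n i|) * θ := by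
  have hn : ∀ i, 0 ≤ ∑' n, |p n i| := fun i => tsum_nonneg fun n => abs_nonneg _
  rw [pi_norm_le_iff_of_nonneg (mul_nonneg (Finset.sum_nonneg fun i _ => hn i) h0)]
  intro i
  have hb : ∀ n, |p n i * θ ^ n| ≤ |p n i| := fun n => by
    rw [abs_mul, abs_of_nonneg (pow_nonneg h0 n)]
    exact mul_le_of_le_one_right (abs_nonneg _) (pow_le_one₀ h0 h1)
  have hsum : Summable fun n => p n i * θ ^ n := Summable.of_norm_bounded (hs i) hb
  have h2 : (powerSum p θ - p 0) i = ∑' n, p (n + 1) i * θ ^ (n + 1) := by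
    rw [Pi.sub_apply, powerSum, hsum.tsum_eq_zero_add]
    simp
  have h3 := (summable_nat_add_iff 1).2 (hs i)
  rw [h2]
  calc ‖∑' n, p (n + 1) i * θ ^ (n + 1)‖ ≤ ∑' n, |p (n + 1) i| * θ := by
        refine tsum_of_norm_bounded (h3.mul_right θ).hasSum fun n => ?_
        rw [Real.norm_eq_abs, abs_mul, abs_of_nonneg (pow_nonneg h0 _), pow_succ]
        exact mul_le_mul_of_nonneg_left (mul_le_of_le_one_left h0 (pow_le_one₀ h0 h1)) (abs_nonneg _)
    _ = (∑' n, |p (n + 1) i|) * θ := tsum_mul_right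
    _ ≤ (∑ i, ∑' n, |p n i|) * θ := by
        refine mul_le_mul_of_nonneg_right ?_ h0
        refine le_trans ?_ (Finset.single_le_sum (f := fun i => ∑' n, |p n i|)
          (fun i _ => hn i) (Finset.mem_univ i))
        rw [(hs i).tsum_eq_zero_add]
        exact le_add_of_nonneg_left (abs_nonneg _)

lemma hasDerivWithinAt_powerSum_exp (hp : IsValidatedParam P q₀ lam v γ ηp phat rbar p)
    (hlam : 0 < lam) {s : ℝ} (hs : s ≤ 0) :
    HasDerivWithinAt (fun s => powerSum p (Real.exp (lam * s)))
      (field P (powerSum p (Real.exp (lam * s)))) (Iic 0) s := by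
  have hm : MapsTo (fun s => Real.exp (lam * s)) (Iic 0) (Icc (-1) 1) := fun s hs =>
    ⟨by linarith [Real.exp_pos (lam * s)], Real.exp_le_one_iff.2 (mul_nonpos_of_nonneg_of_nonpos hlam.le hs)⟩
  obtain ⟨d, hd, hf⟩ := hp.invariance (Real.exp (lam * s)) (hm hs)
  have h1 : HasDerivWithinAt (fun s => Real.exp (lam * s)) (lam * Real.exp (lam * s)) (Iic 0) s := by
    have := ((hasDerivAt_id s).const_mul lam).exp.hasDerivWithinAt (s := Iic 0)
    refine this.congr_deriv ?_
    simp [mul_comm]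
  rw [← hf]
  exact hd.scomp s h1 hm

/-- The backward orbit through `p(1)`. -/
def backOrbit (lam : ℝ) (p : ℕ → Phase) (s : ℝ) : Phase := powerSum p (Real.exp (lam * s))

lemma backOrbit_zero : backOrbit lam p 0 = powerSum p 1 := by simp [backOrbit]

lemma norm_backOrbit_sub_le (hp : IsValidatedParam P q₀ lam v γ ηp phat rbar p) (hlam : 0 < lam)
    {s : ℝ} (hs : s ≤ 0) :
    ‖backOrbit lam p s - lift P q₀‖ ≤ (∑ i, ∑' n, |p n i|) * Real.exp (lam * s) := by
  rw [← hp.coeff_zero]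
  exact norm_powerSum_sub_le hp.summable (Real.exp_pos _).le
    (Real.exp_le_one_iff.2 (mul_nonpos_of_nonneg_of_nonpos hlam.le hs))

lemma tendsto_backOrbit (hp : IsValidatedParam P q₀ lam v γ ηp phat rbar p) (hlam : 0 < lam) :
    Tendsto (backOrbit lam p) atBot (𝓝 (lift P q₀)) := by
  rw [tendsto_iff_norm_sub_tendsto_zero]
  have h1 : Tendsto (fun s => (∑ i, ∑' n, |p n i|) * Real.exp (lam * s)) atBot (𝓝 0) := by
    have := (Real.tendsto_exp_atBot.comp (tendsto_id.const_mul_atBot hlam)).const_mul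
      (∑ i, ∑' n, |p n i|)
    simpa using this
  refine squeeze_zero' (Eventually.of_forall fun s => norm_nonneg _) ?_ h1
  filter_upwards [eventually_le_atBot 0] with s hs
  exact norm_backOrbit_sub_le hp hlam hs

lemma powerSum_one_mem_unstableManifold (hp : IsValidatedParam P q₀ lam v γ ηp phat rbar p)
    (hlam : 0 < lam) : powerSum p 1 ∈ unstableManifold (field P) (lift P q₀) :=
  ⟨backOrbit lam p, backOrbit_zero, fun _ hs => hasDerivWithinAt_powerSum_exp hp hlam hs,
    _, lam, hlam, fun _ hs => norm_backOrbit_sub_le hp hlam hs⟩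

lemma continuous_conserved (j : Fin 4) : Continuous (conserved P j) := by
  unfold conserved expo
  fun_prop

/-- The conserved quantities are constant along the backward orbit and continuous at its limit, the
lift of the saddle. -/
lemma conserved_backOrbit (hp : IsValidatedParam P q₀ lam v γ ηp phat rbar p) (hlam : 0 < lam)
    {s : ℝ} (hs : s ≤ 0) (j : Fin 4) : conserved P j (backOrbit lam p s) = P.α j := by
  have h1 : Tendsto (fun s => conserved P j (backOrbit lam p s)) atBot (𝓝 (P.α j)) := by
    rw [← conserved_lift P j q₀]
    exact ((continuous_conserved j).tendsto _).comp (tendsto_backOrbit hp hlam)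
  refine tendsto_nhds_unique (tendsto_const_nhds.congr' ?_) h1
  filter_upwards [eventually_le_atBot 0] with r hr
  exact conserved_eq P (convex_Iic 0) (fun s hs => hasDerivWithinAt_powerSum_exp hp hlam hs) j hs hr

end Unstable


/-! ### Trapping regions -/

section Global

variable {E : Type*} [NormedAddCommGroup E] [NormedSpace ℝ E] [CompleteSpace E]

/-- A bounded Lipschitz vector field has forward solutions for all times. -/
lemma exists_forward_solution {G : E → E} {K L : NNReal} (hG : LipschitzWith K G)
    (hL : ∀ x, ‖G x‖ ≤ L) (x₀ : E) :
    ∃ y : ℝ → E, y 0 = x₀ ∧ ∀ s ∈ Ici (0 : ℝ), HasDerivWithinAt y (G (y s)) (Ici 0) s := by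
  have hex : ∀ n : ℕ, ∃ α : ℝ → E, α 0 = x₀ ∧
      ∀ s ∈ Icc (0 : ℝ) n, HasDerivWithinAt α (G (α s)) (Icc (0 : ℝ) n) s := by
    intro n
    have hPL : IsPicardLindelof (fun _ => G) (tmin := 0) (tmax := n)
        ⟨0, le_rfl, Nat.cast_nonneg n⟩ x₀ (L * n) 0 L K :=
      { lipschitzOnWith := fun _ _ => hG.lipschitzOnWith
        continuousOn := fun _ _ => continuousOn_const
        norm_le := fun _ _ x _ => hL x
        mul_max_le := by simp }
    exact hPL.exists_eq_forall_mem_Icc_hasDerivWithinAt₀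
  choose α hα0 hα using hex
  have hle : ∀ {m n : ℕ}, m ≤ n → EqOn (α m) (α n) (Icc (0 : ℝ) m) := by
    intro m n hmn
    have hmn' : (m : ℝ) ≤ n := by exact_mod_cast hmn
    have hsub : Icc (0 : ℝ) m ⊆ Icc (0 : ℝ) n := Icc_subset_Icc_right hmn'
    refine ODE_solution_unique (v := fun _ => G) (fun _ => hG)
      (fun s hs => (hα m s hs).continuousWithinAt) (fun s hs => ?_)
      (fun s hs => ((hα n s (hsub hs)).continuousWithinAt).mono hsub) (fun s hs => ?_)
      ((hα0 m).trans (hα0 n).symm)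
    · exact (hα m s ⟨hs.1, hs.2.le⟩).mono_of_mem_nhdsWithin (Icc_mem_nhdsGE_of_mem hs)
    · exact (hα n s ⟨hs.1, hs.2.le.trans hmn'⟩).mono_of_mem_nhdsWithin
        (Icc_mem_nhdsGE_of_mem ⟨hs.1, hs.2.trans_le hmn'⟩)
  have heq : ∀ {m n : ℕ} {s : ℝ}, 0 ≤ s → s ≤ m → s ≤ n → α m s = α n s := by
    intro m n s h0 hm hn
    rcases le_total m n with h | h
    · exact hle h ⟨h0, hm⟩
    · exact (hle h ⟨h0, hn⟩).symm
  have hfl : ∀ s : ℝ, s ≤ ((⌊s⌋₊ + 1 : ℕ) : ℝ) := fun s => by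
    push_cast; exact (Nat.lt_floor_add_one s).le
  refine ⟨fun s => α (⌊s⌋₊ + 1) s, hα0 _, fun s hs => ?_⟩
  have hlt : s < ((⌊s⌋₊ + 1 : ℕ) : ℝ) := by push_cast; exact Nat.lt_floor_add_one s
  have h1 := (hα (⌊s⌋₊ + 1) s ⟨hs, hlt.le⟩).congr (f₁ := fun s => α (⌊s⌋₊ + 1) s)
    (fun r hr => heq hr.1 (hfl r) hr.2) rfl
  refine h1.mono_of_mem_nhdsWithin ?_
  filter_upwards [self_mem_nhdsWithin, mem_nhdsWithin_of_mem_nhds (Iio_mem_nhds hlt)] with r h0 h1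
  exact ⟨h0, le_of_lt h1⟩

end Global

section Trapping

/-- The nearest point of the square with centre `c` and half side `h`. -/
def clamp (c : Plane) (h : ℝ) (q : Plane) : Plane :=
  WithLp.toLp 2 fun i => max (c i - h) (min (c i + h) (q i))

/-- The closed square with centre `c` and half side `h`. -/
def square (c : Plane) (h : ℝ) : Set Plane := {q | ∀ i, |q i - c i| ≤ h}

variable {c : Plane} {h : ℝ}

lemma clamp_mem (hh : 0 < h) (q : Plane) : clamp c h q ∈ square c h := by
  intro i
  have h1 : clamp c h q i = max (c i - h) (min (c i + h) (q i)) := rfl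
  rw [h1, abs_le]
  have h2 : max (c i - h) (min (c i + h) (q i)) ≤ c i + h :=
    max_le (by linarith) (min_le_left _ _)
  have h3 := le_max_left (c i - h) (min (c i + h) (q i))
  constructor <;> linarith

lemma clamp_eq_self {q : Plane} (hq : q ∈ square c h) : clamp c h q = q := by
  ext i
  have h1 := abs_le.1 (hq i)
  have h2 : clamp c h q i = max (c i - h) (min (c i + h) (q i)) := rfl
  rw [h2, min_eq_right (by linarith), max_eq_right (by linarith)]

lemma clamp_lipschitz : LipschitzWith 1 (clamp c h) := by
  refine LipschitzWith.of_dist_le_mul fun p q => ?_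
  rw [NNReal.coe_one, one_mul, EuclideanSpace.dist_eq, EuclideanSpace.dist_eq]
  refine Real.sqrt_le_sqrt (Finset.sum_le_sum fun i _ => ?_)
  refine pow_le_pow_left₀ dist_nonneg ?_ 2
  have h1 : ∀ q, clamp c h q i = max (c i - h) (min (c i + h) (q i)) := fun _ => rfl
  rw [h1, h1, Real.dist_eq, Real.dist_eq]
  have h2 := abs_max_sub_max_le_max (c i - h) (min (c i + h) (p i)) (c i - h) (min (c i + h) (q i))
  have h3 := abs_min_sub_min_le_max (c i + h) (p i) (c i + h) (q i)
  rw [sub_self, abs_zero] at h2 h3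
  exact (h2.trans (max_le (abs_nonneg _) le_rfl)).trans (h3.trans (max_le (abs_nonneg _) le_rfl))

lemma isCompact_square : IsCompact (square c h) := by
  rcases lt_or_ge h 0 with hh | hh
  · have : square c h = ∅ := by
      ext q
      simp only [square, mem_ofPred_eq, mem_empty_iff_false, iff_false, not_forall, not_le]
      exact ⟨0, hh.trans_le (abs_nonneg _)⟩
    rw [this]; exact isCompact_empty
  · have h1 : square c h = (EuclideanSpace.equiv (Fin 2) ℝ).toHomeomorph ⁻¹'
        Metric.closedBall (EuclideanSpace.equiv (Fin 2) ℝ c) h := by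
      ext q
      simp only [square, mem_ofPred_eq, mem_preimage, Metric.mem_closedBall, dist_pi_le_iff hh,
        Real.dist_eq]
      rfl
    rw [h1, Homeomorph.isCompact_preimage]
    exact isCompact_closedBall _ _

variable (P : Params)

lemma contDiff_negGrad : ContDiff ℝ 1 (negGrad P) := by
  have h0 : ∀ i, ContDiff ℝ 1 fun q : Plane => q i := fun i =>
    (EuclideanSpace.proj i : Plane →L[ℝ] ℝ).contDiff
  have hpsi : ∀ j, ContDiff ℝ 1 (psi P j) := fun j => by
    have := h0 0
    have := h0 1
    unfold psi
    fun_prop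
  rw [contDiff_euclidean]
  intro i
  have e0 : (fun q => negGrad P q 0) = fun q => -∑ i : Fin 4, lin₁ P i (q 0) (q 1) * psi P i q := by
    funext q
    rw [negGrad_eq]
    exact field_zero P (lift P q)
  have e1 : (fun q => negGrad P q 1) = fun q => -∑ i : Fin 4, lin₂ P i (q 0) (q 1) * psi P i q := by
    funext q
    rw [negGrad_eq]
    exact field_one P (lift P q)
  have hx := h0 0
  have hy := h0 1
  fin_cases i
  · refine e0 ▸ (ContDiff.sum fun j _ => ContDiff.mul ?_ (hpsi j)).neg
    unfold lin₁
    fun_prop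
  · refine e1 ▸ (ContDiff.sum fun j _ => ContDiff.mul ?_ (hpsi j)).neg
    unfold lin₂
    fun_prop

lemma continuous_V : Continuous (V P) :=
  continuous_iff_continuousAt.2 fun q => (hasFDerivAt_V P q).continuousAt

variable {P}

/-- The gradient inequality for a convex function, along the segment from `q` to `q'`. -/
lemma inner_negGrad_le {U : Set Plane} (hU : ConvexOn ℝ U (V P)) {q q' : Plane} (hq : q ∈ U)
    (hq' : q' ∈ U) : inner ℝ (q - q') (negGrad P q) ≤ V P q' - V P q := by
  have h1 := hU.comp_affineMap (AffineMap.lineMap q q' : ℝ →ᵃ[ℝ] Plane)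
  have hgrad : HasFDerivAt (V P) (InnerProductSpace.toDual ℝ Plane (-negGrad P q)) q := by
    rw [negGrad_eq]
    exact hasGradientAt_iff_hasFDerivAt.1 (hasGradientAt_V P q)
  have h2 : HasDerivAt (V P ∘ (AffineMap.lineMap q q' : ℝ →ᵃ[ℝ] Plane))
      (inner ℝ (-negGrad P q) (q' - q)) 0 := by
    have h3 : HasDerivAt (AffineMap.lineMap q q' : ℝ →ᵃ[ℝ] Plane) (q' - q) (0 : ℝ) :=
      AffineMap.hasDerivAt_lineMap
    have h4 : HasFDerivAt (V P) (InnerProductSpace.toDual ℝ Plane (-negGrad P q))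
        ((AffineMap.lineMap q q' : ℝ →ᵃ[ℝ] Plane) 0) := by
      rwa [AffineMap.lineMap_apply_zero]
    exact h4.comp_hasDerivAt 0 h3
  have h5 := h1.le_slope_of_hasDerivAt (x := 0) (y := 1) (by simpa using hq) (by simpa using hq')
    one_pos h2
  rw [slope_def_field] at h5
  simp only [Function.comp_apply, AffineMap.lineMap_apply_one, AffineMap.lineMap_apply_zero, sub_zero,
    div_one] at h5
  rw [inner_neg_left, ← inner_neg_right, neg_sub, real_inner_comm] at h5
  exact h5

/-- Solutions that enter a trapping region stay there for all later times. -/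
lemma exists_trapped_solution (hh : 0 < h) (hconv : Convex ℝ (square c h))
    (hb : ∀ q ∈ square c h, ∀ i, (q i = c i + h → negGrad P q i < 0) ∧
      (q i = c i - h → 0 < negGrad P q i)) {q : Plane} (hq : q ∈ square c h) :
    ∃ y : ℝ → Plane, y 0 = q ∧ (∀ s ∈ Ici (0 : ℝ), y s ∈ square c h) ∧
      ∀ s ∈ Ici (0 : ℝ), HasDerivWithinAt y (negGrad P (y s)) (Ici 0) s := by
  obtain ⟨K, hK⟩ := (contDiff_negGrad P).contDiffOn.exists_lipschitzOnWith one_ne_zero hconv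
    isCompact_square
  obtain ⟨L, hL⟩ := isCompact_square.exists_bound_of_continuousOn
    (contDiff_negGrad P).continuous.continuousOn
  have hlip : LipschitzWith K fun q => negGrad P (clamp c h q) := by
    have h1 := hK.comp (clamp_lipschitz (c := c) (h := h)).lipschitzOnWith (s := univ)
      fun q _ => clamp_mem hh q
    rw [mul_one, lipschitzOnWith_univ] at h1
    exact h1
  obtain ⟨y, hy0, hy⟩ := exists_forward_solution (L := L.toNNReal) hlip
    (fun x => (hL _ (clamp_mem hh x)).trans (Real.le_coe_toNNReal L)) q
  have hyi : ∀ i, ∀ s ∈ Ici (0 : ℝ),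
      HasDerivWithinAt (fun s => y s i) (negGrad P (clamp c h (y s)) i) (Ici 0) s := fun i s hs =>
    (EuclideanSpace.proj i : Plane →L[ℝ] ℝ).hasFDerivAt.comp_hasDerivWithinAt s (hy s hs)
  have hci : ∀ i q, clamp c h q i = max (c i - h) (min (c i + h) (q i)) := fun _ _ => rfl
  have hmem : ∀ s ∈ Ici (0 : ℝ), y s ∈ square c h := by
    intro s hs i
    have hsub : ∀ r ∈ Ico (0 : ℝ) s, Ici r ⊆ Ici 0 := fun r hr => Ici_subset_Ici.2 hr.1
    have h0 := abs_le.1 (hq i)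
    have hup := image_le_of_deriv_right_lt_deriv_boundary (f := fun s => y s i)
      (f' := fun s => negGrad P (clamp c h (y s)) i) (a := 0) (b := s)
      (fun r hr => ((hyi i r hr.1).continuousWithinAt).mono Icc_subset_Ici_self)
      (fun r hr => (hyi i r hr.1).mono (hsub r hr)) (B := fun _ => c i + h) (B' := fun _ => 0)
      (by simp only [hy0]; linarith) (fun r => hasDerivAt_const r _) (fun r hr hE => by
        refine ((hb _ (clamp_mem hh (y r)) i).1 ?_)
        rw [hci, hE, min_self, max_eq_right (by linarith)])
    have hlo := image_le_of_deriv_right_lt_deriv_boundary (f := fun s => -y s i)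
      (f' := fun s => -negGrad P (clamp c h (y s)) i) (a := 0) (b := s)
      (fun r hr => ((hyi i r hr.1).neg.continuousWithinAt).mono Icc_subset_Ici_self)
      (fun r hr => (hyi i r hr.1).neg.mono (hsub r hr)) (B := fun _ => -(c i - h)) (B' := fun _ => 0)
      (by simp only [hy0]; linarith) (fun r => hasDerivAt_const r _) (fun r hr hE => by
        have hE' : y r i = c i - h := neg_injective hE
        have := (hb _ (clamp_mem hh (y r)) i).2 (by
          rw [hci, hE', min_eq_right (by linarith), max_self])
        linarith)
    have h1 := hup (right_mem_Icc.2 hs)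
    have h2 := hlo (right_mem_Icc.2 hs)
    rw [abs_le]
    constructor <;> linarith
  refine ⟨y, hy0, hmem, fun s hs => ?_⟩
  have h1 := hy s hs
  rwa [clamp_eq_self (hmem s hs)] at h1

/-- In a compact set on which `V` is strictly convex, the squared distance to the minimizer `q₁` is a
strict Lyapunov function: by the gradient inequality its derivative is at most
`-2 (V - V(q₁))`. -/
lemma tendsto_of_trapped {U : Set Plane} (hU : IsCompact U) (hconv : StrictConvexOn ℝ U (V P))
    {q₁ : Plane} (hq₁ : q₁ ∈ U) (hmin : IsLocalMin (V P) q₁) {y : ℝ → Plane}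
    (hyU : ∀ s ∈ Ici (0 : ℝ), y s ∈ U)
    (hy : ∀ s ∈ Ici (0 : ℝ), HasDerivWithinAt y (negGrad P (y s)) (Ici 0) s) :
    Tendsto y atTop (𝓝 q₁) := by
  have hglob : IsMinOn (V P) U q₁ :=
    IsMinOn.of_isLocalMinOn_of_convexOn hq₁ (hmin.on U) hconv.convexOn
  have hφ : ∀ s ∈ Ici (0 : ℝ), HasDerivWithinAt (fun s => ‖y s - q₁‖ ^ 2)
      (2 * inner ℝ (y s - q₁) (negGrad P (y s))) (Ici 0) s := fun s hs =>
    ((hy s hs).sub_const q₁).norm_sq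
  have hder : ∀ s ∈ Ici (0 : ℝ), inner ℝ (y s - q₁) (negGrad P (y s)) ≤ V P q₁ - V P (y s) :=
    fun s hs => inner_negGrad_le hconv.convexOn (hyU s hs) hq₁
  have hanti : ∀ w : ℝ, ∀ S ⊆ Ici (0 : ℝ), Convex ℝ S → (∀ s ∈ S, w ≤ V P (y s) - V P q₁) →
      AntitoneOn (fun s => ‖y s - q₁‖ ^ 2 + 2 * w * s) S := by
    intro w S hS hSc hw
    have hd : ∀ s ∈ S, HasDerivWithinAt (fun s => ‖y s - q₁‖ ^ 2 + 2 * w * s)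
        (2 * inner ℝ (y s - q₁) (negGrad P (y s)) + 2 * w) S s := fun s hs => by
      have h1 := ((hφ s (hS hs)).mono hS).add
        ((hasDerivAt_id s).const_mul (2 * w)).hasDerivWithinAt
      exact h1.congr_deriv (by simp)
    refine antitoneOn_of_hasDerivWithinAt_nonpos hSc (fun s hs => (hd s hs).continuousWithinAt)
      (fun s hs => (hd s (interior_subset hs)).mono interior_subset) fun s hs => ?_
    have h1 := hder s (hS (interior_subset hs))
    have h2 := hw s (interior_subset hs)
    linarith
  have hmono : AntitoneOn (fun s => ‖y s - q₁‖ ^ 2) (Ici (0 : ℝ)) := by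
    have := hanti 0 (Ici 0) le_rfl (convex_Ici 0) fun s hs => sub_nonneg.2 (hglob (hyU s hs))
    simpa using this
  have hsmall : ∀ ε > 0, ∃ T ≥ (0 : ℝ), ‖y T - q₁‖ ^ 2 < ε := by
    intro ε hε
    by_contra! hge
    obtain ⟨q, hq, hqmin⟩ := IsCompact.exists_isMinOn (s := U ∩ {q | ε ≤ ‖q - q₁‖ ^ 2})
      (hU.inter_right (isClosed_le continuous_const (by fun_prop)))
      ⟨y 0, hyU 0 self_mem_Ici, hge 0 le_rfl⟩ (continuous_V P).continuousOn
    have hw : 0 < V P q - V P q₁ := by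
      refine sub_pos.2 (lt_of_le_of_ne (hglob hq.1) fun he => ?_)
      have h1 : IsMinOn (V P) U q := fun r hr => he ▸ hglob hr
      have h2 := hconv.eq_of_isMinOn h1 hglob hq.1 hq₁
      have h3 : ε ≤ ‖q - q₁‖ ^ 2 := hq.2
      rw [h2, sub_self, norm_zero] at h3
      norm_num at h3
      linarith
    set w := V P q - V P q₁
    have h1 := hanti w (Ici 0) le_rfl (convex_Ici 0) fun s hs =>
      sub_le_sub_right (hqmin ⟨hyU s hs, hge s hs⟩) _
    have hT : 0 ≤ ‖y 0 - q₁‖ ^ 2 / (2 * w) := by positivity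
    have h2 := h1 self_mem_Ici (mem_Ici.2 hT) hT
    have h3 := hge _ hT
    simp only [mul_zero, add_zero] at h2
    rw [mul_div_cancel₀ _ (by positivity)] at h2
    linarith
  rw [Metric.tendsto_atTop]
  intro ε hε
  obtain ⟨T, hT, hTε⟩ := hsmall (ε ^ 2) (by positivity)
  refine ⟨T, fun s hs => ?_⟩
  have h1 : ‖y s - q₁‖ ^ 2 ≤ ‖y T - q₁‖ ^ 2 := hmono hT (hT.trans hs) hs
  rw [dist_eq_norm]
  exact lt_of_pow_lt_pow_left₀ 2 hε.le (h1.trans_lt hTε)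

end Trapping


/-! ### The connecting orbit -/

section Connection

variable {P : Params} {q₀ q₁ : Plane}

open Classical in
/-- Solutions on `(-∞, 0]`, `[0, τ]` and `[τ, ∞)` that agree at the end points form a solution on the
whole line. -/
lemma exists_isConnectingOrbit {τ : ℝ} (hτ : 0 < τ) {y₁ y₂ y₃ : ℝ → Plane}
    (h₁ : ∀ s ∈ Iic (0 : ℝ), HasDerivWithinAt y₁ (negGrad P (y₁ s)) (Iic 0) s)
    (h₂ : ∀ s ∈ Icc 0 τ, HasDerivWithinAt y₂ (negGrad P (y₂ s)) (Icc 0 τ) s)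
    (h₃ : ∀ s ∈ Ici (0 : ℝ), HasDerivWithinAt y₃ (negGrad P (y₃ s)) (Ici 0) s)
    (h₁₂ : y₁ 0 = y₂ 0) (h₂₃ : y₂ τ = y₃ 0) (hbot : Tendsto y₁ atBot (𝓝 q₀))
    (htop : Tendsto y₃ atTop (𝓝 q₁)) :
    ∃ y : ℝ → Plane, IsConnectingOrbit P q₀ q₁ y ∧ ∀ s ∈ Icc 0 τ, y s = y₂ s := by
  let y : ℝ → Plane := fun s => if s ≤ 0 then y₁ s else if s ≤ τ then y₂ s else y₃ (s - τ)
  have e₁ : ∀ s ∈ Iic (0 : ℝ), y s = y₁ s := fun s hs => if_pos hs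
  have e₂ : ∀ s ∈ Icc 0 τ, y s = y₂ s := by
    intro s hs
    rcases hs.1.eq_or_lt with h | h
    · subst h; rw [e₁ 0 self_mem_Iic, h₁₂]
    · simp only [y, if_neg (not_le.2 h), if_pos hs.2]
  have e₃ : ∀ s ∈ Ici τ, y s = y₃ (s - τ) := by
    intro s hs
    rcases (mem_Ici.1 hs).eq_or_lt with h | h
    · subst h; rw [e₂ τ ⟨hτ.le, le_rfl⟩, h₂₃, sub_self]
    · simp only [y, if_neg (not_le.2 (hτ.trans h)), if_neg (not_le.2 h)]
  refine ⟨y, ⟨fun s => ?_, ?_, ?_⟩, e₂⟩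
  · have hcov : (⋃ i : Fin 3, (![Iic 0, Icc 0 τ, Ici τ] : Fin 3 → Set ℝ) i) = univ := by
      refine eq_univ_of_forall fun r => mem_iUnion.2 ?_
      rcases le_total r 0 with h | h
      · exact ⟨0, h⟩
      · rcases le_total r τ with h' | h'
        · exact ⟨1, h, h'⟩
        · exact ⟨2, h'⟩
    rw [← hasDerivWithinAt_univ, ← hcov]
    refine hasDerivWithinAt_iUnion ?_ ?_
    · rw [Fin.forall_fin_succ, Fin.forall_fin_two]
      exact ⟨isClosed_Iic, isClosed_Icc, isClosed_Ici⟩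
    · rw [Fin.forall_fin_succ, Fin.forall_fin_two]
      refine ⟨fun hs => ?_, fun hs => ?_, fun hs => ?_⟩
      · have hs' : s ∈ Iic (0 : ℝ) := hs
        rw [e₁ s hs']
        exact (h₁ s hs').congr e₁ (e₁ s hs')
      · have hs' : s ∈ Icc 0 τ := hs
        rw [e₂ s hs']
        exact (h₂ s hs').congr e₂ (e₂ s hs')
      · have hs' : s ∈ Ici τ := hs
        have hm : MapsTo (fun s => s - τ) (Ici τ) (Ici 0) := fun r hr => mem_Ici.2 (sub_nonneg.2 hr)
        rw [e₃ s hs']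
        have h4 := (h₃ (s - τ) (hm hs')).scomp s ((hasDerivAt_id s).sub_const τ).hasDerivWithinAt hm
        rw [one_smul] at h4
        exact h4.congr e₃ (e₃ s hs')
  · refine hbot.congr' ?_
    filter_upwards [eventually_le_atBot 0] with s hs
    exact (e₁ s hs).symm
  · refine (htop.comp (tendsto_atTop_add_const_right atTop (-τ) tendsto_id)).congr' ?_
    filter_upwards [eventually_ge_atTop τ] with s hs
    rw [e₃ s hs]; rfl

end Connection

end MullerBrown

end

open MullerBrown
theorem mainTheorem2 (P : Params)
    -- the saddle, its unstable eigenvalue and eigenvector, and its validated unstable manifold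
    (q₀ : Plane) (hq₀ : IsSaddle P q₀)
    (lam : ℝ) (hlam : 0 < lam) (v : Phase)
    (hv : Module.End.HasEigenvector (fderiv ℝ (field P) (lift P q₀)).toLinearMap lam v)
    (γ : ℝ) (hγ : 0 < γ) (N : ℕ) (hN : 2 ≤ N)
    (ηp : Fin 6 → ℝ) (hηp : ∀ i, 0 < ηp i)
    (phat : Fin N → Phase) (rbar : ℝ) (hrbar : 0 < rbar)
    (p : ℕ → Phase) (hp : IsValidatedParam P q₀ lam v γ ηp phat rbar p)
    -- the numerical data for the orbit
    (ν : ℝ) (hν : 1 < ν) (M : ℕ) (hM : 1 ≤ M) (K : ℕ) (hK : 1 ≤ K)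
    (τ : ℝ) (hτ : 0 < τ) (t : Fin (M + 1) → ℝ) (ht : StrictMono t)
    (ht₀ : t 0 = 0) (htτ : t (Fin.last M) = τ)
    (η : Fin M → Fin 6 → ℝ) (hη : ∀ m i, 0 < η m i)
    (Xbar : Fin M → Fin 6 → Fin K → ℝ)
    (AK : Matrix (Fin M × Fin 6 × Fin K) (Fin M × Fin 6 × Fin K) ℝ)
    -- the radii polynomials are negative at `ρ`
    (ρ : ℝ) (hρ : 0 < ρ)
    (hP : ∀ m, radiiP P t (powerSum p 1) ν η Xbar AK m ρ < 0)
    (hQ : ∀ m, radiiQ P t (powerSum p 1) ν η Xbar AK m ρ < 0) :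
    ∃ X : Coeffs M, MemX ν X ∧ normX ν η (X - inj Xbar) ≤ ρ ∧
      ∃ Xf : ℝ → Phase, IsPiecewiseCheb t X Xf ∧
        (∀ s ∈ Set.Icc 0 τ, HasDerivWithinAt Xf (field P (Xf s)) (Set.Icc 0 τ) s) ∧
        Xf 0 = powerSum p 1 ∧ Xf 0 ∈ unstableManifold (field P) (lift P q₀) ∧
        ∀ (q₁ : Plane) (U : Set Plane), IsLocalMin (V P) q₁ → IsTrappingRegion P q₁ U →
          proj (Xf τ) ∈ U →
          ∃ y : ℝ → Plane, IsConnectingOrbit P q₀ q₁ y ∧ ∀ s ∈ Set.Icc 0 τ, y s = proj (Xf s) := by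
  have : Fact (1 < ν) := ⟨hν⟩
  have : Nonempty (Fin M) := ⟨⟨0, hM⟩⟩
  obtain ⟨H, hH, hF⟩ := exists_zero P t (powerSum p 1) Xbar AK hM hK ht hη hρ hP hQ
  set x : EllFam ν M := injE ν Xbar + H with hx
  have hX0 : glued t x 0 = powerSum p 1 := by
    have := glued_zero hM ht hF
    rwa [ht₀] at this
  have hode : ∀ s ∈ Set.Icc 0 τ,
      HasDerivWithinAt (glued t x) (field P (glued t x s)) (Set.Icc 0 τ) s := fun s _ => by
    have := hasDerivWithinAt_glued hM ht hF s
    rwa [ht₀, htτ] at this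
  refine ⟨toC x, memX_toC x, ciSup_le fun m => ?_, glued t x, isPiecewiseCheb_glued ht hF, hode, hX0,
    hX0 ▸ powerSum_one_mem_unstableManifold hp hlam, ?_⟩
  · have h1 : toC x - inj Xbar = toC H := by
      rw [← toC_injE (ν := ν), ← toC_sub, hx, add_sub_cancel_left]
    rw [h1, domNorm_toC]
    exact hH m
  · rintro q₁ U hmin ⟨c, h, hh, rfl, hq₁, hconv, hb⟩ hend
    have hcons : ∀ s ∈ Set.Icc 0 τ, ∀ j, conserved P j (glued t x s) = P.α j := fun s hs j => by
      rw [conserved_eq P (convex_Icc 0 τ) hode j hs ⟨le_rfl, hτ.le⟩, hX0, ← backOrbit_zero (lam := lam)]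
      exact conserved_backOrbit hp hlam le_rfl j
    obtain ⟨z, hz0, hzU, hz⟩ := exists_trapped_solution hh hconv.1 hb hend
    refine exists_isConnectingOrbit hτ (y₁ := fun s => proj (backOrbit lam p s)) (y₃ := z)
      (fun s hs => hasDerivWithinAt_proj P (hasDerivWithinAt_powerSum_exp hp hlam hs)
        fun j => conserved_backOrbit hp hlam hs j)
      (fun s hs => hasDerivWithinAt_proj P (hode s hs) (hcons s hs)) hz ?_ hz0.symm ?_
      (tendsto_of_trapped isCompact_square hconv hq₁ hmin hzU hz)
    · simp only [hX0, backOrbit_zero]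
    · have h1 := (projL.continuous.tendsto _).comp (tendsto_backOrbit hp hlam)
      rw [projL_apply, proj_lift] at h1
      exact h1
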